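/- **Setting.** Let $N\ge 2$ and $\hbar>0$. For $\Lambda>0$ and $\boldsymbol\delta\in\mathbb C^N$ with $|\mathrm{Im}\,\delta_k|<\hbar/2$ for all $k$, put $\vartheta(\mu)=\prod_{k=1}^N(\mu-\delta_k)$, $\Theta(\mu)=\Lambda^{-2N}\vartheta(\mu-\tfrac{i\hbar}2)\vartheta(\mu+\tfrac{i\hbar}2)$, and consider the nonlinear integral equation for a bounded continuous nowhere vanishing $X_{\boldsymbol\delta}=X_{\boldsymbol\delta,\Lambda}:\mathbb R\to\mathbb C$, $$\log\big(X_{\boldsymbol\delta}(\mu)\Theta(\mu)\big)=\int_{\mathbb R}\frac{d\mu'}{2\pi i}\,\frac{2i\hbar}{(\mu-\mu')^2+\hbar^2}\,\log(1+X_{\boldsymbol\delta}(\mu')) ,$$ with principal logarithms. A *family of solutions* over an open set $D$ of such parameters $(\boldsymbol\delta,\Lambda)$ consists of a solution $X_{\boldsymbol\delta,\Lambda}$ with $\mathrm{Re}\,X_{\boldsymbol\delta,\Lambda}>-\frac12$ for each $(\boldsymbol\delta,\Lambda)\in D$ (automatic if $X>0$ or $|X|<\frac12$), depending continuously on $(\boldsymbol\delta,\Lambda)$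 in the sup norm. Let $$\mathcal Y=\mathcal Y^{\rm pert}+\mathcal Y^{\rm inst},\qquad \mathcal Y^{\rm pert}(\boldsymbol\delta,\Lambda)=\frac{iN}{\hbar}(\log\hbar-\log\Lambda)\sum_j\delta_j^2+\sum_{j,k=1}^N\varpi(\delta_k-\delta_j),$$ $$\mathcal Y^{\rm inst}(\boldsymbol\delta,\Lambda)=-\int_{\mathbb R}\frac{d\mu}{2\pi i}\Big\{\tfrac12\log(X_{\boldsymbol\delta}(\mu)\Theta(\mu))\log(1+X_{\boldsymbol\delta}(\mu))+\mathrm{Li}_2(-X_{\boldsymbol\delta}(\mu))\Big\},$$ where $\varpi'(\lambda)=\log\Gamma(1+i\lambda/\hbar)$ for $\mathrm{Im}\,\lambda<\hbar$, $\varpi(0)=0$, and $\log\Gamma$ is the holomorphic branch on the right half plane with $\log\Gamma(1)=0$. Let, for $\mathrm{Im}\,\lambda>-\hbar/2$ and $\mathrm{Im}\,\lambda<\hbar/2$ respectively, $$Q^+_{\boldsymbol\delta}(\lambda)=\Big(\frac\hbar\Lambda\Big)^{\frac{iN\lambda}\hbar}\frac{e^{-N\pi\lambda/\hbar}\,v_\uparrow(\lambda)}{\prod_k\Gamma(1-i(\lambda-\delta_k)/\hbar)},\qquad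 \log v_\uparrow(\lambda)=-\int_{\mathbb R}\frac{d\mu}{2\pi i}\frac{\log(1+X_{\boldsymbol\delta}(\mu))}{\lambda-\mu+i\hbar/2},$$ $$Q^-_{\boldsymbol\delta}(\lambda)=\Big(\frac\Lambda\hbar\Big)^{\frac{iN\lambda}\hbar}\frac{e^{-N\pi\lambda/\hbar}\,v_\downarrow(\lambda-i\hbar)}{\prod_k\Gamma(1+i(\lambda-\delta_k)/\hbar)},\qquad \log v_\downarrow(\lambda-i\hbar)=\int_{\mathbb R}\frac{d\mu}{2\pi i}\frac{\log(1+X_{\boldsymbol\delta}(\mu))}{\lambda-\mu-i\hbar/2},$$ and define $\eta_j=\frac1{2\pi i}\big(\log Q^+_{\boldsymbol\delta}(\delta_j)-\log Q^-_{\boldsymbol\delta}(\delta_j)\big)$, the logarithms being read off from these formulae with the above branch of $\log\Gamma$. **Theorem.** (0) There is a continuous positive function $\Lambda_0(\boldsymbol\delta)$ on $\{|\mathrm{Im}\,\delta_k|<\hbar/2\}$ such that a family of solutions exists over $\{0<\Lambda<\Lambda_0(\boldsymbol\delta)\}$. For every family of solutions over an open set $D$ the following holds at all points $(\boldsymbol\delta,\Lambda)\in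 D$ (and in (4) for the corresponding $\boldsymbol\sigma$). (1) $Q^\pm_{\boldsymbol\delta}$ extend to entire functions, and there is a monic polynomial $t(\lambda)=\lambda^N+E_1\lambda^{N-1}+E_2\lambda^{N-2}+\dots+E_N$ such that both solve the Baxter equation $t(\lambda)q(\lambda)=\Lambda^N\big(i^Nq(\lambda+i\hbar)+i^{-N}q(\lambda-i\hbar)\big)$; moreover $E_1=-\sum_j\delta_j$. With $\sigma_j=\frac i\hbar\delta_j$, the Floquet series $$F^{(0)}_j(z)=\sum_{n\in\mathbb Z}Q^+_{\boldsymbol\delta}(\delta_j-i\hbar n)z^{\sigma_j+n},\qquad F^{(\infty)}_j(z)=\sum_{n\in\mathbb Z}Q^-_{\boldsymbol\delta}(\delta_j-i\hbar n)z^{\sigma_j+n}$$ converge absolutely on the universal cover of $\mathbb C^\times$ and solve the oper equation $t(-i\hbar z\partial_z)\chi=\Lambda^N(i^Nz+i^{-N}z^{-1})\chi$; if the $\delta_j$ are distinct, the $N$ functions $F^{(0)}_j$ are linearly independent, and so are the $F^{(\infty)}_j$. The numbers $\eta_j$ are the connection coefficients: $Q^+_{\boldsymbol\delta}(\delta_j-i\hbar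 n)=e^{2\pi i\eta_j}Q^-_{\boldsymbol\delta}(\delta_j-i\hbar n)$ for all $n\in\mathbb Z$, with $Q^\pm_{\boldsymbol\delta}(\delta_j)\ne0$, and $F^{(0)}_j=e^{2\pi i\eta_j}F^{(\infty)}_j$. (2) $\displaystyle\frac{\partial\mathcal Y}{\partial\delta_j}=2\pi i\,\eta_j$ for $j=1,\dots,N$. (3) $\displaystyle i\hbar\,\frac{\partial\mathcal Y}{\partial\log\Lambda^{2N}}=\tfrac12E_1^2-E_2$; in particular it equals $u:=-E_2$ when $\sum_j\delta_j=0$. (4) The function $\mathcal S(\boldsymbol\sigma,\Lambda):=\mathcal Y(\boldsymbol\delta,\Lambda)|_{\boldsymbol\delta=-i\hbar\boldsymbol\sigma}$ satisfies $\partial\mathcal S/\partial\sigma_j=2\pi\hbar\,\eta_j$. In particular it is a generating function of the oper locus $\boldsymbol\sigma\mapsto(\boldsymbol\sigma,\boldsymbol\eta(\boldsymbol\sigma,\Lambda))$, $\sum_j\sigma_j=0$, i.e. $d\mathcal S=2\pi\hbar\sum_j\eta_j\,d\sigma_j$ along the hyperplane $\sum_j\sigma_j=0$. Conversely, at fixed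 $\Lambda$ every generating function of the oper locus agrees with $\mathcal Y(-i\hbar\boldsymbol\sigma,\Lambda)$ up to an additive constant, if $\{\boldsymbol\sigma:\sum_j\sigma_j=0,\ (-i\hbar\boldsymbol\sigma,\Lambda)\in D\}$ is connected; and a function $\mathcal S(\boldsymbol\sigma,\Lambda)$ which is a generating function for every $\Lambda$ and satisfies $i\hbar\,\partial\mathcal S/\partial\log\Lambda^{2N}=-E_2$ agrees with it up to one additive constant, if $\{(\boldsymbol\sigma,\Lambda):\sum_j\sigma_j=0,\ (-i\hbar\boldsymbol\sigma,\Lambda)\in D\}$ is connected. -/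

import Mathlib

open Complex Filter Topology MeasureTheory

namespace TodaYangYang

noncomputable section

/-! ### Special functions -/

/-- The branch of `log Γ` on the half plane `Re s > 0` that vanishes at `s = 1`:
the primitive of the digamma function `Γ'/Γ` along the segment from `1` to `s`. -/
def logGamma (s : ℂ) : ℂ :=
  ∫ t in (0 : ℝ)..1, (s - 1) * Complex.digamma (1 + (t : ℂ) * (s - 1))

/-- `ϖ`, the primitive of `logΓ(1 + i x / ħ)` along the segment from `0` to `x`. -/
def varpi (ħ : ℝ) (x : ℂ) : ℂ :=
  ∫ t in (0 : ℝ)..1, x * logGamma (1 + I * ((t : ℂ) * x) / ħ)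

/-- The dilogarithm `Li₂(z) = ∫_z^0 log(1-t)/t dt`, along the segment from `z` to `0`. -/
def dilog (z : ℂ) : ℂ :=
  -∫ t in (0 : ℝ)..1, Complex.log (1 - (t : ℂ) * z) / (t : ℂ)

/-! ### The nonlinear integral equation -/

/-- The parameters `δ` with `|Im δ_k| < ħ/2` for all `k`. -/
def strip (N : ℕ) (ħ : ℝ) : Set (Fin N → ℂ) :=
  {δ | ∀ k, |(δ k).im| < ħ / 2}

/-- `ϑ(μ) = ∏ₖ (μ - δₖ)`. -/
def vartheta {N : ℕ} (δ : Fin N → ℂ) (μ : ℂ) : ℂ := ∏ k, (μ - δ k)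

/-- `Θ(μ) = Λ^{-2N} ϑ(μ - iħ/2) ϑ(μ + iħ/2)`. -/
def Theta {N : ℕ} (ħ : ℝ) (δ : Fin N → ℂ) (Λ : ℝ) (μ : ℂ) : ℂ :=
  ((Λ : ℂ) ^ (2 * N))⁻¹ * (vartheta δ (μ - I * ħ / 2) * vartheta δ (μ + I * ħ / 2))

/-- `X` is a (continuous, bounded, nowhere zero) solution on the real line of
`log (X(μ) Θ(μ)) = ∫ dμ'/(2πi) · 2iħ / ((μ-μ')² + ħ²) · log (1 + X(μ'))`. -/
structure IsNLIESolution {N : ℕ} (ħ : ℝ) (δ : Fin N → ℂ) (Λ : ℝ) (X : ℝ → ℂ) : Prop where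
  continuous : Continuous X
  bounded : ∃ B : ℝ, ∀ μ, ‖X μ‖ ≤ B
  ne_zero : ∀ μ, X μ ≠ 0
  equation : ∀ μ : ℝ, Complex.log (X μ * Theta ħ δ Λ μ) =
    ∫ μ' : ℝ, 1 / (2 * Real.pi * I) * (2 * I * ħ / (((μ : ℂ) - μ') ^ 2 + (ħ : ℂ) ^ 2)) *
      Complex.log (1 + X μ')

/-- A family `X_{δ,Λ}`, `(δ,Λ) ∈ D`, of solutions of the nonlinear integral equation over an open
set `D` of parameters with `|Im δ_k| < ħ/2` and `Λ > 0`, which depends continuously on the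
parameters (in the sup norm). The condition `Re X > -1/2` says that `|X| < |1 + X|`, i.e. that the
iteration of the equation is contracting at `X`. It holds if `X` is positive, and
if `|X| < 1/2`. -/
structure IsSolutionFamily {N : ℕ} (ħ : ℝ) (D : Set ((Fin N → ℂ) × ℝ))
    (X : (Fin N → ℂ) × ℝ → ℝ → ℂ) : Prop where
  isOpen : IsOpen D
  mem_strip : ∀ p ∈ D, p.1 ∈ strip N ħ
  pos : ∀ p ∈ D, 0 < p.2
  solution : ∀ p ∈ D, IsNLIESolution ħ p.1 p.2 (X p)
  contracting : ∀ p ∈ D, ∀ μ, -(1 / 2) < (X p μ).re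
  continuous : ∀ p ∈ D, TendstoUniformly X (X p) (𝓝 p)

/-! ### The Yang-Yang function -/

/-- The perturbative part of the Yang-Yang function. -/
def YPert {N : ℕ} (ħ : ℝ) (δ : Fin N → ℂ) (Λ : ℝ) : ℂ :=
  N * (I / ħ) * ((Real.log ħ : ℂ) - (Real.log Λ : ℂ)) * ∑ j, δ j ^ 2 +
    ∑ j, ∑ k, varpi ħ (δ k - δ j)

/-- The instanton part of the Yang-Yang function, in terms of `X = X_{δ,Λ}`. -/
def YInst {N : ℕ} (ħ : ℝ) (δ : Fin N → ℂ) (Λ : ℝ) (X : ℝ → ℂ) : ℂ :=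
  -∫ μ : ℝ, 1 / (2 * Real.pi * I) *
    (Complex.log (X μ * Theta ħ δ Λ μ) / 2 * Complex.log (1 + X μ) + dilog (-X μ))

/-- The Yang-Yang function `𝒴(δ, Λ)` built from a family of solutions `X`. -/
def YangYang {N : ℕ} (ħ : ℝ) (X : (Fin N → ℂ) × ℝ → ℝ → ℂ) (δ : Fin N → ℂ) (Λ : ℝ) : ℂ :=
  YPert ħ δ Λ + YInst ħ δ Λ (X (δ, Λ))

/-! ### Solutions of the Baxter equation -/

/-- `log v_↑(x)`, for `Im x > -ħ/2`. -/
def logVUp (ħ : ℝ) (X : ℝ → ℂ) (x : ℂ) : ℂ :=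
  -∫ μ : ℝ, 1 / (2 * Real.pi * I) * (1 / (x - μ + I * ħ / 2)) * Complex.log (1 + X μ)

/-- `log v_↓(x - iħ)`, for `Im x < ħ/2`. -/
def logVDown (ħ : ℝ) (X : ℝ → ℂ) (x : ℂ) : ℂ :=
  ∫ μ : ℝ, 1 / (2 * Real.pi * I) * (1 / (x - μ - I * ħ / 2)) * Complex.log (1 + X μ)

/-- The explicit formula for `Q⁺_δ(x)`, for `Im x > -ħ/2`. -/
def QPlusFormula {N : ℕ} (ħ : ℝ) (δ : Fin N → ℂ) (Λ : ℝ) (X : ℝ → ℂ) (x : ℂ) : ℂ :=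
  ((ħ / Λ : ℝ) : ℂ) ^ (I * N * x / ħ) * exp (-(N * Real.pi * x / ħ)) * exp (logVUp ħ X x) /
    ∏ k, Complex.Gamma (1 - I * (x - δ k) / ħ)

/-- The explicit formula for `Q⁻_δ(x)`, for `Im x < ħ/2`. -/
def QMinusFormula {N : ℕ} (ħ : ℝ) (δ : Fin N → ℂ) (Λ : ℝ) (X : ℝ → ℂ) (x : ℂ) : ℂ :=
  ((Λ / ħ : ℝ) : ℂ) ^ (I * N * x / ħ) * exp (-(N * Real.pi * x / ħ)) * exp (logVDown ħ X x) /
    ∏ k, Complex.Gamma (1 + I * (x - δ k) / ħ)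

/-- The determination of `log Q⁺_δ(x)`, for `Im x > -ħ/2`, obtained from the explicit formula. -/
def logQPlus {N : ℕ} (ħ : ℝ) (δ : Fin N → ℂ) (Λ : ℝ) (X : ℝ → ℂ) (x : ℂ) : ℂ :=
  I * N * x / ħ * ((Real.log ħ : ℂ) - (Real.log Λ : ℂ)) - N * Real.pi * x / ħ + logVUp ħ X x -
    ∑ k, logGamma (1 - I * (x - δ k) / ħ)

/-- The determination of `log Q⁻_δ(x)`, for `Im x < ħ/2`, obtained from the explicit formula. -/
def logQMinus {N : ℕ} (ħ : ℝ) (δ : Fin N → ℂ) (Λ : ℝ) (X : ℝ → ℂ) (x : ℂ) : ℂ :=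
  I * N * x / ħ * ((Real.log Λ : ℂ) - (Real.log ħ : ℂ)) - N * Real.pi * x / ħ + logVDown ħ X x -
    ∑ k, logGamma (1 + I * (x - δ k) / ħ)

/-- The Baxter equation `t(x) q(x) = Λ^N (i^N q(x + iħ) + i^{-N} q(x - iħ))`. -/
def IsBaxterSolution (N : ℕ) (ħ Λ : ℝ) (t : Polynomial ℂ) (q : ℂ → ℂ) : Prop :=
  ∀ x : ℂ, t.eval x * q x =
    (Λ : ℂ) ^ N * (I ^ N * q (x + I * ħ) + (I ^ N)⁻¹ * q (x - I * ħ))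

/-- `Qp`, `Qm` are the entire functions `Q^±_δ` (analytic continuations of the explicit formulae)
and `t = t_δ` is the monic polynomial of degree `N` such that both solve the Baxter equation
with `t` on the left side. All three are uniquely determined by these conditions. -/
structure IsBaxterData {N : ℕ} (ħ : ℝ) (δ : Fin N → ℂ) (Λ : ℝ) (X : ℝ → ℂ)
    (Qp Qm : ℂ → ℂ) (t : Polynomial ℂ) : Prop where
  entire_plus : Differentiable ℂ Qp
  entire_minus : Differentiable ℂ Qm
  eq_plus : ∀ x : ℂ, -(ħ / 2) < x.im → Qp x = QPlusFormula ħ δ Λ X x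
  eq_minus : ∀ x : ℂ, x.im < ħ / 2 → Qm x = QMinusFormula ħ δ Λ X x
  monic : t.Monic
  natDegree : t.natDegree = N
  baxter_plus : IsBaxterSolution N ħ Λ t Qp
  baxter_minus : IsBaxterSolution N ħ Λ t Qm

/-! ### Opers and Floquet solutions

Multivalued functions of `z ∈ ℂ \ {0}` are written as functions of `w = log z`. -/

/-- `ψ(w) = χ(e^w)` solves the oper equation
`t(-iħ z ∂_z) χ(z) = Λ^N (i^N z + i^{-N} z⁻¹) χ(z)`. -/
def IsOperSolution (N : ℕ) (ħ Λ : ℝ) (t : Polynomial ℂ) (ψ : ℂ → ℂ) : Prop :=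
  Differentiable ℂ ψ ∧ ∀ w : ℂ,
    ∑ k ∈ Finset.range (t.natDegree + 1), t.coeff k * (-(I * ħ)) ^ k * iteratedDeriv k ψ w =
      (Λ : ℂ) ^ N * (I ^ N * exp w + (I ^ N)⁻¹ * exp (-w)) * ψ w

/-- The `n`-th term `Q(d - iħn) z^{σ + n}` of the Floquet series, where `σ = i d / ħ`, `z = e^w`. -/
def floquetTerm (ħ : ℝ) (Q : ℂ → ℂ) (d w : ℂ) (n : ℤ) : ℂ :=
  Q (d - I * ħ * n) * exp ((I * d / ħ + n) * w)

/-- The Floquet series `∑_{n ∈ ℤ} Q(d - iħn) z^{σ + n}`, where `σ = i d / ħ` and `z = e^w`. -/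
def floquet (ħ : ℝ) (Q : ℂ → ℂ) (d w : ℂ) : ℂ := ∑' n : ℤ, floquetTerm ħ Q d w n

/-- `η_j = (log Q⁺_δ(δ_j) - log Q⁻_δ(δ_j)) / (2πi)`. That these numbers are the connection
coefficients of the Floquet bases is part of the theorem. -/
def eta {N : ℕ} (ħ : ℝ) (X : (Fin N → ℂ) × ℝ → ℝ → ℂ) (p : (Fin N → ℂ) × ℝ) (j : Fin N) : ℂ :=
  (logQPlus ħ p.1 p.2 (X p) (p.1 j) - logQMinus ħ p.1 p.2 (X p) (p.1 j)) / (2 * Real.pi * I)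

/-! ### Generating functions of the oper locus -/

/-- The value of `δ` that belongs to `σ`, i.e. `δ = -iħσ`. -/
def deltaOf {N : ℕ} (ħ : ℝ) (σ : Fin N → ℂ) : Fin N → ℂ := (-(I * ħ)) • σ

/-- The pairs `(σ, Λ)` with `∑ σ_j = 0` and `(-iħσ, Λ) ∈ D`. -/
def operDomain {N : ℕ} (ħ : ℝ) (D : Set ((Fin N → ℂ) × ℝ)) : Set ((Fin N → ℂ) × ℝ) :=
  {q | ∑ j, q.1 j = 0 ∧ (deltaOf ħ q.1, q.2) ∈ D}

/-- `S(σ, Λ)` is, at the given `Λ`, a generating function of the locus `σ ↦ (σ, η(-iħσ, Λ))`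
in the space with coordinates `(σ, η)`, `∑ σ_j = 0`: one has
`dS = 2πħ ∑ η_j dσ_j` along the hyperplane `∑ σ_j = 0`. -/
def IsGeneratingFunctionAt {N : ℕ} (ħ : ℝ) (D : Set ((Fin N → ℂ) × ℝ))
    (η : (Fin N → ℂ) × ℝ → Fin N → ℂ) (S : (Fin N → ℂ) → ℝ → ℂ) (Λ : ℝ) : Prop :=
  ∀ σ : Fin N → ℂ, (σ, Λ) ∈ operDomain ħ D → ∀ v : Fin N → ℂ, ∑ j, v j = 0 →
    HasDerivAt (fun s : ℂ => S (σ + s • v) Λ)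
      (2 * Real.pi * ħ * ∑ j, η (deltaOf ħ σ, Λ) j * v j) 0

/-- `c` is the value of `iħ ∂f/∂ log Λ^{2N}` at `Λ`. -/
def HasLogDeriv (N : ℕ) (ħ : ℝ) (f : ℝ → ℂ) (c : ℂ) (Λ : ℝ) : Prop :=
  ∃ d : ℂ, HasDerivAt (fun l : ℝ => f (Real.exp (l / (2 * N)))) d (Real.log (Λ ^ (2 * N))) ∧
    I * ħ * d = c

end

end TodaYangYang

namespace TodaYangYang

noncomputable section

/-! ### Primitives along segments -/

/-! Write L = log(1+X), and let P be convolution with the Poisson kernel, which is symmetric and has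
mass one. The integral equation says log(XΘ) = PL, so the instanton integral is ∫ (½ L·PL +
Li₂(-X)). This functional is stationary under variations of X. If Θ is divided by e^r and L changes
by ΔL, then X is multiplied by e^y with y = PΔL + r. To first order Li₂(-X) changes by -yL, the
symmetry of P makes the quadratic term change by ∫ L·PΔL, and only -∫ rL survives. Hence no
differentiability of X in the parameters is needed, only PΔL = O(r) in sup norm. That bound follows
from the contraction factor |X/(1+X)|, which is uniformly below 1 because Re X > -1/2 and X decays.
`IsSolutionFamily.exists_variation` records the resulting O(r²) remainder. Taking r along δ produces
log v_↑ - log v_↓ at δ_j, and the perturbative part supplies the Gamma factors and powers. Taking r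
along log Λ produces ∫ L.

For the Baxter equation, X is continued to a thin strip around ℝ, where log(1+X) = A + B with A and
B holomorphic and bounded in overlapping half planes (`IsNLIESolution.exists_factorization`). The
integral equation becomes the jump relation e^A e^B = 1 + e^{A(·+iħ)} e^{B(·-iħ)}/Θ. It makes three
formulae for t agree on overlapping regions, so t is entire of growth of order |x|^N, hence a
polynomial (`IsFactorization.exists_transfer`). Its expansion along the imaginary axis gives E₁ and
expresses E₁²/2 - E₂ through ∑ δ_k² and ∫ L (`transfer_coeff`), which is the same expression as the
Λ-derivative of the Yang-Yang function. The functions Q^± are Gamma factors times e^A or e^B. They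
satisfy the Baxter equation in half planes, and the equation itself continues them to entire
functions.

At δ_j the polynomial ϑ vanishes, and t(δ_j) is the sum of the two ratios that shift Q⁺ up and Q⁻
down. Therefore Q⁺ and e^{2πiη_j} Q⁻ agree at δ_j and at δ_j - iħ, and the three term recurrence
propagates this along the whole lattice (`IsFactorization.connection`). Each of Q^± has
superexponentially small values in one lattice direction, so proportionality gives decay in both and
the Floquet series converge. Their independence is that of eigenvectors of the monodromy.

Finally, two generating functions differ by a function with vanishing derivative along segments,
which is locally constant and hence constant on a preconnected domain. -/

theorem hasDerivAt_segment_primitive {s : Set ℂ} (hs : Convex ℝ s) (hso : IsOpen s) {f : ℂ → ℂ}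
    (hf : DifferentiableOn ℂ f s) {c x : ℂ} (hc : c ∈ s) (hx : x ∈ s) :
    HasDerivAt (fun x : ℂ => ∫ t in (0 : ℝ)..1, (x - c) * f (c + (t : ℂ) * (x - c))) (f x) x := by
  -- Convexity provides a global primitive F. The segment integral is then F y - F c, so nothing has
  -- to be differentiated under the integral sign.
  obtain ⟨F, hF⟩ := hs.exists_forall_hasDerivWithinAt hf
  have hF' : ∀ a ∈ s, HasDerivAt F (f a) a := fun a ha => (hF a ha).hasDerivAt (hso.mem_nhds ha)
  have key : ∀ y ∈ s, ∫ t in (0 : ℝ)..1, (y - c) * f (c + (t : ℂ) * (y - c)) = F y - F c := by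
    intro y hy
    have hmem : ∀ t ∈ Set.uIcc (0 : ℝ) 1, c + (t : ℂ) * (y - c) ∈ s := by
      intro t ht
      rw [Set.uIcc_of_le zero_le_one] at ht
      have := hs.add_smul_sub_mem hc hy ht
      simpa [Complex.real_smul] using this
    have hline : ∀ t : ℝ, HasDerivAt (fun t : ℝ => c + (t : ℂ) * (y - c)) (y - c) t := by
      intro t
      have := ((Complex.ofRealCLM.hasDerivAt (x := t)).mul_const (y - c)).const_add c
      simpa using this
    have h := intervalIntegral.integral_eq_sub_of_hasDerivAt
      (f := fun t : ℝ => F (c + (t : ℂ) * (y - c)))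
      (f' := fun t : ℝ => (y - c) * f (c + (t : ℂ) * (y - c))) (a := 0) (b := 1) ?_ ?_
    · rw [h]; simp
    · intro t ht
      rw [mul_comm]
      exact (hF' _ (hmem t ht)).comp t (hline t)
    · apply ContinuousOn.intervalIntegrable
      refine continuousOn_const.mul (hf.continuousOn.comp ?_ hmem)
      fun_prop
  refine ((hF' x hx).sub_const (F c)).congr_of_eventuallyEq ?_
  filter_upwards [hso.mem_nhds hx] with y hy using key y hy

theorem convex_re_pos : Convex ℝ {s : ℂ | 0 < s.re} := convex_halfSpace_re_gt 0

theorem isOpen_re_pos : IsOpen {s : ℂ | 0 < s.re} :=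
  isOpen_lt continuous_const Complex.continuous_re

theorem ne_neg_nat_of_re_pos {s : ℂ} (hs : 0 < s.re) (m : ℕ) : s ≠ -(m : ℂ) := by
  rintro rfl
  simp at hs
  linarith [Nat.cast_nonneg (α := ℝ) m]

theorem differentiableOn_digamma : DifferentiableOn ℂ Complex.digamma {s : ℂ | 0 < s.re} := by
  have hG : DifferentiableOn ℂ Complex.Gamma {s : ℂ | 0 < s.re} := fun s hs =>
    (Complex.differentiableAt_Gamma s (ne_neg_nat_of_re_pos hs)).differentiableWithinAt
  have : Complex.digamma = fun s => deriv Complex.Gamma s / Complex.Gamma s := by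
    ext s; rfl
  rw [this]
  exact (hG.deriv isOpen_re_pos).div hG fun s hs => Complex.Gamma_ne_zero_of_re_pos hs

theorem hasDerivAt_logGamma {s : ℂ} (hs : 0 < s.re) :
    HasDerivAt logGamma (Complex.digamma s) s :=
  hasDerivAt_segment_primitive convex_re_pos isOpen_re_pos differentiableOn_digamma
    (c := 1) (by simp) hs

theorem logGamma_one : logGamma 1 = 0 := by simp [logGamma]

/-- The quotient of the two sides has vanishing derivative on a convex set and equals 1 at s = 1. -/
theorem exp_logGamma {s : ℂ} (hs : 0 < s.re) : exp (logGamma s) = Complex.Gamma s := by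
  have hder : ∀ z ∈ {s : ℂ | 0 < s.re},
      HasDerivAt (fun z => exp (-logGamma z) * Complex.Gamma z) 0 z := by
    intro z hz
    have hG := (Complex.differentiableAt_Gamma z (ne_neg_nat_of_re_pos hz)).hasDerivAt
    have h0 : Complex.Gamma z ≠ 0 := Complex.Gamma_ne_zero_of_re_pos hz
    have hd : Complex.digamma z = deriv Complex.Gamma z / Complex.Gamma z := rfl
    refine ((hasDerivAt_logGamma hz).neg.cexp.mul hG).congr_deriv ?_
    rw [hd]
    field_simp
    ring
  have := convex_re_pos.is_const_of_fderivWithin_eq_zero (𝕜 := ℂ)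
    (f := fun z => exp (-logGamma z) * Complex.Gamma z)
    (fun z hz => (hder z hz).differentiableAt.differentiableWithinAt)
    (fun z hz => by
      rw [fderivWithin_of_isOpen isOpen_re_pos hz]
      ext; simp [(hder z hz).deriv]) hs (show (1 : ℂ) ∈ {s : ℂ | 0 < s.re} by simp)
  simp only [logGamma_one, Complex.Gamma_one, neg_zero, Complex.exp_zero, mul_one] at this
  rw [Complex.exp_neg] at this
  have h0 := Complex.exp_ne_zero (logGamma s)
  field_simp at this
  exact this.symm

/-- The condition on Im x says exactly that 1 + ix/ħ lies in the right half plane, where `logGamma`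
is holomorphic. -/
theorem hasDerivAt_varpi {ħ : ℝ} (hħ : 0 < ħ) {x : ℂ} (hx : x.im < ħ) :
    HasDerivAt (varpi ħ) (logGamma (1 + I * x / ħ)) x := by
  have hre : ∀ y : ℂ, (1 + I * y / ħ).re = 1 - y.im / ħ := by
    intro y; rw [Complex.add_re, Complex.div_ofReal_re]; simp; ring
  have hf : DifferentiableOn ℂ (fun y : ℂ => logGamma (1 + I * y / ħ)) {y : ℂ | y.im < ħ} := by
    intro y hy
    refine DifferentiableAt.differentiableWithinAt ?_
    have hpos : 0 < (1 + I * y / ħ).re := by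
      rw [hre, sub_pos, div_lt_one hħ]; exact hy
    have hin : DifferentiableAt ℂ (fun y : ℂ => 1 + I * y / ħ) y := by fun_prop
    exact DifferentiableAt.comp y (hasDerivAt_logGamma hpos).differentiableAt hin
  have := hasDerivAt_segment_primitive (convex_halfSpace_im_lt ħ)
    (isOpen_lt Complex.continuous_im continuous_const) hf (c := 0) (by simpa using hħ) hx
  refine this.congr_of_eventuallyEq (Eventually.of_forall fun y => ?_)
  simp [varpi]

/-! ### The dilogarithm -/

theorem one_sub_mem_slitPlane {z : ℂ} (hz : z.re < 1) : 1 - z ∈ slitPlane :=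
  Or.inl (by simpa using hz)

/-- The singularity of log(1-w)/w at w = 0 is removable; `dslope` is its holomorphic extension up to
sign. Giving the product z·d instead of d itself keeps z = 0 from being a special case. -/
theorem hasDerivAt_dilog {z : ℂ} (hz : z.re < 1) :
    ∃ d : ℂ, HasDerivAt dilog d z ∧ z * d = -Complex.log (1 - z) := by
  set s : Set ℂ := {z : ℂ | z.re < 1} with hs
  have hso : IsOpen s := isOpen_lt Complex.continuous_re continuous_const
  have h0 : (0 : ℂ) ∈ s := by simp [hs]
  have hl : DifferentiableOn ℂ (fun w : ℂ => -Complex.log (1 - w)) s := fun w hw =>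
    (((differentiableAt_id.const_sub 1).clog
      (one_sub_mem_slitPlane hw)).neg).differentiableWithinAt
  have hg : DifferentiableOn ℂ (dslope (fun w : ℂ => -Complex.log (1 - w)) 0) s :=
    (Complex.differentiableOn_dslope (hso.mem_nhds h0)).2 hl
  have hval : ∀ w : ℂ, w * dslope (fun w : ℂ => -Complex.log (1 - w)) 0 w
      = -Complex.log (1 - w) := by
    intro w
    have := sub_smul_dslope (fun w : ℂ => -Complex.log (1 - w)) 0 w
    simpa using this
  refine ⟨_, (hasDerivAt_segment_primitive (convex_halfSpace_re_lt 1) hso hg h0 hz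
    ).congr_of_eventuallyEq (Eventually.of_forall fun y => ?_), hval z⟩
  simp only [dilog, sub_zero, zero_add]
  rw [← intervalIntegral.integral_neg]
  -- Only 0 < t ≤ 1 is compared: at t = 0 the quotient takes the default value 0 and differs from
  -- the removable one.
  refine intervalIntegral.integral_congr_ae (Eventually.of_forall fun t ht => ?_)
  rw [Set.uIoc_of_le zero_le_one] at ht
  have ht0 : (t : ℂ) ≠ 0 := by exact_mod_cast ht.1.ne'
  rw [← neg_div, ← hval, mul_assoc, mul_div_cancel_left₀ _ ht0]

theorem continuousAt_dilog {z : ℂ} (hz : z.re < 1) : ContinuousAt dilog z := by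
  obtain ⟨d, hd, -⟩ := hasDerivAt_dilog hz
  exact hd.continuousAt

/-- `d/ds Li₂(-x e^s) = -log (1 + x e^s)`. -/
theorem hasDerivAt_dilog_neg_mul_exp {x s : ℂ} (h : -1 < (x * exp s).re) :
    HasDerivAt (fun s => dilog (-(x * exp s))) (-Complex.log (1 + x * exp s)) s := by
  obtain ⟨d, hd, hd'⟩ := hasDerivAt_dilog (z := -(x * exp s)) (by rw [Complex.neg_re]; linarith)
  have h1 : HasDerivAt (fun s => -(x * exp s)) (-(x * exp s)) s :=
    ((Complex.hasDerivAt_exp s).const_mul x).neg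
  have := HasDerivAt.comp s hd h1
  rw [mul_comm, hd', sub_neg_eq_add] at this
  exact this

/-! ### Convolution with the Poisson kernel -/

/-- The Poisson kernel `ħ / (π (t² + ħ²))`. -/
def poissonKer (ħ t : ℝ) : ℝ := ħ / (Real.pi * (t ^ 2 + ħ ^ 2))

/-- Convolution with the Poisson kernel. -/
def poisson (ħ : ℝ) (L : ℝ → ℂ) (μ : ℝ) : ℂ := ∫ μ' : ℝ, (poissonKer ħ (μ - μ') : ℂ) * L μ'

section Poisson

variable {ħ : ℝ}

theorem poissonKer_nonneg (hħ : 0 < ħ) (t : ℝ) : 0 ≤ poissonKer ħ t := by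
  unfold poissonKer; positivity

theorem poissonKer_neg (t : ℝ) : poissonKer ħ (-t) = poissonKer ħ t := by simp [poissonKer]

theorem poissonKer_eq (hħ : 0 < ħ) (t : ℝ) :
    poissonKer ħ t = (Real.pi * ħ)⁻¹ * (1 + (t / ħ) ^ 2)⁻¹ := by
  unfold poissonKer
  have := Real.pi_pos
  have : 0 < ħ ^ 2 + t ^ 2 := by positivity
  field_simp
  rw [add_comm]

theorem continuous_poissonKer (hħ : 0 < ħ) : Continuous (poissonKer ħ) := by
  unfold poissonKer
  refine continuous_const.div (by fun_prop) fun t => ?_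
  have := Real.pi_pos
  positivity

theorem integrable_poissonKer (hħ : 0 < ħ) : Integrable (poissonKer ħ) := by
  have h := (integrable_inv_one_add_sq.comp_div hħ.ne').const_mul (Real.pi * ħ)⁻¹
  exact h.congr (Eventually.of_forall fun t => (poissonKer_eq hħ t).symm)

theorem integral_poissonKer (hħ : 0 < ħ) : ∫ t, poissonKer ħ t = 1 := by
  simp_rw [poissonKer_eq hħ]
  rw [integral_const_mul, Measure.integral_comp_div (fun x : ℝ => (1 + x ^ 2)⁻¹),
    integral_univ_inv_one_add_sq, abs_of_pos hħ, smul_eq_mul]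
  have := Real.pi_pos
  field_simp

theorem poissonKer_le (hħ : 0 < ħ) (t : ℝ) : poissonKer ħ t ≤ (Real.pi * ħ)⁻¹ := by
  rw [poissonKer_eq hħ]
  have := Real.pi_pos
  refine mul_le_of_le_one_right (by positivity) (inv_le_one_of_one_le₀ ?_)
  nlinarith [sq_nonneg (t / ħ)]

theorem integrable_poissonKer_mul (hħ : 0 < ħ) {L : ℝ → ℂ} (hL : AEStronglyMeasurable L)
    {M : ℝ} (hM : ∀ μ, ‖L μ‖ ≤ M) (μ : ℝ) :
    Integrable fun μ' : ℝ => (poissonKer ħ (μ - μ') : ℂ) * L μ' :=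
  (((integrable_poissonKer hħ).comp_sub_left μ).ofReal).mul_bdd hL (Eventually.of_forall hM)

/-- A positive kernel of total mass one does not increase sup norms. All contraction arguments below
rest on this bound with constant exactly 1. -/
theorem norm_poisson_le (hħ : 0 < ħ) {L : ℝ → ℂ} {M : ℝ} (hM : ∀ μ, ‖L μ‖ ≤ M) (μ : ℝ) :
    ‖poisson ħ L μ‖ ≤ M := by
  have h := norm_integral_le_of_norm_le
    (f := fun μ' : ℝ => (poissonKer ħ (μ - μ') : ℂ) * L μ')
    (((integrable_poissonKer hħ).comp_sub_left μ).mul_const M)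
    (Eventually.of_forall fun μ' => by
      rw [norm_mul, Complex.norm_real, Real.norm_of_nonneg (poissonKer_nonneg hħ _)]
      exact mul_le_mul_of_nonneg_left (hM _) (poissonKer_nonneg hħ _))
  rwa [integral_mul_const, integral_sub_left_eq_self (poissonKer ħ) volume μ,
    integral_poissonKer hħ, one_mul] at h

theorem poisson_sub (hħ : 0 < ħ) {L₁ L₂ : ℝ → ℂ} (h₁ : AEStronglyMeasurable L₁)
    (h₂ : AEStronglyMeasurable L₂) {M₁ M₂ : ℝ} (hM₁ : ∀ μ, ‖L₁ μ‖ ≤ M₁)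
    (hM₂ : ∀ μ, ‖L₂ μ‖ ≤ M₂) (μ : ℝ) :
    poisson ħ L₁ μ - poisson ħ L₂ μ = poisson ħ (fun μ => L₁ μ - L₂ μ) μ := by
  unfold poisson
  rw [← integral_sub (integrable_poissonKer_mul hħ h₁ hM₁ μ)
    (integrable_poissonKer_mul hħ h₂ hM₂ μ)]
  simp_rw [mul_sub]

theorem continuous_poisson (hħ : 0 < ħ) {L : ℝ → ℂ} (hL : Continuous L)
    {M : ℝ} (hM : ∀ μ, ‖L μ‖ ≤ M) : Continuous (poisson ħ L) := by
  -- The substitution moves μ into L, so that the dominating function no longer depends on μ.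
  have h : poisson ħ L = fun μ => ∫ t : ℝ, (poissonKer ħ t : ℂ) * L (μ - t) := by
    ext μ
    have := integral_sub_left_eq_self
      (fun t : ℝ => (poissonKer ħ (μ - t) : ℂ) * L t) volume μ
    simp only [sub_sub_cancel] at this
    exact this.symm
  rw [h]
  refine continuous_of_dominated (bound := fun t => poissonKer ħ t * M) (fun μ => ?_) (fun μ => ?_)
    ((integrable_poissonKer hħ).mul_const M) ?_
  · have := continuous_poissonKer hħ
    exact Continuous.aestronglyMeasurable (by fun_prop)
  · refine Eventually.of_forall fun t => ?_
    rw [norm_mul, Complex.norm_real, Real.norm_of_nonneg (poissonKer_nonneg hħ _)]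
    exact mul_le_mul_of_nonneg_left (hM _) (poissonKer_nonneg hħ _)
  · exact Eventually.of_forall fun t => by fun_prop

/-- Fubini and the evenness of the kernel. This symmetry is what makes the instanton functional
stationary in X. -/
theorem integral_poisson_mul_comm (hħ : 0 < ħ) {L₁ L₂ : ℝ → ℂ} (h₁ : Integrable L₁)
    (h₂ : Integrable L₂) :
    ∫ μ, poisson ħ L₁ μ * L₂ μ = ∫ μ, poisson ħ L₂ μ * L₁ μ := by
  have hint : Integrable (Function.uncurry fun μ μ' : ℝ =>
      (poissonKer ħ (μ - μ') : ℂ) * (L₂ μ * L₁ μ')) (volume.prod volume) := by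
    refine (h₂.mul_prod h₁).bdd_mul (c := (Real.pi * ħ)⁻¹) ?_ (Eventually.of_forall fun p => ?_)
    · have := continuous_poissonKer hħ
      exact Continuous.aestronglyMeasurable (by fun_prop)
    · rw [Complex.norm_real, Real.norm_of_nonneg (poissonKer_nonneg hħ _)]
      exact poissonKer_le hħ _
  have hs := integral_integral_swap hint
  have e₁ : ∀ μ, poisson ħ L₁ μ * L₂ μ =
      ∫ μ', (poissonKer ħ (μ - μ') : ℂ) * (L₂ μ * L₁ μ') := fun μ => by
    unfold poisson
    rw [← integral_mul_const]
    exact integral_congr_ae (Eventually.of_forall fun μ' => by ring)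
  have e₂ : ∀ μ', poisson ħ L₂ μ' * L₁ μ' =
      ∫ μ, (poissonKer ħ (μ - μ') : ℂ) * (L₂ μ * L₁ μ') := fun μ' => by
    unfold poisson
    rw [← integral_mul_const]
    refine integral_congr_ae (Eventually.of_forall fun μ => ?_)
    simp only
    rw [← poissonKer_neg, neg_sub]
    ring
  simp_rw [e₁, e₂]
  exact hs

theorem kernel_eq_poissonKer (hħ : 0 < ħ) (μ μ' : ℝ) :
    1 / (2 * Real.pi * I) * (2 * I * ħ / (((μ : ℂ) - μ') ^ 2 + (ħ : ℂ) ^ 2)) =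
      (poissonKer ħ (μ - μ') : ℂ) := by
  unfold poissonKer
  have h1 : ((μ : ℂ) - μ') ^ 2 + (ħ : ℂ) ^ 2 ≠ 0 := by
    have : (0 : ℝ) < (μ - μ') ^ 2 + ħ ^ 2 := by positivity
    exact_mod_cast this.ne'
  have h2 : (Real.pi : ℂ) ≠ 0 := by exact_mod_cast Real.pi_ne_zero
  push_cast
  field_simp

theorem nlie_integral_eq (hħ : 0 < ħ) (X : ℝ → ℂ) (μ : ℝ) :
    ∫ μ' : ℝ, 1 / (2 * Real.pi * I) * (2 * I * ħ / (((μ : ℂ) - μ') ^ 2 + (ħ : ℂ) ^ 2)) *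
      Complex.log (1 + X μ') = poisson ħ (fun μ => Complex.log (1 + X μ)) μ := by
  simp_rw [kernel_eq_poissonKer hħ]
  rfl

end Poisson

/-! ### Elementary estimates -/

/-- On this convex half plane |1+z| ≥ 1/2, so the derivative 1/(1+z) is bounded by 2. -/
theorem norm_log_one_add_sub_le {a b : ℂ} (ha : -(1 / 2) < a.re) (hb : -(1 / 2) < b.re) :
    ‖Complex.log (1 + a) - Complex.log (1 + b)‖ ≤ 2 * ‖a - b‖ := by
  have hs : Convex ℝ {z : ℂ | -(1 / 2) < z.re} := convex_halfSpace_re_gt _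
  refine hs.norm_image_sub_le_of_norm_hasDerivWithin_le (𝕜 := ℂ)
    (f := fun z => Complex.log (1 + z)) (f' := fun z => (1 + z)⁻¹) (fun z hz => ?_) (fun z hz => ?_)
    hb ha
  · have hz' : 1 + z ∈ slitPlane := Or.inl (by
      have : -(1 / 2) < z.re := hz
      simp; linarith)
    have := ((hasDerivAt_id z).const_add 1).clog hz'
    simpa using this.hasDerivWithinAt
  · have : (1 / 2 : ℝ) ≤ ‖1 + z‖ := by
      refine le_trans ?_ (Complex.re_le_norm _)
      have : -(1 / 2) < z.re := hz
      simp; linarith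
    rw [norm_inv, inv_le_comm₀ (by linarith) two_pos]
    linarith

theorem norm_log_one_add_le {a : ℂ} (ha : -(1 / 2) < a.re) :
    ‖Complex.log (1 + a)‖ ≤ 2 * ‖a‖ := by
  simpa using norm_log_one_add_sub_le ha (b := 0) (by norm_num)

theorem exp_half_le_two : Real.exp (1 / 2) ≤ 2 := by
  have h := Real.exp_one_lt_d9
  have h2 : Real.exp (1 / 2) * Real.exp (1 / 2) = Real.exp 1 := by
    rw [← Real.exp_add]; norm_num
  nlinarith [Real.exp_pos (1 / 2)]

theorem norm_exp_le_two {a : ℂ} (ha : ‖a‖ ≤ 1 / 2) : ‖exp a‖ ≤ 2 :=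
  (Complex.norm_exp_le_exp_norm a).trans ((Real.exp_le_exp.2 ha).trans exp_half_le_two)

theorem norm_exp_sub_exp_le {a b : ℂ} (ha : ‖a‖ ≤ 1 / 2) (hb : ‖b‖ ≤ 1 / 2) :
    ‖exp a - exp b‖ ≤ 2 * ‖a - b‖ := by
  refine (convex_closedBall (0 : ℂ) (1 / 2)).norm_image_sub_le_of_norm_hasDerivWithin_le (𝕜 := ℂ)
    (f := exp) (f' := exp) (fun z _ => (Complex.hasDerivAt_exp z).hasDerivWithinAt)
    (fun z hz => norm_exp_le_two (by simpa using hz)) (by simpa using hb) (by simpa using ha)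

/-! ### Small solutions of the integral equation -/

section Existence

open BoundedContinuousFunction

variable {ħ : ℝ}

/-- One estimate serves two purposes: with φ = ψ it is the contraction property, with φ ≠ ψ it
controls how the fixed point depends on φ. The factor 1/2 is 1/8 · 2 · 2, from the bound on φ and
the Lipschitz constants of exp and of log(1+·). -/
theorem norm_iterate_sub_le (hħ : 0 < ħ) {φ ψ : ℝ → ℂ} {X Y : ℝ → ℂ} {η d : ℝ}
    (hX : Continuous X) (hY : Continuous Y)
    (hφ : ∀ μ, ‖φ μ‖ ≤ 1 / 8) (hφψ : ∀ μ, ‖φ μ - ψ μ‖ ≤ η)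
    (hX4 : ∀ μ, ‖X μ‖ ≤ 1 / 4) (hY4 : ∀ μ, ‖Y μ‖ ≤ 1 / 4) (hd : ∀ μ, ‖X μ - Y μ‖ ≤ d) (μ : ℝ) :
    ‖φ μ * exp (poisson ħ (fun μ => Complex.log (1 + X μ)) μ) -
      ψ μ * exp (poisson ħ (fun μ => Complex.log (1 + Y μ)) μ)‖ ≤ 2 * η + d / 2 := by
  have hre : ∀ {Z : ℝ → ℂ}, (∀ μ, ‖Z μ‖ ≤ 1 / 4) → ∀ μ, -(1 / 2) < (Z μ).re := fun h μ => by
    have := (Complex.abs_re_le_norm _).trans (h μ)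
    linarith [(abs_le.1 this).1]
  have hlog : ∀ {Z : ℝ → ℂ}, (∀ μ, ‖Z μ‖ ≤ 1 / 4) → ∀ μ, ‖Complex.log (1 + Z μ)‖ ≤ 1 / 2 :=
    fun h μ => (norm_log_one_add_le (hre h μ)).trans (by linarith [h μ])
  have hc : ∀ {Z : ℝ → ℂ}, (∀ μ, ‖Z μ‖ ≤ 1 / 4) → Continuous Z →
      Continuous fun μ => Complex.log (1 + Z μ) := fun h hZ =>
    (continuous_const.add hZ).clog fun μ => Or.inl (by
      have := hre h μ
      simp; linarith)
  have e1 := norm_poisson_le hħ (hlog hX4) μ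
  have e2 := norm_poisson_le hħ (hlog hY4) μ
  have e3 : ‖poisson ħ (fun μ => Complex.log (1 + X μ)) μ -
      poisson ħ (fun μ => Complex.log (1 + Y μ)) μ‖ ≤ 2 * d := by
    rw [poisson_sub hħ (hc hX4 hX).aestronglyMeasurable (hc hY4 hY).aestronglyMeasurable
      (hlog hX4) (hlog hY4)]
    exact norm_poisson_le hħ (fun μ =>
      (norm_log_one_add_sub_le (hre hX4 μ) (hre hY4 μ)).trans (by linarith [hd μ])) μ
  set u := poisson ħ (fun μ => Complex.log (1 + X μ)) μ
  set v := poisson ħ (fun μ => Complex.log (1 + Y μ)) μ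
  have : φ μ * exp u - ψ μ * exp v = φ μ * (exp u - exp v) + (φ μ - ψ μ) * exp v := by ring
  rw [this]
  refine (norm_add_le _ _).trans ?_
  rw [norm_mul, norm_mul]
  have h1 : ‖φ μ‖ * ‖exp u - exp v‖ ≤ 1 / 8 * (2 * (2 * d)) :=
    mul_le_mul (hφ μ) ((norm_exp_sub_exp_le e1 e2).trans (by linarith)) (norm_nonneg _)
      (by norm_num)
  have h2 : ‖φ μ - ψ μ‖ * ‖exp v‖ ≤ η * 2 :=
    mul_le_mul (hφψ μ) (norm_exp_le_two e2) (norm_nonneg _)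
      ((norm_nonneg _).trans (hφψ μ))
  linarith

/-- The second bound keeps the iteration inside the ball of radius 1/4. The first keeps the exponent
within the range of the principal logarithm. -/
theorem norm_iterate_le (hħ : 0 < ħ) {φ : ℝ → ℂ} {X : ℝ → ℂ} (hφ : ∀ μ, ‖φ μ‖ ≤ 1 / 8)
    (hX4 : ∀ μ, ‖X μ‖ ≤ 1 / 4) (μ : ℝ) :
    ‖poisson ħ (fun μ => Complex.log (1 + X μ)) μ‖ ≤ 1 / 2 ∧
    ‖φ μ * exp (poisson ħ (fun μ => Complex.log (1 + X μ)) μ)‖ ≤ 1 / 4 := by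
  have hlog : ∀ μ, ‖Complex.log (1 + X μ)‖ ≤ 1 / 2 := fun μ => by
    have := (Complex.abs_re_le_norm _).trans (hX4 μ)
    exact (norm_log_one_add_le (by linarith [(abs_le.1 this).1])).trans (by linarith [hX4 μ])
  have e := norm_poisson_le hħ hlog μ
  refine ⟨e, ?_⟩
  rw [norm_mul]
  calc _ ≤ 1 / 8 * 2 := mul_le_mul (hφ μ) (norm_exp_le_two e) (norm_nonneg _) (by norm_num)
    _ = 1 / 4 := by norm_num

theorem exists_fixedPoint (hħ : 0 < ħ) {φ : ℝ → ℂ} (hφc : Continuous φ)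
    (hφ : ∀ μ, ‖φ μ‖ ≤ 1 / 8) :
    ∃ X : ℝ → ℂ, Continuous X ∧ (∀ μ, ‖X μ‖ ≤ 1 / 4) ∧
      ∀ μ, X μ = φ μ * exp (poisson ħ (fun μ => Complex.log (1 + X μ)) μ) := by
  let S : Set (ℝ →ᵇ ℂ) := Metric.closedBall 0 (1 / 4)
  have hS : ∀ X ∈ S, ∀ μ, ‖X μ‖ ≤ 1 / 4 := fun X hX μ =>
    (X.norm_coe_le_norm μ).trans (by simpa [S] using hX)
  have hcont : ∀ X ∈ S, Continuous fun μ =>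
      φ μ * exp (poisson ħ (fun μ => Complex.log (1 + X μ)) μ) := by
    intro X hX
    have hre : ∀ μ, -(1 / 2) < (X μ).re := fun μ => by
      have := (Complex.abs_re_le_norm _).trans (hS X hX μ)
      linarith [(abs_le.1 this).1]
    refine hφc.mul (Complex.continuous_exp.comp (continuous_poisson hħ (M := 1 / 2) ?_ fun μ => ?_))
    · exact (continuous_const.add X.continuous).clog fun μ => Or.inl (by
        have := hre μ
        simp; linarith)
    · exact (norm_log_one_add_le (hre μ)).trans (by linarith [hS X hX μ])
  let T : S → S := fun X => ⟨BoundedContinuousFunction.ofNormedAddCommGroup _ (hcont X X.2) (1 / 4)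
      fun μ => (norm_iterate_le hħ hφ (hS X X.2) μ).2, by
    rw [Metric.mem_closedBall, dist_zero_right]
    exact BoundedContinuousFunction.norm_ofNormedAddCommGroup_le _ (by norm_num) _⟩
  have hT : ContractingWith (1 / 2) T := by
    refine ⟨by norm_num, LipschitzWith.of_dist_le_mul fun X Y => ?_⟩
    rw [Subtype.dist_eq, Subtype.dist_eq, BoundedContinuousFunction.dist_le (by positivity)]
    intro μ
    have := norm_iterate_sub_le hħ (φ := φ) (ψ := φ) (η := 0) X.1.continuous Y.1.continuous hφ
      (by simp) (hS X X.2) (hS Y Y.2) (d := dist X.1 Y.1)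
      (fun μ => by rw [← dist_eq_norm]; exact BoundedContinuousFunction.dist_coe_le_dist μ) μ
    rw [dist_eq_norm]
    refine this.trans (le_of_eq ?_)
    simp; ring
  have : CompleteSpace S := (Metric.isClosed_closedBall.isComplete).completeSpace_coe
  have : Nonempty S := ⟨⟨0, by simp [S]⟩⟩
  have hfix := hT.fixedPoint_isFixedPt
  set X := ContractingWith.fixedPoint T hT
  refine ⟨X.1, X.1.continuous, hS X X.2, fun μ => ?_⟩
  have h2 : (T X).1 μ = X.1 μ := by rw [hfix]
  exact h2.symm

end Existence

/-! ### The function `Θ` -/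

section Theta

variable {N : ℕ} {ħ : ℝ} {δ δ' : Fin N → ℂ} {Λ Λ' : ℝ} {m : ℝ}

/-- The margin m is the half-width of a strip around ℝ in which Θ has no zeros. -/
theorem exists_gap (hδ : δ ∈ strip N ħ) : ∃ m > 0, ∀ k, |(δ k).im| + m ≤ ħ / 2 := by
  have h : ∀ᶠ m : ℝ in 𝓝[>] 0, ∀ k, |(δ k).im| + m ≤ ħ / 2 := by
    refine eventually_all.2 fun k => ?_
    have hk := hδ k
    filter_upwards [Ioo_mem_nhdsGT (show (0 : ℝ) < ħ / 2 - |(δ k).im| by linarith)] with m hm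
    linarith [hm.2]
  obtain ⟨m, h1, h2⟩ := (h.and self_mem_nhdsWithin).exists
  exact ⟨m, h2, h1⟩

theorem Theta_eq_prod (z : ℂ) : Theta ħ δ Λ z =
    ((Λ : ℂ) ^ (2 * N))⁻¹ * ∏ k, ((z - I * ħ / 2 - δ k) * (z + I * ħ / 2 - δ k)) := by
  rw [Theta, vartheta, vartheta, Finset.prod_mul_distrib]

theorem le_norm_sub_of_gap (hm : ∀ k, |(δ k).im| + m ≤ ħ / 2) (z : ℂ) (k : Fin N) :
    m - |z.im| ≤ ‖z - I * ħ / 2 - δ k‖ ∧ m - |z.im| ≤ ‖z + I * ħ / 2 - δ k‖ := by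
  have h := hm k
  have hi : (I * (ħ : ℂ) / 2).im = ħ / 2 := by
    have : I * (ħ : ℂ) / 2 = ((ħ / 2 : ℝ) : ℂ) * I := by push_cast; ring
    rw [this]; simp
  have h1 := neg_abs_le (δ k).im
  have h2 := le_abs_self (δ k).im
  have h3 := neg_abs_le z.im
  have h4 := le_abs_self z.im
  constructor
  · refine le_trans ?_ (Complex.abs_im_le_norm _)
    rw [Complex.sub_im, Complex.sub_im, hi]
    refine le_trans ?_ (neg_le_abs _)
    linarith
  · refine le_trans ?_ (Complex.abs_im_le_norm _)
    rw [Complex.sub_im, Complex.add_im, hi]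
    refine le_trans ?_ (le_abs_self _)
    linarith

theorem Theta_ne_zero (hm : ∀ k, |(δ k).im| + m ≤ ħ / 2) (hΛ : 0 < Λ) {z : ℂ}
    (hz : |z.im| < m) : Theta ħ δ Λ z ≠ 0 := by
  rw [Theta_eq_prod]
  have hΛ' : (Λ : ℂ) ≠ 0 := by exact_mod_cast hΛ.ne'
  refine mul_ne_zero (inv_ne_zero (pow_ne_zero _ hΛ')) (Finset.prod_ne_zero_iff.2 fun k _ => ?_)
  obtain ⟨h1, h2⟩ := le_norm_sub_of_gap hm z k
  exact mul_ne_zero (norm_pos_iff.1 (by linarith)) (norm_pos_iff.1 (by linarith))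

theorem differentiable_Theta : Differentiable ℂ (Theta ħ δ Λ) := by
  unfold Theta vartheta
  fun_prop

/-- From x² ≤ 2(x-d)² + 2d², with the constant terms absorbed by ‖w‖ ≥ c. Only the real part of w is
prescribed, so w may carry any imaginary shift. -/
theorem exists_sq_le_norm_sub_sq {c : ℝ} (hc : 0 < c) (d : ℂ) :
    ∃ C > 0, ∀ z w : ℂ, w.re = z.re - d.re → c ≤ ‖w‖ →
      1 + z.re ^ 2 ≤ C * ‖w‖ ^ 2 := by
  refine ⟨2 + (1 + 2 * d.re ^ 2) / c ^ 2, by positivity, fun z w hw hcw => ?_⟩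
  have h1 : w.re ^ 2 ≤ ‖w‖ ^ 2 := by
    rw [← sq_abs]
    exact pow_le_pow_left₀ (abs_nonneg _) (Complex.abs_re_le_norm w) 2
  have h2 : c ^ 2 ≤ ‖w‖ ^ 2 := pow_le_pow_left₀ hc.le hcw 2
  have h3 : 1 + 2 * d.re ^ 2 ≤ (1 + 2 * d.re ^ 2) / c ^ 2 * ‖w‖ ^ 2 := by
    rw [div_mul_eq_mul_div, le_div_iff₀ (by positivity)]
    exact mul_le_mul_of_nonneg_left h2 (by positivity)
  rw [hw] at h1
  nlinarith [sq_nonneg (z.re - 2 * d.re)]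

/-- Every conjugate pair of factors contributes a decay 1/(1+x²). Keeping one of the N powers is
enough for integrability. -/
theorem exists_norm_Theta_inv_le (hN : N ≠ 0) (hm0 : 0 < m) (hm : ∀ k, |(δ k).im| + m ≤ ħ / 2) :
    ∃ C, 0 ≤ C ∧ ∀ z : ℂ, |z.im| ≤ m / 2 → ‖(Theta ħ δ Λ z)⁻¹‖ ≤ C * (1 + z.re ^ 2)⁻¹ := by
  have hc : 0 < m / 2 := by linarith
  choose C hC0 hC using fun k => exists_sq_le_norm_sub_sq hc (δ k)
  refine ⟨‖(Λ : ℂ) ^ (2 * N)‖ * ∏ k, C k,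
    mul_nonneg (norm_nonneg _) (Finset.prod_nonneg fun k _ => (hC0 k).le), fun z hz => ?_⟩
  have hpos : (0 : ℝ) < 1 + z.re ^ 2 := by positivity
  have hk : ∀ k, ‖((z - I * ħ / 2 - δ k) * (z + I * ħ / 2 - δ k))⁻¹‖ ≤
      C k * (1 + z.re ^ 2)⁻¹ := by
    intro k
    obtain ⟨h1, h2⟩ := le_norm_sub_of_gap hm z k
    have hre : ∀ s : ℂ, s.re = 0 → (z + s - δ k).re = z.re - (δ k).re := by
      intro s hs; simp [hs]
    have h3 := hC k z (z - I * ħ / 2 - δ k) (by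
      have := hre (-(I * ħ / 2)) (by simp)
      rwa [← sub_eq_add_neg] at this) (by linarith)
    have h4 := hC k z (z + I * ħ / 2 - δ k) (hre _ (by simp)) (by linarith)
    set a := ‖z - I * ħ / 2 - δ k‖
    set b := ‖z + I * ħ / 2 - δ k‖
    have ha : 0 < a := by linarith
    have hb : 0 < b := by linarith
    rw [norm_inv, norm_mul, ← div_eq_mul_inv, inv_le_comm₀ (by positivity)
      (div_pos (hC0 k) hpos), inv_div, div_le_iff₀ (hC0 k)]
    change 1 + z.re ^ 2 ≤ a * b * C k
    have h5 : (1 + z.re ^ 2) ^ 2 ≤ (a * b * C k) ^ 2 := by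
      calc (1 + z.re ^ 2) ^ 2 = (1 + z.re ^ 2) * (1 + z.re ^ 2) := by ring
        _ ≤ (C k * a ^ 2) * (C k * b ^ 2) := mul_le_mul h3 h4 hpos.le (by have := hC0 k; positivity)
        _ = _ := by ring
    exact (pow_le_pow_iff_left₀ hpos.le (by have := hC0 k; positivity) two_ne_zero).1 h5
  rw [Theta_eq_prod, mul_inv, inv_inv, norm_mul, mul_assoc, ← Finset.prod_inv_distrib, norm_prod]
  refine mul_le_mul_of_nonneg_left ?_ (norm_nonneg _)
  calc _ ≤ ∏ k, (C k * (1 + z.re ^ 2)⁻¹) :=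
        Finset.prod_le_prod (fun _ _ => norm_nonneg _) fun k _ => hk k
    _ = (∏ k, C k) * ((1 + z.re ^ 2)⁻¹) ^ N := by
        rw [Finset.prod_mul_distrib, Finset.prod_const, Finset.card_univ, Fintype.card_fin]
    _ ≤ _ := by
        refine mul_le_mul_of_nonneg_left ?_ (Finset.prod_nonneg fun k _ => (hC0 k).le)
        refine pow_le_of_le_one (by positivity) (inv_le_one_of_one_le₀ ?_) hN
        nlinarith [sq_nonneg z.re]

/-- A logarithm of `Θ_{δ,Λ} / Θ_{δ',Λ'}` for `(δ',Λ')` close to `(δ,Λ)`. -/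
def logRatio (ħ : ℝ) (δ δ' : Fin N → ℂ) (Λ Λ' : ℝ) (μ : ℝ) : ℂ :=
  2 * N * ((Real.log Λ' : ℂ) - (Real.log Λ : ℂ)) -
    ∑ k, (Complex.log (1 + -((δ' k - δ k) / (μ - I * ħ / 2 - δ k))) +
      Complex.log (1 + -((δ' k - δ k) / (μ + I * ħ / 2 - δ k))))

theorem norm_div_sub_le (hm0 : 0 < m) (hm : ∀ k, |(δ k).im| + m ≤ ħ / 2) (k : Fin N) (d : ℂ)
    (μ : ℝ) : ‖-(d / (μ - I * ħ / 2 - δ k))‖ ≤ ‖d‖ / m ∧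
      ‖-(d / (μ + I * ħ / 2 - δ k))‖ ≤ ‖d‖ / m := by
  obtain ⟨h1, h2⟩ := le_norm_sub_of_gap hm μ k
  rw [Complex.ofReal_im, abs_zero, sub_zero] at h1 h2
  rw [norm_neg, norm_neg, norm_div, norm_div]
  exact ⟨div_le_div_of_nonneg_left (norm_nonneg _) hm0 h1,
    div_le_div_of_nonneg_left (norm_nonneg _) hm0 h2⟩

theorem one_add_mem_slitPlane {z : ℂ} (hz : ‖z‖ ≤ 1 / 2) : 1 + z ∈ slitPlane := by
  have := (Complex.abs_re_le_norm z).trans hz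
  exact Or.inl (by simp; linarith [(abs_le.1 this).1])

/-- Each linear factor changes by 1 + u with |u| ≤ 1/2. Summing the principal logarithms factor by
factor gives a logarithm that is small uniformly in μ, whereas the principal logarithm of the
product could jump by 2πi. -/
theorem Theta_eq_exp_logRatio (hm0 : 0 < m) (hm : ∀ k, |(δ k).im| + m ≤ ħ / 2) (hΛ : 0 < Λ)
    (hΛ' : 0 < Λ') (hδ' : ∀ k, ‖δ' k - δ k‖ ≤ m / 2) (μ : ℝ) :
    Theta ħ δ Λ μ = exp (logRatio ħ δ δ' Λ Λ' μ) * Theta ħ δ' Λ' μ := by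
  have hΛc : (Λ : ℂ) ≠ 0 := by exact_mod_cast hΛ.ne'
  have hΛc' : (Λ' : ℂ) ≠ 0 := by exact_mod_cast hΛ'.ne'
  have hk : ∀ k, (μ - I * ħ / 2 - δ' k) * (μ + I * ħ / 2 - δ' k) =
      exp (Complex.log (1 + -((δ' k - δ k) / (μ - I * ħ / 2 - δ k))) +
      Complex.log (1 + -((δ' k - δ k) / (μ + I * ħ / 2 - δ k)))) *
      ((μ - I * ħ / 2 - δ k) * (μ + I * ħ / 2 - δ k)) := by
    intro k
    obtain ⟨h1, h2⟩ := norm_div_sub_le hm0 hm k (δ' k - δ k) μ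
    have hle : ‖δ' k - δ k‖ / m ≤ 1 / 2 := by
      rw [div_le_iff₀ hm0]; linarith [hδ' k]
    obtain ⟨h3, h4⟩ := le_norm_sub_of_gap hm μ k
    rw [Complex.ofReal_im, abs_zero, sub_zero] at h3 h4
    have h5 : (μ - I * ħ / 2 - δ k : ℂ) ≠ 0 := norm_pos_iff.1 (by linarith)
    have h6 : (μ + I * ħ / 2 - δ k : ℂ) ≠ 0 := norm_pos_iff.1 (by linarith)
    rw [Complex.exp_add, Complex.exp_log (slitPlane_ne_zero (one_add_mem_slitPlane (h1.trans hle))),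
      Complex.exp_log (slitPlane_ne_zero (one_add_mem_slitPlane (h2.trans hle)))]
    have e : ∀ a b d : ℂ, a ≠ 0 → b ≠ 0 →
        (a - d) * (b - d) = (1 + -(d / a)) * (1 + -(d / b)) * (a * b) := by
      intro a b d ha hb
      field_simp
      ring
    rw [← e _ _ _ h5 h6]
    ring
  have hlog : ∀ {a : ℝ}, 0 < a → exp (2 * N * (Real.log a : ℂ)) = (a : ℂ) ^ (2 * N) := by
    intro a ha
    have : (2 * N * (Real.log a : ℂ)) = ((2 * N : ℕ) : ℂ) * (Real.log a : ℂ) := by push_cast; ring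
    rw [this, Complex.exp_nat_mul, ← Complex.ofReal_exp, Real.exp_log ha]
  have hP : ∏ k, ((μ - I * ħ / 2 - δ' k) * (μ + I * ħ / 2 - δ' k)) =
      exp (∑ k, (Complex.log (1 + -((δ' k - δ k) / (μ - I * ħ / 2 - δ k))) +
      Complex.log (1 + -((δ' k - δ k) / (μ + I * ħ / 2 - δ k))))) *
      ∏ k, ((μ - I * ħ / 2 - δ k) * (μ + I * ħ / 2 - δ k)) := by
    rw [Finset.prod_congr rfl fun k _ => hk k, Finset.prod_mul_distrib, ← Complex.exp_sum]
  rw [Theta_eq_prod, Theta_eq_prod, hP, logRatio, mul_sub, Complex.exp_sub, Complex.exp_sub,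
    hlog hΛ, hlog hΛ']
  generalize ∏ k, ((μ - I * ħ / 2 - δ k) * (μ + I * ħ / 2 - δ k)) = P
  generalize ∑ k, (Complex.log (1 + -((δ' k - δ k) / (μ - I * ħ / 2 - δ k))) +
      Complex.log (1 + -((δ' k - δ k) / (μ + I * ħ / 2 - δ k)))) = S
  have := Complex.exp_ne_zero S
  field_simp

/-- Both logarithms belonging to k satisfy |log(1+u)| ≤ (3/2)|u|, whence the constant 3/m. -/
theorem norm_logRatio_le (hm0 : 0 < m) (hm : ∀ k, |(δ k).im| + m ≤ ħ / 2)
    (hδ' : ∀ k, ‖δ' k - δ k‖ ≤ m / 2) (μ : ℝ) :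
    ‖logRatio ħ δ δ' Λ Λ' μ‖ ≤
      2 * N * |Real.log Λ' - Real.log Λ| + ∑ k, 3 / m * ‖δ' k - δ k‖ := by
  refine (norm_sub_le _ _).trans (add_le_add (le_of_eq ?_) ((norm_sum_le _ _).trans
    (Finset.sum_le_sum fun k _ => (norm_add_le _ _).trans ?_)))
  · rw [norm_mul, ← Complex.ofReal_sub, Complex.norm_real]
    simp
  · obtain ⟨h1, h2⟩ := norm_div_sub_le hm0 hm k (δ' k - δ k) μ
    have hle : ‖δ' k - δ k‖ / m ≤ 1 / 2 := by
      rw [div_le_iff₀ hm0]; linarith [hδ' k]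
    have h3 := Complex.norm_log_one_add_half_le_self (h1.trans hle)
    have h4 := Complex.norm_log_one_add_half_le_self (h2.trans hle)
    have : 3 / m * ‖δ' k - δ k‖ = 3 * (‖δ' k - δ k‖ / m) := by ring
    rw [this]
    linarith

theorem continuous_logRatio (hm0 : 0 < m) (hm : ∀ k, |(δ k).im| + m ≤ ħ / 2)
    (hδ' : ∀ k, ‖δ' k - δ k‖ ≤ m / 2) : Continuous (logRatio ħ δ δ' Λ Λ') := by
  refine continuous_const.sub (continuous_finsetSum _ fun k _ => ?_)
  have hle : ‖δ' k - δ k‖ / m ≤ 1 / 2 := by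
    rw [div_le_iff₀ hm0]; linarith [hδ' k]
  have h5 : ∀ μ : ℝ, (μ - I * ħ / 2 - δ k : ℂ) ≠ 0 := fun μ => norm_pos_iff.1 (by
    have := (le_norm_sub_of_gap hm μ k).1
    rw [Complex.ofReal_im, abs_zero, sub_zero] at this
    linarith)
  have h6 : ∀ μ : ℝ, (μ + I * ħ / 2 - δ k : ℂ) ≠ 0 := fun μ => norm_pos_iff.1 (by
    have := (le_norm_sub_of_gap hm μ k).2
    rw [Complex.ofReal_im, abs_zero, sub_zero] at this
    linarith)
  refine Continuous.add (Continuous.clog ?_ fun μ => one_add_mem_slitPlane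
    ((norm_div_sub_le hm0 hm k _ μ).1.trans hle)) (Continuous.clog ?_ fun μ =>
      one_add_mem_slitPlane ((norm_div_sub_le hm0 hm k _ μ).2.trans hle))
  · exact continuous_const.add (continuous_const.div (by fun_prop) h5).neg
  · exact continuous_const.add (continuous_const.div (by fun_prop) h6).neg

theorem eventually_logRatio_le (hm0 : 0 < m) (hm : ∀ k, |(δ k).im| + m ≤ ħ / 2) (hΛ : 0 < Λ)
    {e : ℝ} (he : 0 < e) :
    ∀ᶠ q : (Fin N → ℂ) × ℝ in 𝓝 (δ, Λ), 0 < q.2 ∧ (∀ k, ‖q.1 k - δ k‖ ≤ m / 2) ∧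
      ∀ μ, ‖logRatio ħ δ q.1 Λ q.2 μ‖ ≤ e := by
  have h1 : ∀ᶠ q : (Fin N → ℂ) × ℝ in 𝓝 (δ, Λ), 0 < q.2 :=
    continuous_snd.continuousAt.eventually (lt_mem_nhds hΛ)
  have h2 : ∀ᶠ q : (Fin N → ℂ) × ℝ in 𝓝 (δ, Λ), ∀ k, ‖q.1 k - δ k‖ ≤ m / 2 := by
    refine eventually_all.2 fun k => ?_
    have : ContinuousAt (fun q : (Fin N → ℂ) × ℝ => ‖q.1 k - δ k‖) (δ, Λ) := by fun_prop
    refine Tendsto.eventually_le_const (u := m / 2) ?_ this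
    simp; linarith
  have h3 : ∀ᶠ q : (Fin N → ℂ) × ℝ in 𝓝 (δ, Λ),
      2 * N * |Real.log q.2 - Real.log Λ| + ∑ k, 3 / m * ‖q.1 k - δ k‖ ≤ e := by
    have hlog : ContinuousAt (fun q : (Fin N → ℂ) × ℝ => Real.log q.2) (δ, Λ) :=
      continuous_snd.continuousAt.log hΛ.ne'
    have : ContinuousAt (fun q : (Fin N → ℂ) × ℝ =>
      2 * N * |Real.log q.2 - Real.log Λ| + ∑ k, 3 / m * ‖q.1 k - δ k‖) (δ, Λ) := by fun_prop
    refine Tendsto.eventually_le_const (u := e) ?_ this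
    simpa using he
  filter_upwards [h1, h2, h3] with q hq1 hq2 hq3
  exact ⟨hq1, hq2, fun μ => (norm_logRatio_le hm0 hm hq2 μ).trans hq3⟩

end Theta

/-! ### Families of solutions for small `Λ` -/

/-- For small Λ one has |1/Θ| ≤ 1/8 on ℝ, and X ↦ Θ⁻¹ exp(P log(1+X)) contracts the ball of radius
1/4. Continuity in the parameters follows from the same contraction, since 1/Θ varies uniformly. -/
theorem exists_solutionFamily {N : ℕ} (hN : N ≠ 0) {ħ : ℝ} (hħ : 0 < ħ) :
    ∃ Λ₀ : (Fin N → ℂ) → ℝ, ContinuousOn Λ₀ (strip N ħ) ∧ (∀ δ ∈ strip N ħ, 0 < Λ₀ δ) ∧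
      ∃ X : (Fin N → ℂ) × ℝ → ℝ → ℂ,
        IsSolutionFamily ħ {p | p.1 ∈ strip N ħ ∧ 0 < p.2 ∧ p.2 < Λ₀ p.1} X := by
  -- The product bounds |Λ^{2N} Θ| from below on ℝ, so Λ^{2N} ≤ P yields |1/Θ| ≤ 1/8. The threshold
  -- `Λ₀` is the 2N-th root of P.
  set P : (Fin N → ℂ) → ℝ := fun δ => (∏ k, (ħ / 2 - |(δ k).im|) ^ 2) / 8 with hP
  have hPc : Continuous P := by rw [hP]; fun_prop
  have hPpos : ∀ δ ∈ strip N ħ, 0 < P δ := fun δ hδ => by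
    refine div_pos (Finset.prod_pos fun k _ => ?_) (by norm_num)
    have := hδ k
    have : 0 < ħ / 2 - |(δ k).im| := by linarith
    positivity
  set e : ℝ := ((2 * N : ℕ) : ℝ)⁻¹ with he
  have he0 : 0 ≤ e := by positivity
  set Λ₀ : (Fin N → ℂ) → ℝ := fun δ => P δ ^ e with hΛ₀
  have hΛ₀c : Continuous Λ₀ := hPc.rpow_const fun _ => Or.inr he0
  have hΛ₀pos : ∀ δ ∈ strip N ħ, 0 < Λ₀ δ := fun δ hδ => Real.rpow_pos_of_pos (hPpos δ hδ) _
  have hstrip : IsOpen (strip N ħ) := by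
    have : strip N ħ = ⋂ k, {δ : Fin N → ℂ | |(δ k).im| < ħ / 2} := by ext; simp [strip]
    rw [this]
    exact isOpen_iInter_of_finite fun k => isOpen_lt (by fun_prop) continuous_const
  set D : Set ((Fin N → ℂ) × ℝ) := {p | p.1 ∈ strip N ħ ∧ 0 < p.2 ∧ p.2 < Λ₀ p.1} with hD
  have hDo : IsOpen D := (hstrip.preimage continuous_fst).inter
    ((isOpen_lt continuous_const continuous_snd).inter
      (isOpen_lt continuous_snd (hΛ₀c.comp continuous_fst)))
  have hpow : ∀ p ∈ D, p.2 ^ (2 * N) ≤ P p.1 := by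
    rintro ⟨δ, Λ⟩ ⟨h1, h2, h3⟩
    calc Λ ^ (2 * N) ≤ (Λ₀ δ) ^ (2 * N) := pow_le_pow_left₀ h2.le h3.le _
      _ = P δ := Real.rpow_inv_natCast_pow (hPpos δ h1).le (by positivity)
  set φ : (Fin N → ℂ) × ℝ → ℝ → ℂ := fun p μ => (Theta ħ p.1 p.2 μ)⁻¹ with hφdef
  have hΘ : ∀ p ∈ D, ∀ μ : ℝ, Theta ħ p.1 p.2 μ ≠ 0 := fun p hp μ => by
    obtain ⟨m, hm0, hm⟩ := exists_gap hp.1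
    exact Theta_ne_zero hm hp.2.1 (by simpa using hm0)
  have hφ : ∀ p ∈ D, ∀ μ, ‖φ p μ‖ ≤ 1 / 8 := by
    rintro ⟨δ, Λ⟩ hp μ
    have hΛ : 0 < Λ := hp.2.1
    have hprod : ∏ k, (ħ / 2 - |(δ k).im|) ^ 2 ≤
        ‖∏ k, ((μ - I * ħ / 2 - δ k) * (μ + I * ħ / 2 - δ k))‖ := by
      rw [norm_prod]
      refine Finset.prod_le_prod (fun k _ => sq_nonneg _) fun k _ => ?_
      have hk : |(δ k).im| < ħ / 2 := hp.1 k
      obtain ⟨h1, h2⟩ := le_norm_sub_of_gap (N := 1) (δ := fun _ => δ k)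
        (m := ħ / 2 - |(δ k).im|) (ħ := ħ) (fun _ => by linarith) (μ : ℂ) 0
      rw [Complex.ofReal_im, abs_zero, sub_zero] at h1 h2
      rw [norm_mul, sq]
      exact mul_le_mul h1 h2 (by linarith) (norm_nonneg _)
    have h8 : 8 * Λ ^ (2 * N) ≤ ∏ k, (ħ / 2 - |(δ k).im|) ^ 2 := by
      have : Λ ^ (2 * N) ≤ (∏ k, (ħ / 2 - |(δ k).im|) ^ 2) / 8 := hpow _ hp
      linarith
    simp only [hφdef]
    rw [Theta_eq_prod, mul_inv, inv_inv, norm_mul, norm_inv, norm_pow, Complex.norm_real,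
      Real.norm_of_nonneg hΛ.le, ← div_eq_mul_inv, div_le_iff₀]
    · linarith
    · have : 0 < Λ ^ (2 * N) := by positivity
      linarith
  have hφc : ∀ p ∈ D, Continuous (φ p) := fun p hp =>
    (differentiable_Theta.continuous.comp Complex.continuous_ofReal).inv₀ (hΘ p hp)
  have hex : ∀ p : (Fin N → ℂ) × ℝ, ∃ X : ℝ → ℂ, p ∈ D → (Continuous X ∧ (∀ μ, ‖X μ‖ ≤ 1 / 4) ∧
      ∀ μ, X μ = φ p μ * exp (poisson ħ (fun μ => Complex.log (1 + X μ)) μ)) := fun p => by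
    by_cases hp : p ∈ D
    · obtain ⟨X, hX⟩ := exists_fixedPoint hħ (hφc p hp) (hφ p hp)
      exact ⟨X, fun _ => hX⟩
    · exact ⟨0, fun h => absurd h hp⟩
  choose X hX using hex
  refine ⟨Λ₀, hΛ₀c.continuousOn, hΛ₀pos, X, hDo, fun p hp => hp.1, fun p hp => hp.2.1,
    fun p hp => ?_, fun p hp μ => ?_, fun p hp => ?_⟩
  · obtain ⟨h1, h2, h3⟩ := hX p hp
    refine ⟨h1, ⟨_, h2⟩, fun μ => ?_, fun μ => ?_⟩
    · rw [h3]
      exact mul_ne_zero (inv_ne_zero (hΘ p hp μ)) (Complex.exp_ne_zero _)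
    · have hG := (norm_iterate_le hħ (hφ p hp) h2 μ).1
      rw [nlie_integral_eq hħ]
      nth_rw 1 [h3 μ]
      simp only [hφdef]
      rw [mul_comm, mul_inv_cancel_left₀ (hΘ p hp μ)]
      -- The exponent has modulus at most 1/2 < π, so its exponential has it as principal logarithm.
      have him := abs_le.1 ((Complex.abs_im_le_norm _).trans hG)
      have := Real.pi_gt_three
      exact Complex.log_exp (by linarith) (by linarith)
  · have := abs_le.1 ((Complex.abs_re_le_norm _).trans ((hX p hp).2.1 μ))
    linarith
  · rw [Metric.tendstoUniformly_iff]
    intro ε hε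
    obtain ⟨m, hm0, hm⟩ := exists_gap hp.1
    have hη : 0 < min (1 / 2) (ε / 4) := by positivity
    filter_upwards [hDo.mem_nhds hp, eventually_logRatio_le hm0 hm hp.2.1 hη] with q hq ⟨_, h2, h3⟩
    obtain ⟨a1, a2, a3⟩ := hX p hp
    obtain ⟨b1, b2, b3⟩ := hX q hq
    have hdiff : ∀ μ, ‖φ p μ - φ q μ‖ ≤ ε / 16 := by
      intro μ
      have hr := h3 μ
      have hr1 : ‖logRatio ħ p.1 q.1 p.2 q.2 μ‖ ≤ 1 / 2 := hr.trans (min_le_left _ _)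
      have hr2 : ‖logRatio ħ p.1 q.1 p.2 q.2 μ‖ ≤ ε / 4 := hr.trans (min_le_right _ _)
      have e1 : φ q μ = φ p μ * exp (logRatio ħ p.1 q.1 p.2 q.2 μ) := by
        simp only [hφdef]
        rw [Theta_eq_exp_logRatio hm0 hm hp.2.1 hq.2.1 h2 μ, mul_inv]
        have := Complex.exp_ne_zero (logRatio ħ p.1 q.1 p.2 q.2 μ)
        field_simp
      have e2 : φ p μ - φ q μ = φ p μ * (exp 0 - exp (logRatio ħ p.1 q.1 p.2 q.2 μ)) := by
        rw [e1, Complex.exp_zero]; ring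
      rw [e2, norm_mul]
      have e3 := norm_exp_sub_exp_le (a := 0) (by simp) hr1
      rw [zero_sub, norm_neg] at e3
      calc _ ≤ 1 / 8 * (2 * (ε / 4)) := mul_le_mul (hφ p hp μ) (by linarith) (norm_nonneg _)
            (by norm_num)
        _ = ε / 16 := by ring
    have hstep : ∀ d : ℝ, (∀ μ, ‖X p μ - X q μ‖ ≤ d) → ∀ μ, ‖X p μ - X q μ‖ ≤ ε / 8 + d / 2 := by
      intro d hd μ
      have := norm_iterate_sub_le hħ a1 b1 (hφ p hp) hdiff a2 b2 hd μ
      rw [← a3, ← b3] at this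
      linarith
    -- The distance s of the two solutions obeys s ≤ ε/8 + s/2. Finiteness of s is needed before
    -- this can be solved to s ≤ ε/4.
    have hb : BddAbove (Set.range fun μ => ‖X p μ - X q μ‖) := ⟨1 / 2, by
      rintro _ ⟨μ, rfl⟩
      exact (norm_sub_le _ _).trans (by linarith [a2 μ, b2 μ])⟩
    have hs := hstep _ (fun μ => le_ciSup hb μ)
    have hs' := ciSup_le hs
    intro μ
    rw [dist_eq_norm]
    have := hs μ
    linarith

/-! ### Decay of solutions -/

section Decay

variable {N : ℕ} {ħ : ℝ} {δ : Fin N → ℂ} {Λ : ℝ} {X : ℝ → ℂ}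

theorem continuous_log_one_add (hX : Continuous X) (hre : ∀ μ, -(1 / 2) < (X μ).re) :
    Continuous fun μ => Complex.log (1 + X μ) :=
  (continuous_const.add hX).clog fun μ => Or.inl (by
    have := hre μ
    simp; linarith)

theorem IsNLIESolution.exp_poisson (hħ : 0 < ħ) (hδ : δ ∈ strip N ħ) (hΛ : 0 < Λ)
    (h : IsNLIESolution ħ δ Λ X) (μ : ℝ) :
    exp (poisson ħ (fun μ => Complex.log (1 + X μ)) μ) = X μ * Theta ħ δ Λ μ := by
  obtain ⟨m, hm0, hm⟩ := exists_gap hδ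
  rw [← nlie_integral_eq hħ, ← h.equation, Complex.exp_log]
  exact mul_ne_zero (h.ne_zero μ) (Theta_ne_zero hm hΛ (by simpa using hm0))

theorem IsNLIESolution.exists_bound (h : IsNLIESolution ħ δ Λ X)
    (hre : ∀ μ, -(1 / 2) < (X μ).re) : ∃ M, 0 ≤ M ∧ ∀ μ, ‖Complex.log (1 + X μ)‖ ≤ M := by
  obtain ⟨B, hB⟩ := h.bounded
  exact ⟨2 * B, by linarith [(norm_nonneg _).trans (hB 0)], fun μ =>
    (norm_log_one_add_le (hre μ)).trans (by linarith [hB μ])⟩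

/-- Since X = e^{PL}/Θ with PL bounded, X inherits the decay of 1/Θ. -/
theorem IsNLIESolution.exists_decay (hN : N ≠ 0) (hħ : 0 < ħ) (hδ : δ ∈ strip N ħ) (hΛ : 0 < Λ)
    (h : IsNLIESolution ħ δ Λ X) (hre : ∀ μ, -(1 / 2) < (X μ).re) :
    ∃ C, 0 ≤ C ∧ ∀ μ, ‖X μ‖ ≤ C * (1 + μ ^ 2)⁻¹ := by
  obtain ⟨m, hm0, hm⟩ := exists_gap hδ
  obtain ⟨C, hC0, hC⟩ := exists_norm_Theta_inv_le (Λ := Λ) hN hm0 hm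
  obtain ⟨M, hM0, hM⟩ := h.exists_bound hre
  refine ⟨Real.exp M * C, by positivity, fun μ => ?_⟩
  have hΘ : Theta ħ δ Λ μ ≠ 0 := Theta_ne_zero hm hΛ (by simpa using hm0)
  have e : X μ = exp (poisson ħ (fun μ => Complex.log (1 + X μ)) μ) * (Theta ħ δ Λ μ)⁻¹ := by
    rw [h.exp_poisson hħ hδ hΛ, mul_inv_cancel_right₀ hΘ]
  rw [e, norm_mul, mul_assoc]
  refine mul_le_mul ?_ ?_ (norm_nonneg _) (Real.exp_nonneg _)
  · exact (Complex.norm_exp_le_exp_norm _).trans (Real.exp_le_exp.2 (norm_poisson_le hħ hM μ))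
  · have := hC μ (by rw [Complex.ofReal_im, abs_zero]; linarith)
    simpa using this

theorem IsNLIESolution.integrable_norm (hN : N ≠ 0) (hħ : 0 < ħ) (hδ : δ ∈ strip N ħ) (hΛ : 0 < Λ)
    (h : IsNLIESolution ħ δ Λ X) (hre : ∀ μ, -(1 / 2) < (X μ).re) : Integrable X := by
  obtain ⟨C, hC0, hC⟩ := h.exists_decay hN hħ hδ hΛ hre
  exact (integrable_inv_one_add_sq.const_mul C).mono' h.continuous.aestronglyMeasurable
    (Eventually.of_forall hC)

theorem IsNLIESolution.integrable_log (hN : N ≠ 0) (hħ : 0 < ħ) (hδ : δ ∈ strip N ħ) (hΛ : 0 < Λ)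
    (h : IsNLIESolution ħ δ Λ X) (hre : ∀ μ, -(1 / 2) < (X μ).re) :
    Integrable fun μ => Complex.log (1 + X μ) :=
  ((h.integrable_norm hN hħ hδ hΛ hre).norm.const_mul 2).mono'
    (continuous_log_one_add h.continuous hre).aestronglyMeasurable
    (Eventually.of_forall fun μ => norm_log_one_add_le (hre μ))

end Decay

/-! ### Second order variation of the Yang-Yang function -/

theorem norm_dilog_neg_le {z : ℂ} (hz : -(1 / 2) < z.re) : ‖dilog (-z)‖ ≤ 2 * ‖z‖ := by
  rw [dilog, norm_neg]
  have := intervalIntegral.norm_integral_le_of_norm_le_const (a := 0) (b := 1)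
    (f := fun t : ℝ => Complex.log (1 - (t : ℂ) * -z) / (t : ℂ)) (C := 2 * ‖z‖) ?_
  · simpa using this
  · intro t ht
    rw [Set.uIoc_of_le zero_le_one] at ht
    have h1 : -(1 / 2) < ((t : ℂ) * z).re := by
      rw [Complex.re_ofReal_mul]
      nlinarith [ht.1, ht.2]
    have h2 := norm_log_one_add_le h1
    rw [norm_mul, Complex.norm_real, Real.norm_of_nonneg ht.1.le] at h2
    rw [norm_div, Complex.norm_real, Real.norm_of_nonneg ht.1.le, div_le_iff₀ ht.1,
      mul_neg, sub_neg_eq_add]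
    linarith

/-- The pointwise inequality Re X > -1/2 becomes uniform: on a compact interval the minimum is
attained, and outside it X is small. A uniform gap κ is what gives a contraction factor strictly
below 1. -/
theorem exists_re_bound {X : ℝ → ℂ} (hX : Continuous X) {C : ℝ} (hC0 : 0 ≤ C)
    (hC : ∀ μ, ‖X μ‖ ≤ C * (1 + μ ^ 2)⁻¹) (hre : ∀ μ, -(1 / 2) < (X μ).re) :
    ∃ κ, 0 < κ ∧ κ ≤ 1 ∧ ∀ μ, -(1 / 2) + κ ≤ (X μ).re := by
  -- Beyond R the decay bound gives |X| ≤ 1/4.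
  set R := 4 * C + 1
  obtain ⟨x₀, -, hx₀⟩ := (isCompact_Icc (a := -R) (b := R)).exists_isMinOn
    ⟨0, by constructor <;> simp only [R] <;> linarith⟩
    (Complex.continuous_re.comp hX).continuousOn
  refine ⟨min (1 / 4) ((X x₀).re + 1 / 2), lt_min (by norm_num) (by linarith [hre x₀]),
    (min_le_left _ _).trans (by norm_num), fun μ => ?_⟩
  by_cases hμ : μ ∈ Set.Icc (-R) R
  · have h1 : (X x₀).re ≤ (X μ).re := hx₀ hμ
    linarith [min_le_right (1 / 4) ((X x₀).re + 1 / 2)]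
  · have hR : R ≤ |μ| := by
      by_contra h
      exact hμ (abs_le.1 (not_le.1 h).le)
    have h2 : 4 * C ≤ 1 + μ ^ 2 := by
      rw [← sq_abs μ]
      have h1 : 1 ≤ R := by simp only [R]; linarith
      have h3 : 4 * C = R - 1 := by simp only [R]; ring
      nlinarith
    have h3 : ‖X μ‖ ≤ 1 / 4 := by
      refine (hC μ).trans ?_
      rw [← div_eq_mul_inv, div_le_iff₀ (by positivity)]
      linarith
    have h4 := abs_le.1 ((Complex.abs_re_le_norm _).trans h3)
    linarith [min_le_left (1 / 4) ((X x₀).re + 1 / 2)]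

/-! ### Pointwise estimates along s ↦ z e^s -/

section Local

variable {κ B η : ℝ} {z : ℂ}

/-- With w = z e^s, the quotient w/(1+w) is the s-derivative of log(1+w). It is less than 1 in
modulus because |1+w|² - |w|² = 1 + 2 Re w, which stays at least κ when s is so small that half of
the gap survives. -/
theorem norm_mul_exp_estimates (hκ : 0 < κ) (hκ1 : κ ≤ 1) (hz : -(1 / 2) + κ ≤ z.re)
    (hB : ‖z‖ ≤ B) (hη : η ≤ 1 / 2) (hηκ : 4 * B * η ≤ κ) {s : ℂ} (hs : ‖s‖ ≤ η) :
    -(1 / 2) < (z * exp s).re ∧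
      ‖z * exp s / (1 + z * exp s)‖ ≤ 1 - κ / (2 * (1 + 2 * B) ^ 2) ∧
      ‖z * exp s / (1 + z * exp s)‖ ≤ 4 * ‖z‖ := by
  have hB0 : 0 ≤ B := (norm_nonneg _).trans hB
  have hη0 : 0 ≤ η := (norm_nonneg _).trans hs
  have hs2 : ‖s‖ ≤ 1 / 2 := hs.trans hη
  set w := z * exp s
  have h1 : ‖w‖ ≤ 2 * ‖z‖ := by
    rw [norm_mul, mul_comm]
    exact mul_le_mul_of_nonneg_right (norm_exp_le_two hs2) (norm_nonneg _)
  have h2 : ‖w - z‖ ≤ κ / 2 := by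
    have e : w - z = z * (exp s - exp 0) := by simp only [w, Complex.exp_zero]; ring
    have e2 := norm_exp_sub_exp_le hs2 (b := 0) (by simp)
    rw [sub_zero] at e2
    rw [e, norm_mul]
    calc _ ≤ B * (2 * η) := mul_le_mul hB (e2.trans (by linarith)) (norm_nonneg _) hB0
      _ ≤ κ / 2 := by linarith
  have h3 : -(1 / 2) + κ / 2 ≤ w.re := by
    have := abs_le.1 ((Complex.abs_re_le_norm _).trans h2)
    rw [Complex.sub_re] at this
    linarith
  have h4 : (1 / 2 : ℝ) ≤ ‖1 + w‖ := by
    refine le_trans ?_ (Complex.re_le_norm _)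
    simp only [Complex.add_re, Complex.one_re]; linarith
  have h5 : ‖1 + w‖ ≤ 1 + 2 * B := by
    refine (norm_add_le _ _).trans ?_
    rw [norm_one]; linarith
  have h6 : ‖1 + w‖ ^ 2 = ‖w‖ ^ 2 + 1 + 2 * w.re := by
    rw [← Complex.normSq_eq_norm_sq, ← Complex.normSq_eq_norm_sq, Complex.normSq_apply,
      Complex.normSq_apply]
    simp only [Complex.add_re, Complex.one_re, Complex.add_im, Complex.one_im]
    ring
  refine ⟨by linarith, ?_, ?_⟩
  · rw [norm_div, div_le_iff₀ (by linarith)]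
    -- Chosen so that 2c|1+w|² ≤ κ, hence (1-c)²|1+w|² ≥ |1+w|² - κ ≥ |w|².
    set c := κ / (2 * (1 + 2 * B) ^ 2) with hc
    have hc0 : 0 ≤ c := by positivity
    have hcB : c * (2 * (1 + 2 * B) ^ 2) = κ := by rw [hc]; field_simp
    have hc1 : c ≤ 1 := by
      rw [hc, div_le_one (by positivity)]
      nlinarith
    have h7 : ‖w‖ ^ 2 ≤ ((1 - c) * ‖1 + w‖) ^ 2 := by
      have h8 : 2 * c * ‖1 + w‖ ^ 2 ≤ κ := by
        rw [← hcB]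
        have := pow_le_pow_left₀ (norm_nonneg _) h5 2
        nlinarith
      have : ((1 - c) * ‖1 + w‖) ^ 2 = ‖1 + w‖ ^ 2 - 2 * c * ‖1 + w‖ ^ 2 +
        c ^ 2 * ‖1 + w‖ ^ 2 := by ring
      rw [this]
      have : 0 ≤ c ^ 2 * ‖1 + w‖ ^ 2 := by positivity
      linarith
    exact (pow_le_pow_iff_left₀ (norm_nonneg _)
      (mul_nonneg (by linarith) (norm_nonneg _)) two_ne_zero).1 h7
  · rw [norm_div, div_le_iff₀ (by linarith)]
    nlinarith [norm_nonneg z]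

/-- Mean value inequality with the two derivative bounds. The first bound is contracting and is used
in sup norm; the second carries the factor ‖z‖ and is used under integrals over μ. -/
theorem log_exp_estimates (hκ : 0 < κ) (hκ1 : κ ≤ 1) (hz : -(1 / 2) + κ ≤ z.re)
    (hB : ‖z‖ ≤ B) (hη : η ≤ 1 / 2) (hηκ : 4 * B * η ≤ κ) {s : ℂ} (hs : ‖s‖ ≤ η) :
    ‖Complex.log (1 + z * exp s) - Complex.log (1 + z)‖ ≤
      (1 - κ / (2 * (1 + 2 * B) ^ 2)) * ‖s‖ ∧
    ‖Complex.log (1 + z * exp s) - Complex.log (1 + z)‖ ≤ 4 * ‖z‖ * ‖s‖ := by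
  have hd : ∀ t ∈ Metric.closedBall (0 : ℂ) η,
      HasDerivWithinAt (fun t => Complex.log (1 + z * exp t)) (z * exp t / (1 + z * exp t))
        (Metric.closedBall (0 : ℂ) η) t := by
    intro t ht
    have h := (norm_mul_exp_estimates hκ hκ1 hz hB hη hηκ (s := t) (by simpa using ht)).1
    exact ((((Complex.hasDerivAt_exp t).const_mul z).const_add 1).clog
      (Or.inl (by simp only [Complex.add_re, Complex.one_re]; linarith))).hasDerivWithinAt
  have h0 : (0 : ℂ) ∈ Metric.closedBall (0 : ℂ) η := by simpa using (norm_nonneg _).trans hs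
  have hsm : s ∈ Metric.closedBall (0 : ℂ) η := by simpa using hs
  constructor
  · simpa using (convex_closedBall (0 : ℂ) η).norm_image_sub_le_of_norm_hasDerivWithin_le hd
      (fun t ht => (norm_mul_exp_estimates hκ hκ1 hz hB hη hηκ (by simpa using ht)).2.1) h0 hsm
  · simpa using (convex_closedBall (0 : ℂ) η).norm_image_sub_le_of_norm_hasDerivWithin_le hd
      (fun t ht => (norm_mul_exp_estimates hκ hκ1 hz hB hη hηκ (by simpa using ht)).2.2) h0 hsm

/-- The left side has t-derivative log(1+z) - log(1+z e^t), which is already O(‖z‖‖t‖). Applying the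
mean value inequality on the ball of radius ‖s‖, rather than η, makes the bound quadratic in s. -/
theorem dilog_exp_estimate (hκ : 0 < κ) (hκ1 : κ ≤ 1) (hz : -(1 / 2) + κ ≤ z.re)
    (hB : ‖z‖ ≤ B) (hη : η ≤ 1 / 2) (hηκ : 4 * B * η ≤ κ) {s : ℂ} (hs : ‖s‖ ≤ η) :
    ‖dilog (-(z * exp s)) - dilog (-z) + s * Complex.log (1 + z)‖ ≤ 4 * ‖z‖ * ‖s‖ ^ 2 := by
  have hle : ∀ t ∈ Metric.closedBall (0 : ℂ) ‖s‖, ‖t‖ ≤ η := fun t ht =>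
    (by simpa using ht : ‖t‖ ≤ ‖s‖).trans hs
  have hd : ∀ t ∈ Metric.closedBall (0 : ℂ) ‖s‖,
      HasDerivWithinAt (fun t => dilog (-(z * exp t)) + t * Complex.log (1 + z))
        (-Complex.log (1 + z * exp t) + 1 * Complex.log (1 + z))
        (Metric.closedBall (0 : ℂ) ‖s‖) t := by
    intro t ht
    have h := (norm_mul_exp_estimates hκ hκ1 hz hB hη hηκ (hle t ht)).1
    exact ((hasDerivAt_dilog_neg_mul_exp (by linarith)).add
      ((hasDerivAt_id t).mul_const _)).hasDerivWithinAt
  have := (convex_closedBall (0 : ℂ) ‖s‖).norm_image_sub_le_of_norm_hasDerivWithin_le hd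
      (C := 4 * ‖z‖ * ‖s‖)
      (fun t ht => by
        have h := (log_exp_estimates hκ hκ1 hz hB hη hηκ (hle t ht)).2
        rw [one_mul, neg_add_eq_sub, norm_sub_rev]
        refine h.trans (mul_le_mul_of_nonneg_left (by simpa using ht) (by positivity)))
      (show (0 : ℂ) ∈ _ by simp) (show s ∈ _ by simp)
  simp only [Complex.exp_zero, mul_one, zero_mul, add_zero, sub_zero] at this
  calc _ = ‖dilog (-(z * exp s)) + s * Complex.log (1 + z) - dilog (-z)‖ := by congr 1; ring
    _ ≤ _ := this
    _ = _ := by ring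

end Local

/-- The integral in the instanton part of the Yang-Yang function. -/
def instIntegral {N : ℕ} (ħ : ℝ) (X : (Fin N → ℂ) × ℝ → ℝ → ℂ) (p : (Fin N → ℂ) × ℝ) : ℂ :=
  ∫ μ : ℝ, (Complex.log (X p μ * Theta ħ p.1 p.2 μ) / 2 * Complex.log (1 + X p μ) +
    dilog (-X p μ))

theorem YInst_eq {N : ℕ} (ħ : ℝ) (X : (Fin N → ℂ) × ℝ → ℝ → ℂ) (δ : Fin N → ℂ) (Λ : ℝ) :
    YInst ħ δ Λ (X (δ, Λ)) = -(1 / (2 * Real.pi * I)) * instIntegral ħ X (δ, Λ) := by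
  rw [YInst, instIntegral, integral_const_mul, neg_mul]

section Variation

variable {N : ℕ} {ħ : ℝ} {D : Set ((Fin N → ℂ) × ℝ)} {X : (Fin N → ℂ) × ℝ → ℝ → ℂ}

theorem IsSolutionFamily.integrable_terms (hN : N ≠ 0) (hħ : 0 < ħ) (h : IsSolutionFamily ħ D X)
    {p q : (Fin N → ℂ) × ℝ} (hp : p ∈ D) (hq : q ∈ D) :
    Integrable (fun μ => poisson ħ (fun μ => Complex.log (1 + X p μ)) μ *
      Complex.log (1 + X q μ)) ∧ Integrable (fun μ => dilog (-X p μ)) := by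
  have hsp := h.solution p hp
  have hsq := h.solution q hq
  have hcp := continuous_log_one_add hsp.continuous (h.contracting p hp)
  obtain ⟨M, -, hM⟩ := hsp.exists_bound (h.contracting p hp)
  constructor
  · exact (hsq.integrable_log hN hħ (h.mem_strip q hq) (h.pos q hq) (h.contracting q hq)).bdd_mul
      (continuous_poisson hħ hcp hM).aestronglyMeasurable
      (Eventually.of_forall (norm_poisson_le hħ hM))
  · have hc : Continuous fun μ => dilog (-X p μ) := by
      refine continuous_iff_continuousAt.2 fun μ => ContinuousAt.comp (f := fun μ => -X p μ)
        (continuousAt_dilog ?_) hsp.continuous.neg.continuousAt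
      have := h.contracting p hp μ
      rw [Complex.neg_re]; linarith
    exact ((hsp.integrable_norm hN hħ (h.mem_strip p hp) (h.pos p hp)
      (h.contracting p hp)).norm.const_mul 2).mono' hc.aestronglyMeasurable
      (Eventually.of_forall fun μ => norm_dilog_neg_le (h.contracting p hp μ))

/-- The integral equation removes Θ, leaving a symmetric quadratic form in log(1+X) plus a
dilogarithm. -/
theorem IsSolutionFamily.instIntegral_eq (hħ : 0 < ħ) (h : IsSolutionFamily ħ D X)
    {p : (Fin N → ℂ) × ℝ} (hp : p ∈ D) :
    instIntegral ħ X p = ∫ μ, (1 / 2 * (poisson ħ (fun μ => Complex.log (1 + X p μ)) μ *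
      Complex.log (1 + X p μ)) + dilog (-X p μ)) := by
  refine integral_congr_ae (Eventually.of_forall fun μ => ?_)
  simp only
  rw [(h.solution p hp).equation μ, nlie_integral_eq hħ]
  ring

/-- The first variation through X cancels and only the explicit dependence on Θ remains, with a
quadratic error. The free bound ρ allows the same statement to be applied to variations of δ and of
Λ. -/
theorem IsSolutionFamily.exists_variation (hN : N ≠ 0) (hħ : 0 < ħ) (h : IsSolutionFamily ħ D X)
    {p : (Fin N → ℂ) × ℝ} (hp : p ∈ D) :
    ∃ C η, 0 < η ∧ ∀ᶠ q in 𝓝 p, ∀ ρ ≤ η, (∀ μ, ‖logRatio ħ p.1 q.1 p.2 q.2 μ‖ ≤ ρ) →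
      ‖instIntegral ħ X q - instIntegral ħ X p +
        ∫ μ, logRatio ħ p.1 q.1 p.2 q.2 μ * Complex.log (1 + X p μ)‖ ≤ C * ρ ^ 2 := by
  have hδ := h.mem_strip p hp
  have hΛ := h.pos p hp
  have hsp := h.solution p hp
  have hrep := h.contracting p hp
  obtain ⟨m, hm0, hm⟩ := exists_gap hδ
  obtain ⟨C₀, hC₀, hdec⟩ := hsp.exists_decay hN hħ hδ hΛ hrep
  obtain ⟨κ, hκ, hκ1, hre⟩ := exists_re_bound hsp.continuous hC₀ hdec hrep
  obtain ⟨B, hB⟩ := hsp.bounded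
  have hB0 : 0 ≤ B := (norm_nonneg _).trans (hB 0)
  -- The largest displacement of log X that the pointwise estimates tolerate; one half of it is
  -- reserved for `logRatio`, the other for the change of the convolution.
  set η := min (1 / 2) (κ / (4 * B + 1)) with hηdef
  have hη0 : 0 < η := lt_min (by norm_num) (by positivity)
  have hη : η ≤ 1 / 2 := min_le_left _ _
  have hηκ : 4 * B * η ≤ κ := by
    have h1 : η ≤ κ / (4 * B + 1) := min_le_right _ _
    rw [le_div_iff₀ (by positivity)] at h1
    linarith
  set c := κ / (2 * (1 + 2 * B) ^ 2) with hc
  have hc0 : 0 < c := by positivity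
  have hc1 : c ≤ 1 := by
    rw [hc, div_le_one (by positivity)]
    nlinarith
  set K := 1 / c with hK
  have hK0 : 0 < K := by positivity
  refine ⟨6 * K ^ 2 * ∫ μ, ‖X p μ‖, η / 2, by positivity, ?_⟩
  -- Continuity of the family serves only to bring the change of X into the range of the pointwise
  -- estimates; the linear rate is derived afterwards.
  have hunif := (Metric.tendstoUniformly_iff.1 (h.continuous p hp)) (η / 4) (by positivity)
  filter_upwards [h.isOpen.mem_nhds hp, hunif,
    eventually_logRatio_le hm0 hm hΛ (e := 1) one_pos] with q hq hXq ⟨_, hδq, _⟩ ρ hρη hρ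
  have hρ0 : 0 ≤ ρ := (norm_nonneg _).trans (hρ 0)
  have hsq := h.solution q hq
  have hreq := h.contracting q hq
  set Lp : ℝ → ℂ := fun μ => Complex.log (1 + X p μ) with hLp
  set Lq : ℝ → ℂ := fun μ => Complex.log (1 + X q μ) with hLq
  set r := logRatio ħ p.1 q.1 p.2 q.2 with hr
  have hLpc : Continuous Lp := continuous_log_one_add hsp.continuous hrep
  have hLqc : Continuous Lq := continuous_log_one_add hsq.continuous hreq
  obtain ⟨Mp, -, hMp⟩ := hsp.exists_bound hrep
  obtain ⟨Mq, -, hMq⟩ := hsq.exists_bound hreq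
  have hG : ∀ μ, poisson ħ Lq μ - poisson ħ Lp μ = poisson ħ (fun μ => Lq μ - Lp μ) μ :=
    poisson_sub hħ hLqc.aestronglyMeasurable hLpc.aestronglyMeasurable hMq hMp
  have hGη : ∀ μ, ‖poisson ħ Lq μ - poisson ħ Lp μ‖ ≤ η / 2 := fun μ => by
    rw [hG]
    refine norm_poisson_le hħ (fun μ => (norm_log_one_add_sub_le (hreq μ) (hrep μ)).trans ?_) μ
    have := hXq μ
    rw [dist_comm, dist_eq_norm] at this
    linarith
  -- The multiplicative displacement of X, obtained by dividing the exponentiated equations at q and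
  -- p.
  set y : ℝ → ℂ := fun μ => poisson ħ Lq μ - poisson ħ Lp μ + r μ with hy
  have hXy : ∀ μ, X q μ = X p μ * exp (y μ) := by
    intro μ
    have hΘp : Theta ħ p.1 p.2 μ ≠ 0 := Theta_ne_zero hm hΛ (by simpa using hm0)
    have e1 := hsp.exp_poisson hħ hδ hΛ μ
    have e2 := hsq.exp_poisson hħ (h.mem_strip q hq) (h.pos q hq) μ
    have e3 := Theta_eq_exp_logRatio hm0 hm hΛ (h.pos q hq) hδq μ
    have hΘq : Theta ħ q.1 q.2 μ ≠ 0 := fun h0 => hΘp (by rw [e3, h0, mul_zero])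
    simp only [hy]
    rw [Complex.exp_add, Complex.exp_sub]
    change X q μ = X p μ * (exp (poisson ħ (fun μ => Complex.log (1 + X q μ)) μ) /
      exp (poisson ħ (fun μ => Complex.log (1 + X p μ)) μ) * exp (r μ))
    rw [e1, e2, e3]
    have h1 := hsp.ne_zero μ
    have h2 := Complex.exp_ne_zero (r μ)
    simp only [← hr]
    field_simp
  have hyη : ∀ μ, ‖y μ‖ ≤ η := fun μ =>
    (norm_add_le _ _).trans (by linarith [hGη μ, hρ μ])
  have hest := fun μ => log_exp_estimates hκ hκ1 (hre μ) (hB μ) hη hηκ (hyη μ)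
  simp_rw [← hXy] at hest
  have hbdd : BddAbove (Set.range fun μ => ‖poisson ħ Lq μ - poisson ħ Lp μ‖) :=
    ⟨η / 2, by rintro _ ⟨μ, rfl⟩; exact hGη μ⟩
  set g := ⨆ μ, ‖poisson ħ Lq μ - poisson ħ Lp μ‖ with hg
  have hgle : ∀ μ, ‖poisson ħ Lq μ - poisson ħ Lp μ‖ ≤ g := le_ciSup hbdd
  have hyg : ∀ μ, ‖y μ‖ ≤ g + ρ := fun μ =>
    (norm_add_le _ _).trans (add_le_add (hgle μ) (hρ μ))
  -- The uniform contraction bootstraps: the change g of the convolution is bounded by (1-c) times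
  -- itself plus ρ, so g + ρ ≤ ρ/c.
  have hgg : g ≤ (1 - c) * (g + ρ) := by
    refine ciSup_le fun μ => ?_
    rw [hG]
    exact norm_poisson_le hħ (fun μ => (hest μ).1.trans
      (mul_le_mul_of_nonneg_left (hyg μ) (by linarith))) μ
  have hKc : K * c = 1 := by rw [hK]; field_simp
  have hgρ : g + ρ ≤ K * ρ := by
    have : c * (g + ρ) ≤ ρ := by linarith
    calc g + ρ = K * (c * (g + ρ)) := by rw [← mul_assoc, hKc, one_mul]
      _ ≤ K * ρ := mul_le_mul_of_nonneg_left this hK0.le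
  have hyK : ∀ μ, ‖y μ‖ ≤ K * ρ := fun μ => (hyg μ).trans hgρ
  have hGK : ∀ μ, ‖poisson ħ Lq μ - poisson ħ Lp μ‖ ≤ K * ρ := fun μ => (hgle μ).trans (by linarith)
  obtain ⟨ipp, idp⟩ := h.integrable_terms hN hħ hp hp
  obtain ⟨iqq, idq⟩ := h.integrable_terms hN hħ hq hq
  obtain ⟨iqp, -⟩ := h.integrable_terms hN hħ hq hp
  obtain ⟨ipq, -⟩ := h.integrable_terms hN hħ hp hq
  have hLpi := hsp.integrable_log hN hħ hδ hΛ hrep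
  have hLqi := hsq.integrable_log hN hħ (h.mem_strip q hq) (h.pos q hq) hreq
  have irL : Integrable fun μ => r μ * Lp μ :=
    hLpi.bdd_mul (continuous_logRatio hm0 hm hδq).aestronglyMeasurable (Eventually.of_forall hρ)
  have hsymm : ∫ μ, poisson ħ Lq μ * Lp μ = ∫ μ, poisson ħ Lp μ * Lq μ :=
    integral_poisson_mul_comm hħ hLqi hLpi
  have hΔ : ∫ μ, (poisson ħ Lq μ - poisson ħ Lp μ) * (Lq μ - Lp μ) =
      (∫ μ, poisson ħ Lq μ * Lq μ) - 2 * (∫ μ, poisson ħ Lq μ * Lp μ) +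
        ∫ μ, poisson ħ Lp μ * Lp μ := by
    have : ∀ μ, (poisson ħ Lq μ - poisson ħ Lp μ) * (Lq μ - Lp μ) =
      (poisson ħ Lq μ * Lq μ - poisson ħ Lq μ * Lp μ) -
        (poisson ħ Lp μ * Lq μ - poisson ħ Lp μ * Lp μ) := fun μ => by ring
    simp_rw [this]
    have i1 : Integrable fun μ => poisson ħ Lq μ * Lq μ - poisson ħ Lq μ * Lp μ := iqq.sub iqp
    have i2 : Integrable fun μ => poisson ħ Lp μ * Lq μ - poisson ħ Lp μ * Lp μ := ipq.sub ipp
    rw [integral_sub i1 i2, integral_sub iqq iqp, integral_sub ipq ipp,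
      ← hsymm]
    ring
  set E : ℝ → ℂ := fun μ => dilog (-X q μ) - dilog (-X p μ) + y μ * Lp μ with hE
  have hyL : Integrable fun μ => y μ * Lp μ := by
    have : (fun μ => y μ * Lp μ) = fun μ =>
      poisson ħ Lq μ * Lp μ - poisson ħ Lp μ * Lp μ + r μ * Lp μ := by
      ext μ; simp only [hy]; ring
    rw [this]
    exact (iqp.sub ipp).add irL
  have hEi : ∫ μ, E μ = (∫ μ, dilog (-X q μ)) - (∫ μ, dilog (-X p μ)) +
      ((∫ μ, poisson ħ Lq μ * Lp μ) - (∫ μ, poisson ħ Lp μ * Lp μ) + ∫ μ, r μ * Lp μ) := by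
    simp only [hE]
    have i1 : Integrable fun μ => dilog (-X q μ) - dilog (-X p μ) := idq.sub idp
    have i2 : Integrable fun μ => poisson ħ Lq μ * Lp μ - poisson ħ Lp μ * Lp μ := iqp.sub ipp
    rw [integral_add i1 hyL, integral_sub idq idp]
    have : ∀ μ, y μ * Lp μ =
      poisson ħ Lq μ * Lp μ - poisson ħ Lp μ * Lp μ + r μ * Lp μ := by
      intro μ; simp only [hy]; ring
    simp_rw [this]
    rw [integral_add i2 irL, integral_sub iqp ipp]
  -- An exact identity, using the symmetry of the convolution. Both terms on the right are second
  -- order: a product of two differences and the Taylor remainder of the dilogarithm.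
  have hmain : instIntegral ħ X q - instIntegral ħ X p + ∫ μ, r μ * Lp μ =
      1 / 2 * (∫ μ, (poisson ħ Lq μ - poisson ħ Lp μ) * (Lq μ - Lp μ)) + ∫ μ, E μ := by
    rw [h.instIntegral_eq hħ hp, h.instIntegral_eq hħ hq, hΔ, hEi,
      integral_add (iqq.const_mul _) idq, integral_add (ipp.const_mul _) idp,
      integral_const_mul, integral_const_mul]
    ring
  have hXi := (hsp.integrable_norm hN hħ hδ hΛ hrep).norm
  have b1 : ‖∫ μ, (poisson ħ Lq μ - poisson ħ Lp μ) * (Lq μ - Lp μ)‖ ≤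
      ∫ μ, 4 * (K * ρ) ^ 2 * ‖X p μ‖ := by
    refine norm_integral_le_of_norm_le (hXi.const_mul _) (Eventually.of_forall fun μ => ?_)
    rw [norm_mul]
    have h1 := (hest μ).2
    have h2 : 4 * ‖X p μ‖ * ‖y μ‖ ≤ 4 * ‖X p μ‖ * (K * ρ) :=
      mul_le_mul_of_nonneg_left (hyK μ) (by positivity)
    calc _ ≤ (K * ρ) * (4 * ‖X p μ‖ * (K * ρ)) :=
          mul_le_mul (hGK μ) (h1.trans h2) (norm_nonneg _) (by positivity)
      _ = _ := by ring
  have b2 : ‖∫ μ, E μ‖ ≤ ∫ μ, 4 * (K * ρ) ^ 2 * ‖X p μ‖ := by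
    refine norm_integral_le_of_norm_le (hXi.const_mul _) (Eventually.of_forall fun μ => ?_)
    have h1 := dilog_exp_estimate hκ hκ1 (hre μ) (hB μ) hη hηκ (hyη μ)
    rw [← hXy] at h1
    refine h1.trans ?_
    have h2 : ‖y μ‖ ^ 2 ≤ (K * ρ) ^ 2 := pow_le_pow_left₀ (norm_nonneg _) (hyK μ) 2
    nlinarith [norm_nonneg (X p μ)]
  rw [integral_const_mul] at b1 b2
  change ‖instIntegral ħ X q - instIntegral ħ X p + ∫ μ, r μ * Lp μ‖ ≤ _
  rw [hmain]
  refine (norm_add_le _ _).trans ?_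
  rw [norm_mul]
  have : ‖(1 / 2 : ℂ)‖ = 1 / 2 := by norm_num
  rw [this]
  calc _ ≤ 1 / 2 * (4 * (K * ρ) ^ 2 * ∫ μ, ‖X p μ‖) + 4 * (K * ρ) ^ 2 * ∫ μ, ‖X p μ‖ := by
        linarith
    _ = _ := by ring

end Variation

/-! ### First derivatives of the Yang-Yang function -/

/-- The field is left general because δ varies over ℂ while log Λ varies over ℝ. -/
theorem hasDerivAt_of_norm_sub_le_sq {𝕜 : Type*} [NontriviallyNormedField 𝕜] [NormedSpace 𝕜 ℂ]
    {f : 𝕜 → ℂ} {c : ℂ} {s₀ : 𝕜} {C : ℝ}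
    (h : ∀ᶠ s in 𝓝 s₀, ‖f s - f s₀ - (s - s₀) • c‖ ≤ C * ‖s - s₀‖ ^ 2) :
    HasDerivAt f c s₀ := by
  rw [hasDerivAt_iff_isLittleO]
  refine (Asymptotics.IsBigO.of_bound C ?_).trans_isLittleO
    (Asymptotics.isLittleO_pow_sub_sub s₀ (m := 2) (by norm_num))
  filter_upwards [h] with s hs
  rwa [norm_pow, norm_norm]

section Derivatives

variable {N : ℕ} {ħ : ℝ} {D : Set ((Fin N → ℂ) × ℝ)} {X : (Fin N → ℂ) × ℝ → ℝ → ℂ}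
  {δ : Fin N → ℂ} {Λ : ℝ}

theorem norm_log_one_add_sub_self_le_sq {u : ℂ} (hu : ‖u‖ ≤ 1 / 2) :
    ‖Complex.log (1 + u) - u‖ ≤ ‖u‖ ^ 2 := by
  refine (Complex.norm_log_one_add_sub_self_le (by linarith)).trans ?_
  have h1 : (1 - ‖u‖)⁻¹ ≤ 2 := by
    rw [inv_le_comm₀ (by linarith) two_pos]; linarith
  have h2 : ‖u‖ ^ 2 * (1 - ‖u‖)⁻¹ ≤ ‖u‖ ^ 2 * 2 := mul_le_mul_of_nonneg_left h1 (by positivity)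
  linarith

/-- The derivative of `log Θ` with respect to `-δ` in the direction `v`. -/
def logThetaDeriv (ħ : ℝ) (δ v : Fin N → ℂ) (μ : ℝ) : ℂ :=
  ∑ k, (v k / (μ - I * ħ / 2 - δ k) + v k / (μ + I * ħ / 2 - δ k))

theorem norm_logRatio_sub_le {m : ℝ} (hm0 : 0 < m) (hm : ∀ k, |(δ k).im| + m ≤ ħ / 2)
    (v : Fin N → ℂ) {s : ℂ} (hs : ∀ k, ‖s * v k‖ ≤ m / 2) (μ : ℝ) :
    ‖logRatio ħ δ (δ + s • v) Λ Λ μ - s * logThetaDeriv ħ δ v μ‖ ≤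
      (∑ k, 2 * (‖v k‖ / m) ^ 2) * ‖s‖ ^ 2 := by
  have e : logRatio ħ δ (δ + s • v) Λ Λ μ - s * logThetaDeriv ħ δ v μ =
      -∑ k, ((Complex.log (1 + -(s * v k / (μ - I * ħ / 2 - δ k))) -
          -(s * v k / (μ - I * ħ / 2 - δ k))) +
        (Complex.log (1 + -(s * v k / (μ + I * ħ / 2 - δ k))) -
          -(s * v k / (μ + I * ħ / 2 - δ k)))) := by
    simp only [logRatio, logThetaDeriv, sub_self, mul_zero, zero_sub, Pi.add_apply, Pi.smul_apply,
      smul_eq_mul, add_sub_cancel_left]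
    rw [Finset.mul_sum, ← neg_add', ← Finset.sum_add_distrib, neg_inj]
    refine Finset.sum_congr rfl fun k _ => ?_
    ring
  rw [e, norm_neg, Finset.sum_mul]
  refine (norm_sum_le _ _).trans (Finset.sum_le_sum fun k _ => (norm_add_le _ _).trans ?_)
  obtain ⟨h1, h2⟩ := norm_div_sub_le hm0 hm k (s * v k) μ
  have hle : ‖s * v k‖ / m ≤ 1 / 2 := by
    rw [div_le_iff₀ hm0]; linarith [hs k]
  have h3 := norm_log_one_add_sub_self_le_sq (h1.trans hle)
  have h4 := norm_log_one_add_sub_self_le_sq (h2.trans hle)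
  have h5 := pow_le_pow_left₀ (norm_nonneg _) h1 2
  have h6 := pow_le_pow_left₀ (norm_nonneg _) h2 2
  have h7 : (‖s * v k‖ / m) ^ 2 = (‖v k‖ / m) ^ 2 * ‖s‖ ^ 2 := by
    rw [norm_mul]; ring
  rw [h7] at h5 h6
  linarith

theorem continuous_div_sub {m : ℝ} (hm0 : 0 < m) (hm : ∀ k, |(δ k).im| + m ≤ ħ / 2) (k : Fin N)
    (c : ℂ) : (Continuous fun μ : ℝ => c / (μ - I * ħ / 2 - δ k)) ∧
      Continuous fun μ : ℝ => c / (μ + I * ħ / 2 - δ k) := by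
  have h := fun μ : ℝ => le_norm_sub_of_gap hm (μ : ℂ) k
  simp only [Complex.ofReal_im, abs_zero, sub_zero] at h
  exact ⟨continuous_const.div (by fun_prop) fun μ => norm_pos_iff.1 (by linarith [(h μ).1]),
    continuous_const.div (by fun_prop) fun μ => norm_pos_iff.1 (by linarith [(h μ).2])⟩

theorem integrable_div_sub_mul {m : ℝ} (hm0 : 0 < m) (hm : ∀ k, |(δ k).im| + m ≤ ħ / 2)
    {L : ℝ → ℂ} (hL : Integrable L) (k : Fin N) (c : ℂ) :
    (Integrable fun μ : ℝ => c / (μ - I * ħ / 2 - δ k) * L μ) ∧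
      Integrable fun μ : ℝ => c / (μ + I * ħ / 2 - δ k) * L μ := by
  have h1 := continuous_div_sub hm0 hm k c
  have h2 := norm_div_sub_le hm0 hm k c
  simp only [norm_neg] at h2
  exact ⟨hL.bdd_mul h1.1.aestronglyMeasurable (Eventually.of_forall fun μ => (h2 μ).1),
    hL.bdd_mul h1.2.aestronglyMeasurable (Eventually.of_forall fun μ => (h2 μ).2)⟩

theorem integrable_logThetaDeriv_mul {m : ℝ} (hm0 : 0 < m) (hm : ∀ k, |(δ k).im| + m ≤ ħ / 2)
    {L : ℝ → ℂ} (hL : Integrable L) (v : Fin N → ℂ) :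
    Integrable fun μ => logThetaDeriv ħ δ v μ * L μ := by
  simp only [logThetaDeriv, Finset.sum_mul, add_mul]
  exact integrable_finsetSum _ fun k _ => (integrable_div_sub_mul hm0 hm hL k (v k)).1.add
    (integrable_div_sub_mul hm0 hm hL k (v k)).2

/-- At the point δ_k the two Cauchy kernels of log v_↑ and log v_↓ are, up to sign, the two terms of
the logarithmic derivative of Θ in δ_k. -/
theorem logVUp_sub_logVDown {m : ℝ} (hm0 : 0 < m) (hm : ∀ k, |(δ k).im| + m ≤ ħ / 2) {Y : ℝ → ℂ}
    (hL : Integrable fun μ => Complex.log (1 + Y μ)) (k : Fin N) (c : ℂ) :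
    c * (logVUp ħ Y (δ k) - logVDown ħ Y (δ k)) = 1 / (2 * Real.pi * I) *
      ∫ μ : ℝ, (c / (μ - I * ħ / 2 - δ k) + c / (μ + I * ħ / 2 - δ k)) *
        Complex.log (1 + Y μ) := by
  have h1 := integrable_div_sub_mul hm0 hm hL k c
  simp only [add_mul]
  rw [integral_add h1.1 h1.2, mul_add, ← integral_const_mul, ← integral_const_mul, logVUp, logVDown,
    mul_sub, mul_neg, ← integral_const_mul, ← integral_const_mul, ← integral_neg, sub_eq_add_neg,
    ← integral_neg]
  congr 1
  · refine integral_congr_ae (Eventually.of_forall fun μ => ?_)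
    simp only
    rw [← neg_sub (μ : ℂ), show -((μ : ℂ) - δ k) + I * ħ / 2 = -(μ - I * ħ / 2 - δ k) by ring,
      one_div (-_), inv_neg]
    ring
  · refine integral_congr_ae (Eventually.of_forall fun μ => ?_)
    simp only
    rw [← neg_sub (μ : ℂ), show -((μ : ℂ) - δ k) - I * ħ / 2 = -(μ + I * ħ / 2 - δ k) by ring,
      one_div (-_), inv_neg]
    ring

/-- Along a complex line `logRatio` is linear in s up to O(s²) uniformly in μ, so the variation
formula applies with ρ proportional to ‖s‖. -/
theorem IsSolutionFamily.hasDerivAt_YInst (hN : N ≠ 0) (hħ : 0 < ħ) (h : IsSolutionFamily ħ D X)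
    (hp : (δ, Λ) ∈ D) (v : Fin N → ℂ) :
    HasDerivAt (fun s : ℂ => YInst ħ (δ + s • v) Λ (X (δ + s • v, Λ)))
      (∑ k, v k * (logVUp ħ (X (δ, Λ)) (δ k) - logVDown ħ (X (δ, Λ)) (δ k))) 0 := by
  have hδ := h.mem_strip _ hp
  have hΛ := h.pos _ hp
  have hL := (h.solution _ hp).integrable_log hN hħ hδ hΛ (h.contracting _ hp)
  obtain ⟨m, hm0, hm⟩ := exists_gap hδ
  obtain ⟨C, η, hη, hC⟩ := h.exists_variation hN hħ hp
  set L : ℝ → ℂ := fun μ => Complex.log (1 + X (δ, Λ) μ) with hLdef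
  have hval : ∑ k, v k * (logVUp ħ (X (δ, Λ)) (δ k) - logVDown ħ (X (δ, Λ)) (δ k)) =
      -(1 / (2 * Real.pi * I)) * -∫ μ, logThetaDeriv ħ δ v μ * L μ := by
    rw [neg_mul_neg]
    simp only [logThetaDeriv, Finset.sum_mul]
    rw [integral_finsetSum, Finset.mul_sum]
    · exact Finset.sum_congr rfl fun k _ => logVUp_sub_logVDown hm0 hm hL k (v k)
    · intro k _
      simp only [add_mul]
      exact (integrable_div_sub_mul hm0 hm hL k (v k)).1.add
        (integrable_div_sub_mul hm0 hm hL k (v k)).2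
  simp only [YInst_eq]
  rw [hval]
  refine HasDerivAt.const_mul _ ?_
  set K := ∑ k, 3 / m * ‖v k‖ with hK
  set K' := ∑ k, 2 * (‖v k‖ / m) ^ 2 with hK'
  refine hasDerivAt_of_norm_sub_le_sq (C := C * K ^ 2 + K' * ∫ μ, ‖L μ‖) ?_
  have hpath : Tendsto (fun s : ℂ => (δ + s • v, Λ)) (𝓝 0) (𝓝 (δ, Λ)) := by
    have : ContinuousAt (fun s : ℂ => (δ + s • v, Λ)) 0 := by fun_prop
    simpa [ContinuousAt] using this
  have hsmall : ∀ᶠ s : ℂ in 𝓝 0, ∀ k, ‖s * v k‖ ≤ m / 2 := by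
    refine eventually_all.2 fun k => Tendsto.eventually_le_const (u := m / 2) (v := 0)
      (by linarith) ?_
    have : ContinuousAt (fun s : ℂ => ‖s * v k‖) 0 := by fun_prop
    simpa [ContinuousAt] using this
  have hsmall' : ∀ᶠ s : ℂ in 𝓝 0, K * ‖s‖ ≤ η := by
    refine Tendsto.eventually_le_const (u := η) (v := 0) hη ?_
    have : ContinuousAt (fun s : ℂ => K * ‖s‖) 0 := by fun_prop
    simpa [ContinuousAt] using this
  filter_upwards [hpath.eventually hC, hsmall, hsmall'] with s hs1 hs2 hs3
  have hb : ∀ μ, ‖logRatio ħ δ (δ + s • v) Λ Λ μ‖ ≤ K * ‖s‖ := fun μ => by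
    refine (norm_logRatio_le hm0 hm (fun k => by simpa using hs2 k) μ).trans (le_of_eq ?_)
    simp only [sub_self, abs_zero, mul_zero, zero_add, Pi.add_apply, Pi.smul_apply, smul_eq_mul,
      add_sub_cancel_left, norm_mul, hK, Finset.sum_mul]
    exact Finset.sum_congr rfl fun k _ => by ring
  have h1 := hs1 _ hs3 hb
  have irL : Integrable fun μ => logRatio ħ δ (δ + s • v) Λ Λ μ * L μ :=
    hL.bdd_mul (continuous_logRatio hm0 hm fun k => by
      simpa using hs2 k).aestronglyMeasurable (Eventually.of_forall hb)
  have ilL := (integrable_logThetaDeriv_mul hm0 hm hL v).const_mul s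
  have h2 : ‖∫ μ, (logRatio ħ δ (δ + s • v) Λ Λ μ * L μ - s * (logThetaDeriv ħ δ v μ * L μ))‖ ≤
      ∫ μ, K' * ‖s‖ ^ 2 * ‖L μ‖ := by
    refine norm_integral_le_of_norm_le (hL.norm.const_mul _) (Eventually.of_forall fun μ => ?_)
    rw [← mul_assoc, ← sub_mul, norm_mul]
    exact mul_le_mul_of_nonneg_right (norm_logRatio_sub_le hm0 hm v hs2 μ) (norm_nonneg _)
  rw [integral_sub irL ilL, integral_const_mul, integral_const_mul] at h2
  rw [sub_zero, zero_smul, add_zero, smul_eq_mul, mul_neg, sub_neg_eq_add]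
  calc _ = ‖(instIntegral ħ X (δ + s • v, Λ) - instIntegral ħ X (δ, Λ) +
          ∫ μ, logRatio ħ δ (δ + s • v) Λ Λ μ * L μ) -
        ((∫ μ, logRatio ħ δ (δ + s • v) Λ Λ μ * L μ) -
          s * ∫ μ, logThetaDeriv ħ δ v μ * L μ)‖ := by congr 1; ring
    _ ≤ C * (K * ‖s‖) ^ 2 + K' * ‖s‖ ^ 2 * ∫ μ, ‖L μ‖ := (norm_sub_le _ _).trans (add_le_add h1 h2)
    _ = _ := by ring

/-- Each δ_j occurs in ϖ(δ_k - δ_j) through either index; interchanging the summation indices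
collects the two opposite arguments of `logGamma`. The strip condition gives |Im(δ_k - δ_j)| < ħ,
inside the domain of ϖ. -/
theorem hasDerivAt_YPert (hħ : 0 < ħ) (hδ : δ ∈ strip N ħ) (v : Fin N → ℂ) :
    HasDerivAt (fun s : ℂ => YPert ħ (δ + s • v) Λ)
      (∑ j, v j * (2 * (I * N * δ j / ħ * ((Real.log ħ : ℂ) - (Real.log Λ : ℂ))) -
        ∑ k, logGamma (1 - I * (δ j - δ k) / ħ) + ∑ k, logGamma (1 + I * (δ j - δ k) / ħ))) 0 := by
  have hlin : ∀ j, HasDerivAt (fun s : ℂ => (δ + s • v) j) (v j) 0 := fun j => by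
    have := ((hasDerivAt_id (0 : ℂ)).mul_const (v j)).const_add (δ j)
    simpa using this
  have h1 : HasDerivAt (fun s : ℂ => ∑ j, (δ + s • v) j ^ 2) (∑ j, 2 * δ j * v j) 0 := by
    refine HasDerivAt.fun_sum fun j _ => ?_
    refine ((hlin j).fun_pow 2).congr_deriv ?_
    simp
  have h2 : HasDerivAt (fun s : ℂ => ∑ j, ∑ k, varpi ħ ((δ + s • v) k - (δ + s • v) j))
      (∑ j, ∑ k, logGamma (1 + I * (δ k - δ j) / ħ) * (v k - v j)) 0 := by
    refine HasDerivAt.fun_sum fun j _ => HasDerivAt.fun_sum fun k _ => ?_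
    have him : (δ k - δ j).im < ħ := by
      have a1 := (abs_lt.1 (hδ k)).2
      have a2 := (abs_lt.1 (hδ j)).1
      rw [Complex.sub_im]; linarith
    have hv := hasDerivAt_varpi hħ him
    have hv' : HasDerivAt (varpi ħ) (logGamma (1 + I * (δ k - δ j) / ħ))
        ((δ + (0 : ℂ) • v) k - (δ + (0 : ℂ) • v) j) := by simpa using hv
    exact hv'.comp (0 : ℂ) ((hlin k).sub (hlin j))
  refine ((h1.const_mul _).add h2).congr_deriv ?_
  have e1 : ∑ j, ∑ k, logGamma (1 + I * (δ k - δ j) / ħ) * (v k - v j) =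
      ∑ j, v j * (∑ k, logGamma (1 + I * (δ j - δ k) / ħ)) -
        ∑ j, v j * ∑ k, logGamma (1 - I * (δ j - δ k) / ħ) := by
    have e0 : ∀ j k, logGamma (1 + I * (δ k - δ j) / ħ) * (v k - v j) =
        logGamma (1 + I * (δ k - δ j) / ħ) * v k - logGamma (1 + I * (δ k - δ j) / ħ) * v j :=
      fun j k => mul_sub _ _ _
    simp only [e0, Finset.sum_sub_distrib]
    congr 1
    · rw [Finset.sum_comm]
      exact Finset.sum_congr rfl fun j _ => by rw [Finset.mul_sum]; simp only [mul_comm]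
    · refine Finset.sum_congr rfl fun j _ => ?_
      rw [Finset.mul_sum]
      refine Finset.sum_congr rfl fun k _ => ?_
      rw [show 1 + I * (δ k - δ j) / (ħ : ℂ) = 1 - I * (δ j - δ k) / ħ by ring, mul_comm]
  rw [e1, Finset.mul_sum, ← Finset.sum_sub_distrib, ← Finset.sum_add_distrib]
  refine Finset.sum_congr rfl fun j _ => ?_
  ring

theorem two_pi_I_mul_eta (X : (Fin N → ℂ) × ℝ → ℝ → ℂ) (p : (Fin N → ℂ) × ℝ) (j : Fin N) :
    2 * Real.pi * I * eta ħ X p j =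
      logQPlus ħ p.1 p.2 (X p) (p.1 j) - logQMinus ħ p.1 p.2 (X p) (p.1 j) := by
  rw [eta, mul_div_cancel₀]
  simp [Real.pi_ne_zero]

/-- The perturbative part contributes the powers of ħ/Λ and the Gamma factors of log Q⁺ - log Q⁻,
the instanton part contributes the v's, and the factor e^{-Nπλ/ħ} drops out of the difference. -/
theorem IsSolutionFamily.hasDerivAt_YangYang (hN : N ≠ 0) (hħ : 0 < ħ)
    (h : IsSolutionFamily ħ D X) (hp : (δ, Λ) ∈ D) (v : Fin N → ℂ) :
    HasDerivAt (fun s : ℂ => YangYang ħ X (δ + s • v) Λ)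
      (2 * Real.pi * I * ∑ j, eta ħ X (δ, Λ) j * v j) 0 := by
  refine ((hasDerivAt_YPert hħ (h.mem_strip _ hp) v).add
    (h.hasDerivAt_YInst hN hħ hp v)).congr_deriv ?_
  rw [Finset.mul_sum, ← Finset.sum_add_distrib]
  refine Finset.sum_congr rfl fun j _ => ?_
  rw [← mul_assoc (2 * Real.pi * I : ℂ), two_pi_I_mul_eta]
  simp only [logQPlus, logQMinus]
  ring

theorem IsSolutionFamily.hasDerivAt_YangYang_of_line (hN : N ≠ 0) (hħ : 0 < ħ)
    (h : IsSolutionFamily ħ D X) (hp : (δ, Λ) ∈ D) (v : Fin N → ℂ) {f : ℂ → Fin N → ℂ} {s₀ : ℂ}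
    (hf : ∀ s, f s = δ + (s - s₀) • v) :
    HasDerivAt (fun s : ℂ => YangYang ħ X (f s) Λ)
      (2 * Real.pi * I * ∑ j, eta ħ X (δ, Λ) j * v j) s₀ := by
  simp only [hf]
  have := h.hasDerivAt_YangYang hN hħ hp v
  rw [← sub_self s₀] at this
  exact HasDerivAt.comp_sub_const s₀ s₀ this

/-- At fixed δ the function `logRatio` is the constant increment of log Λ^{2N}, so the instanton
integral has derivative -∫ log(1+X). -/
theorem IsSolutionFamily.hasLogDeriv_YangYang (hN : N ≠ 0) (hħ : 0 < ħ)
    (h : IsSolutionFamily ħ D X) (hp : (δ, Λ) ∈ D) :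
    HasLogDeriv N ħ (fun Λ' => YangYang ħ X δ Λ') (1 / 2 * ∑ j, δ j ^ 2 +
      ħ / (2 * Real.pi) * ∫ μ, Complex.log (1 + X (δ, Λ) μ)) Λ := by
  have hδ := h.mem_strip _ hp
  have hΛ : 0 < Λ := h.pos _ hp
  have hL := (h.solution _ hp).integrable_log hN hħ hδ hΛ (h.contracting _ hp)
  obtain ⟨C, η, hη, hC⟩ := h.exists_variation hN hħ hp
  set L : ℝ → ℂ := fun μ => Complex.log (1 + X (δ, Λ) μ) with hLdef
  have hN' : (N : ℝ) ≠ 0 := by exact_mod_cast hN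
  have hNc : (N : ℂ) ≠ 0 := by exact_mod_cast hN
  have hħc : (ħ : ℂ) ≠ 0 := by exact_mod_cast hħ.ne'
  have hπc : (Real.pi : ℂ) ≠ 0 := by exact_mod_cast Real.pi_ne_zero
  set l₀ := Real.log (Λ ^ (2 * N)) with hl₀
  have hl₀' : l₀ = 2 * N * Real.log Λ := by rw [hl₀, Real.log_pow]; push_cast; ring
  have hΛl : Real.exp (l₀ / (2 * N)) = Λ := by
    rw [hl₀', mul_div_cancel_left₀ _ (by positivity), Real.exp_log hΛ]
  have hP : HasDerivAt (fun l : ℝ => YPert ħ δ (Real.exp (l / (2 * N))))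
      (N * (I / ħ) * (0 - ((1 / (2 * N) : ℝ) : ℂ)) * ∑ j, δ j ^ 2) l₀ := by
    have h1 : HasDerivAt (fun l : ℝ => ((l / (2 * N) : ℝ) : ℂ)) ((1 / (2 * N) : ℝ) : ℂ) l₀ :=
      ((hasDerivAt_id l₀).div_const _).ofReal_comp
    have h2 := (((hasDerivAt_const l₀ (Real.log ħ : ℂ)).sub h1).const_mul
      ((N : ℂ) * (I / ħ))).mul_const (∑ j, δ j ^ 2)
    have h3 := h2.add_const (∑ j, ∑ k, varpi ħ (δ k - δ j))
    refine h3.congr_of_eventuallyEq (Eventually.of_forall fun l => ?_)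
    simp only [YPert, Real.log_exp]
    rfl
  have hI : HasDerivAt (fun l : ℝ => instIntegral ħ X (δ, Real.exp (l / (2 * N)))) (-∫ μ, L μ)
      l₀ := by
    refine hasDerivAt_of_norm_sub_le_sq (C := C) ?_
    have hpath : Tendsto (fun l : ℝ => (δ, Real.exp (l / (2 * N)))) (𝓝 l₀) (𝓝 (δ, Λ)) := by
      have : ContinuousAt (fun l : ℝ => (δ, Real.exp (l / (2 * N)))) l₀ := by fun_prop
      simpa [ContinuousAt, hΛl] using this
    have hsmall : ∀ᶠ l : ℝ in 𝓝 l₀, ‖l - l₀‖ ≤ η := by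
      refine Tendsto.eventually_le_const (u := η) (v := 0) hη ?_
      have : ContinuousAt (fun l : ℝ => ‖l - l₀‖) l₀ := by fun_prop
      simpa [ContinuousAt] using this
    filter_upwards [hpath.eventually hC, hsmall] with l hl1 hl2
    have hr : ∀ μ, logRatio ħ δ δ Λ (Real.exp (l / (2 * N))) μ = ((l - l₀ : ℝ) : ℂ) := fun μ => by
      simp only [logRatio, sub_self, zero_div, neg_zero, add_zero, Complex.log_one,
        Finset.sum_const_zero, sub_zero, Real.log_exp, hl₀']
      push_cast
      field_simp
    have h1 := hl1 ‖l - l₀‖ hl2 (fun μ => by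
      rw [hr, Complex.norm_real])
    change ‖instIntegral ħ X (δ, Real.exp (l / (2 * N))) - instIntegral ħ X (δ, Λ) +
      ∫ μ, logRatio ħ δ δ Λ (Real.exp (l / (2 * N))) μ * L μ‖ ≤ _ at h1
    simp_rw [hr] at h1
    rw [integral_const_mul] at h1
    rw [hΛl, smul_neg, sub_neg_eq_add, Complex.real_smul]
    exact h1
  refine ⟨_, (hP.add (hI.const_mul (-(1 / (2 * Real.pi * I))))).congr_of_eventuallyEq
    (Eventually.of_forall fun l => ?_), ?_⟩
  · simp only [YangYang, YInst_eq]
    rfl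
  · push_cast
    field_simp
    rw [show I ^ 2 = -1 from I_sq]
    ring

end Derivatives

/-! ### Contour shifts in a strip -/

/-- Cauchy's theorem on rectangles of growing width. The bound on ‖g‖·|Re z| makes the vertical
sides O(1/n). -/
theorem integral_line_eq {g : ℂ → ℂ} {c d : ℝ} (hcd : c ≤ d)
    (hg : DifferentiableOn ℂ g {z | c ≤ z.im ∧ z.im ≤ d})
    (hc : Integrable fun t : ℝ => g (t + c * I)) (hd : Integrable fun t : ℝ => g (t + d * I))
    {K R₀ : ℝ} (hK : ∀ z : ℂ, c ≤ z.im → z.im ≤ d → R₀ ≤ |z.re| → ‖g z‖ * |z.re| ≤ K) :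
    ∫ t : ℝ, g (t + c * I) = ∫ t : ℝ, g (t + d * I) := by
  have hT : Tendsto (fun n : ℕ => (n : ℝ)) atTop atTop := tendsto_natCast_atTop_atTop
  have hT' : Tendsto (fun n : ℕ => -(n : ℝ)) atTop atBot := tendsto_neg_atTop_atBot.comp hT
  have l1 := intervalIntegral_tendsto_integral hc hT' hT
  have l2 := intervalIntegral_tendsto_integral hd hT' hT
  have hside : ∀ σ : ℝ, |σ| = 1 →
      Tendsto (fun n : ℕ => ∫ y in c..d, g ((σ * n : ℝ) + y * I)) atTop (𝓝 0) := by
    intro σ hσ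
    have h0 : Tendsto (fun n : ℕ => K * (n : ℝ)⁻¹ * |d - c|) atTop (𝓝 0) := by
      simpa using (tendsto_inv_atTop_zero.comp hT).const_mul K |>.mul_const |d - c|
    refine squeeze_zero_norm' ?_ h0
    filter_upwards [hT.eventually_ge_atTop (max R₀ 1)] with n hn
    have hn0 : (0 : ℝ) < n := by linarith [le_max_right R₀ 1]
    refine intervalIntegral.norm_integral_le_of_norm_le_const fun y hy => ?_
    rw [Set.uIoc_of_le hcd] at hy
    have habs : |((((σ * n : ℝ) : ℂ) + y * I)).re| = n := by
      simp [abs_mul, hσ]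
    have := hK ((σ * n : ℝ) + y * I) (by simpa using hy.1.le) (by simpa using hy.2)
      (by rw [habs]; exact (le_max_left _ _).trans hn)
    rw [habs] at this
    rwa [← div_eq_mul_inv, le_div_iff₀ hn0]
  have hrect : ∀ n : ℕ, (∫ x : ℝ in -(n : ℝ)..n, g (x + c * I)) -
      (∫ x : ℝ in -(n : ℝ)..n, g (x + d * I)) + I • (∫ y in c..d, g ((1 * n : ℝ) + y * I)) -
      I • (∫ y in c..d, g (((-1) * n : ℝ) + y * I)) = 0 := by
    intro n
    have := Complex.integral_boundary_rect_eq_zero_of_differentiableOn g (⟨-n, c⟩ : ℂ) ⟨n, d⟩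
      (hg.mono fun z hz => by
        rw [Complex.mem_reProdIm] at hz
        have := hz.2
        rw [Set.uIcc_of_le hcd] at this
        exact this)
    simpa using this
  have hlim := ((l1.sub l2).add ((hside 1 (by simp)).const_smul I)).sub
    ((hside (-1) (by simp)).const_smul I)
  simp only [hrect, smul_zero, add_zero, sub_zero] at hlim
  exact sub_eq_zero.1 (tendsto_nhds_unique hlim tendsto_const_nhds)

/-! ### Cauchy transforms -/

/-- The Cauchy transform `∫ φ(t) / (z - t) dt`. -/
def cauchyT (φ : ℝ → ℂ) (z : ℂ) : ℂ := ∫ t : ℝ, (z - t)⁻¹ * φ t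

theorem abs_im_le_norm_sub_ofReal (z : ℂ) (t : ℝ) : |z.im| ≤ ‖z - t‖ := by
  simpa using Complex.abs_im_le_norm (z - t)

theorem sub_ofReal_ne_zero {z : ℂ} (hz : z.im ≠ 0) (t : ℝ) : z - t ≠ 0 :=
  norm_pos_iff.1 ((abs_pos.2 hz).trans_le (abs_im_le_norm_sub_ofReal z t))

theorem norm_inv_sub_ofReal_le {z : ℂ} (hz : z.im ≠ 0) (t : ℝ) : ‖(z - t)⁻¹‖ ≤ |z.im|⁻¹ := by
  rw [norm_inv]
  exact inv_anti₀ (abs_pos.2 hz) (abs_im_le_norm_sub_ofReal z t)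

theorem continuous_inv_sub_ofReal {z : ℂ} (hz : z.im ≠ 0) :
    Continuous fun t : ℝ => (z - t)⁻¹ :=
  (continuous_const.sub Complex.continuous_ofReal).inv₀ (sub_ofReal_ne_zero hz)

theorem integrable_inv_sub_mul {φ : ℝ → ℂ} (hφ : Integrable φ) {z : ℂ} (hz : z.im ≠ 0) :
    Integrable fun t : ℝ => (z - t)⁻¹ * φ t :=
  hφ.bdd_mul (continuous_inv_sub_ofReal hz).aestronglyMeasurable
    (Eventually.of_forall (norm_inv_sub_ofReal_le hz))

theorem norm_cauchyT_le {φ : ℝ → ℂ} (hφ : Integrable φ) {z : ℂ} (hz : z.im ≠ 0) :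
    ‖cauchyT φ z‖ ≤ |z.im|⁻¹ * ∫ t, ‖φ t‖ := by
  rw [← integral_const_mul]
  refine norm_integral_le_of_norm_le (hφ.norm.const_mul _) (Eventually.of_forall fun t => ?_)
  rw [norm_mul]
  exact mul_le_mul_of_nonneg_right (norm_inv_sub_ofReal_le hz t) (norm_nonneg _)

theorem differentiableAt_cauchyT {φ : ℝ → ℂ} (hφ : Integrable φ) {z : ℂ} (hz : z.im ≠ 0) :
    DifferentiableAt ℂ (cauchyT φ) z := by
  have hz0 : 0 < |z.im| := abs_pos.2 hz
  have him : ∀ w ∈ Metric.ball z (|z.im| / 2), |z.im| / 2 ≤ |w.im| := by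
    intro w hw
    rw [Metric.mem_ball, dist_eq_norm] at hw
    have h1 := (Complex.abs_im_le_norm (w - z)).trans hw.le
    rw [Complex.sub_im] at h1
    have h2 := abs_sub_abs_le_abs_sub z.im w.im
    rw [abs_sub_comm] at h2
    linarith
  have hne : ∀ w ∈ Metric.ball z (|z.im| / 2), w.im ≠ 0 := fun w hw =>
    abs_pos.1 (lt_of_lt_of_le (by positivity) (him w hw))
  refine (hasDerivAt_integral_of_dominated_loc_of_deriv_le (μ := volume)
    (F := fun (w : ℂ) (t : ℝ) => (w - t)⁻¹ * φ t)
    (F' := fun (w : ℂ) (t : ℝ) => -1 / (w - t) ^ 2 * φ t)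
    (bound := fun t => ((|z.im| / 2)⁻¹) ^ 2 * ‖φ t‖)
    (Metric.ball_mem_nhds z (half_pos hz0)) ?_ (integrable_inv_sub_mul hφ hz) ?_ ?_
    (hφ.norm.const_mul _) ?_).2.differentiableAt
  · filter_upwards [Metric.ball_mem_nhds z (half_pos hz0)] with w hw
    exact (integrable_inv_sub_mul hφ (hne w hw)).aestronglyMeasurable
  · refine AEStronglyMeasurable.mul (Continuous.aestronglyMeasurable ?_) hφ.aestronglyMeasurable
    exact continuous_const.div ((continuous_const.sub Complex.continuous_ofReal).pow 2)
      fun t => pow_ne_zero 2 (sub_ofReal_ne_zero hz t)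
  · refine Eventually.of_forall fun t w hw => ?_
    rw [norm_mul]
    refine mul_le_mul_of_nonneg_right ?_ (norm_nonneg _)
    rw [norm_div, norm_neg, norm_one, norm_pow, one_div, ← inv_pow, ← norm_inv]
    refine pow_le_pow_left₀ (norm_nonneg _) ((norm_inv_sub_ofReal_le (hne w hw) t).trans ?_) 2
    exact inv_anti₀ (by positivity) (him w hw)
  · refine Eventually.of_forall fun t w hw => ?_
    have h1 : HasDerivAt (fun w : ℂ => w - t) 1 w := (hasDerivAt_id w).sub_const _
    exact (h1.fun_inv (sub_ofReal_ne_zero (hne w hw) t)).mul_const _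

/-! ### Some rational integrals -/

theorem integrable_inv_sub_mul_inv_sub {q₁ q₂ : ℂ} (h₁ : q₁.im ≠ 0) (h₂ : q₂.im ≠ 0) :
    Integrable fun t : ℝ => (t - q₁)⁻¹ - (t - q₂)⁻¹ := by
  have key : ∀ q : ℂ, q.im ≠ 0 → ∃ C > 0, ∀ t : ℝ, ‖((t : ℂ) - q)⁻¹‖ ^ 2 ≤ C * (1 + t ^ 2)⁻¹ := by
    intro q hq
    obtain ⟨C, hC0, hC⟩ := exists_sq_le_norm_sub_sq (abs_pos.2 hq) q
    refine ⟨C, hC0, fun t => ?_⟩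
    have hn : |q.im| ≤ ‖(t : ℂ) - q‖ := by
      rw [norm_sub_rev]; exact abs_im_le_norm_sub_ofReal q t
    have h := hC t (t - q) (by simp) hn
    rw [Complex.ofReal_re] at h
    have hpos : 0 < ‖(t : ℂ) - q‖ := (abs_pos.2 hq).trans_le hn
    rw [norm_inv, inv_pow, ← div_eq_mul_inv, inv_le_comm₀ (by positivity) (by positivity),
      inv_div, div_le_iff₀ hC0]
    linarith
  have hne : ∀ q : ℂ, q.im ≠ 0 → ∀ t : ℝ, (t : ℂ) - q ≠ 0 := fun q hq t => by
    rw [← neg_sub]; exact neg_ne_zero.2 (sub_ofReal_ne_zero hq t)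
  obtain ⟨C₁, hC₁, hb₁⟩ := key q₁ h₁
  obtain ⟨C₂, hC₂, hb₂⟩ := key q₂ h₂
  refine (integrable_inv_one_add_sq.const_mul (‖q₁ - q₂‖ * (C₁ + C₂))).mono' ?_
    (Eventually.of_forall fun t => ?_)
  · refine Continuous.aestronglyMeasurable (Continuous.sub ?_ ?_)
    · exact (Complex.continuous_ofReal.sub continuous_const).inv₀ (hne q₁ h₁)
    · exact (Complex.continuous_ofReal.sub continuous_const).inv₀ (hne q₂ h₂)
  · have e : ((t : ℂ) - q₁)⁻¹ - (t - q₂)⁻¹ = (q₁ - q₂) * ((t - q₁)⁻¹ * (t - q₂)⁻¹) := by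
      have := hne q₁ h₁ t
      have := hne q₂ h₂ t
      field_simp
      ring
    rw [e, norm_mul, norm_mul, mul_assoc]
    refine mul_le_mul_of_nonneg_left ?_ (norm_nonneg _)
    have a1 := hb₁ t
    have a2 := hb₂ t
    rw [add_mul]
    nlinarith [sq_nonneg (‖((t : ℂ) - q₁)⁻¹‖ - ‖((t : ℂ) - q₂)⁻¹‖),
      sq_nonneg (‖((t : ℂ) - q₁)⁻¹‖), sq_nonneg (‖((t : ℂ) - q₂)⁻¹‖)]

/-- The integrand is 2πi times a translated Poisson kernel. -/
theorem integral_inv_sub_sub_conj {q : ℂ} (hq : 0 < q.im) :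
    ∫ t : ℝ, (((t : ℂ) - q)⁻¹ - (t - (starRingEnd ℂ) q)⁻¹) = 2 * Real.pi * I := by
  have e : ∀ t : ℝ, ((t : ℂ) - q)⁻¹ - (t - (starRingEnd ℂ) q)⁻¹ =
      2 * Real.pi * I * (poissonKer q.im (t - q.re) : ℂ) := by
    intro t
    have h1 : (t : ℂ) - q ≠ 0 := by
      rw [← neg_sub]; exact neg_ne_zero.2 (sub_ofReal_ne_zero hq.ne' t)
    have h2 : (t : ℂ) - (starRingEnd ℂ) q ≠ 0 := by
      rw [← neg_sub]; exact neg_ne_zero.2 (sub_ofReal_ne_zero (by simpa using hq.ne') t)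
    have h3 : ((t : ℂ) - q) * (t - (starRingEnd ℂ) q) = (((t - q.re) ^ 2 + q.im ^ 2 : ℝ) : ℂ) := by
      apply Complex.ext
      · simp only [Complex.mul_re, Complex.sub_re, Complex.sub_im, Complex.ofReal_re,
          Complex.ofReal_im, Complex.conj_re, Complex.conj_im]
        ring
      · simp only [Complex.mul_im, Complex.sub_re, Complex.sub_im, Complex.ofReal_re,
          Complex.ofReal_im, Complex.conj_re, Complex.conj_im]
        ring
    have h4 : q - (starRingEnd ℂ) q = 2 * q.im * I := by
      apply Complex.ext
      · simp
      · simp; ring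
    rw [inv_sub_inv h1 h2, h3, sub_sub_sub_cancel_left, h4, poissonKer]
    have h5 : (((t - q.re) ^ 2 + q.im ^ 2 : ℝ) : ℂ) ≠ 0 := by rw [← h3]; exact mul_ne_zero h1 h2
    have h6 : (Real.pi : ℂ) ≠ 0 := by exact_mod_cast Real.pi_ne_zero
    push_cast at h5 ⊢
    field_simp
  simp_rw [e]
  rw [integral_const_mul, integral_complex_ofReal, integral_sub_right_eq_self (poissonKer q.im),
    integral_poissonKer hq]
  simp

/-- Both poles lie on the same side, so (t-q₁)/(t-q₂) avoids the negative axis. Its principal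
logarithm is a primitive that vanishes at both ends. -/
theorem integral_inv_sub_sub_of_im_neg {q₁ q₂ : ℂ} (h₁ : q₁.im < 0) (h₂ : q₂.im < 0) :
    ∫ t : ℝ, (((t : ℂ) - q₁)⁻¹ - (t - q₂)⁻¹) = 0 := by
  have hne : ∀ q : ℂ, q.im < 0 → ∀ t : ℝ, (t : ℂ) - q ≠ 0 := fun q hq t => by
    rw [← neg_sub]; exact neg_ne_zero.2 (sub_ofReal_ne_zero hq.ne t)
  have hslit : ∀ t : ℝ, ((t : ℂ) - q₁) / (t - q₂) ∈ slitPlane := by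
    intro t
    by_contra h
    rw [Complex.mem_slitPlane_iff, not_or, not_lt, not_not] at h
    obtain ⟨hr, hi⟩ := h
    set r := ((t : ℂ) - q₁) / (t - q₂) with hrdef
    have e : (t : ℂ) - q₁ = r * (t - q₂) := by rw [hrdef, div_mul_cancel₀ _ (hne q₂ h₂ t)]
    have := congrArg Complex.im e
    rw [Complex.mul_im, hi] at this
    simp at this
    nlinarith
  have hder : ∀ t : ℝ, HasDerivAt (fun t : ℝ => Complex.log (((t : ℂ) - q₁) / (t - q₂)))
      (((t : ℂ) - q₁)⁻¹ - (t - q₂)⁻¹) t := by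
    intro t
    have d1 : HasDerivAt (fun t : ℝ => (t : ℂ) - q₁) 1 t :=
      Complex.ofRealCLM.hasDerivAt.sub_const _
    have d2 : HasDerivAt (fun t : ℝ => (t : ℂ) - q₂) 1 t :=
      Complex.ofRealCLM.hasDerivAt.sub_const _
    refine ((d1.fun_div d2 (hne q₂ h₂ t)).clog_real (hslit t)).congr_deriv ?_
    have := hne q₁ h₁ t
    have := hne q₂ h₂ t
    field_simp
  have hlim : ∀ l : Filter ℝ, Tendsto (fun t : ℝ => ‖(t : ℂ) - q₂‖) l atTop →
      Tendsto (fun t : ℝ => Complex.log (((t : ℂ) - q₁) / (t - q₂))) l (𝓝 0) := by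
    intro l hl
    have h0 : Tendsto (fun t : ℝ => (q₂ - q₁) * ((t : ℂ) - q₂)⁻¹) l (𝓝 0) := by
      have : Tendsto (fun t : ℝ => ((t : ℂ) - q₂)⁻¹) l (𝓝 0) :=
        tendsto_zero_iff_norm_tendsto_zero.2 (by
          simp only [norm_inv]
          exact tendsto_inv_atTop_zero.comp hl)
      simpa using this.const_mul (q₂ - q₁)
    have h1 : Tendsto (fun t : ℝ => ((t : ℂ) - q₁) / (t - q₂)) l (𝓝 1) := by
      have := h0.const_add 1
      rw [add_zero] at this
      refine this.congr fun t => ?_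
      have := hne q₂ h₂ t
      field_simp
      ring
    have h2 := (continuousAt_clog (x := 1) (by simp)).tendsto.comp h1
    rwa [Complex.log_one] at h2
  have hnorm : ∀ t : ℝ, |t| - ‖q₂‖ ≤ ‖(t : ℂ) - q₂‖ := fun t => by
    have := norm_sub_norm_le (t : ℂ) q₂
    simpa using this
  have := integral_of_hasDerivAt_of_tendsto hder
    (integrable_inv_sub_mul_inv_sub h₁.ne h₂.ne) (m := 0) (n := 0)
    (hlim _ (tendsto_atTop_mono hnorm (tendsto_atTop_add_const_right _ _ tendsto_abs_atBot_atTop)))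
    (hlim _ (tendsto_atTop_mono hnorm (tendsto_atTop_add_const_right _ _ tendsto_abs_atTop_atTop)))
  rw [this, sub_zero]

/-! ### Additive decomposition of an analytic function in a strip -/

section Strip

variable {f : ℂ → ℂ} {ε C e : ℝ}

theorem continuous_line (hf : DifferentiableOn ℂ f {z | |z.im| < ε}) {y : ℝ} (hy : |y| < ε) :
    Continuous fun t : ℝ => f (t + y * I) :=
  hf.continuousOn.comp_continuous (by fun_prop) fun t => by simpa using hy

theorem integrable_line (hf : DifferentiableOn ℂ f {z | |z.im| < ε})
    (hC : ∀ z : ℂ, |z.im| < ε → ‖f z‖ ≤ C * (1 + z.re ^ 2)⁻¹) {y : ℝ} (hy : |y| < ε) :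
    Integrable fun t : ℝ => f (t + y * I) :=
  (integrable_inv_one_add_sq.const_mul C).mono' (continuous_line hf hy).aestronglyMeasurable
    (Eventually.of_forall fun t => by simpa using hC (t + y * I) (by simpa using hy))

/-- The contour moves from Im = c to Im = d without meeting the pole at z. -/
theorem cauchyT_shift_eq (hC0 : 0 ≤ C) (hf : DifferentiableOn ℂ f {z | |z.im| < ε})
    (hC : ∀ z : ℂ, |z.im| < ε → ‖f z‖ ≤ C * (1 + z.re ^ 2)⁻¹) {c d : ℝ} (hcd : c ≤ d)
    (hc : -ε < c) (hd : d < ε) {z : ℂ} (hz : d < z.im ∨ z.im < c) :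
    cauchyT (fun t => f (t + c * I)) (z - c * I) = cauchyT (fun t => f (t + d * I)) (z - d * I) := by
  have hdist : ∃ r > 0, ∀ w : ℂ, c ≤ w.im → w.im ≤ d → r ≤ ‖z - w‖ := by
    rcases hz with hz | hz
    · refine ⟨z.im - d, by linarith, fun w _ h2 => ?_⟩
      refine le_trans ?_ ((le_abs_self _).trans (Complex.abs_im_le_norm _))
      rw [Complex.sub_im]; linarith
    · refine ⟨c - z.im, by linarith, fun w h1 _ => ?_⟩
      refine le_trans ?_ ((neg_le_abs _).trans (Complex.abs_im_le_norm _))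
      rw [Complex.sub_im]; linarith
  obtain ⟨r, hr, hdist⟩ := hdist
  have hne : ∀ w : ℂ, c ≤ w.im → w.im ≤ d → z - w ≠ 0 := fun w h1 h2 =>
    norm_pos_iff.1 (hr.trans_le (hdist w h1 h2))
  have hstrip : ∀ w : ℂ, c ≤ w.im → w.im ≤ d → |w.im| < ε := fun w h1 h2 =>
    abs_lt.2 ⟨by linarith, by linarith⟩
  have him : ∀ y : ℝ, c ≤ y → y ≤ d → (z - y * I).im ≠ 0 := by
    intro y h1 h2
    simp only [Complex.sub_im, Complex.mul_im, Complex.ofReal_re, Complex.I_im, Complex.ofReal_im,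
      Complex.I_re]
    rcases hz with hz | hz
    · exact ne_of_gt (by linarith)
    · exact ne_of_lt (by linarith)
  have e : ∀ y : ℝ, (fun t : ℝ => (z - y * I - t)⁻¹ * f (t + y * I)) =
      fun t : ℝ => (fun w => (z - w)⁻¹ * f w) (t + y * I) := by
    intro y
    ext t
    simp only
    rw [show z - y * I - t = z - (t + y * I) by ring]
  have hint : ∀ y : ℝ, c ≤ y → y ≤ d →
      Integrable fun t : ℝ => (fun w => (z - w)⁻¹ * f w) (t + y * I) := by
    intro y h1 h2
    rw [← e]
    exact integrable_inv_sub_mul (integrable_line hf hC (abs_lt.2 ⟨by linarith, by linarith⟩))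
      (him y h1 h2)
  have := integral_line_eq (g := fun w => (z - w)⁻¹ * f w) hcd ?_ (hint c le_rfl hcd)
    (hint d hcd le_rfl) (K := r⁻¹ * C) (R₀ := 0) ?_
  · simp only [cauchyT]
    rw [e, e]
    exact this
  · intro w hw
    refine DifferentiableWithinAt.mul ?_ ?_
    · exact ((differentiableAt_const z).sub differentiableAt_id).inv
        (hne w hw.1 hw.2) |>.differentiableWithinAt
    · exact (hf w (hstrip w hw.1 hw.2)).mono fun u hu => hstrip u hu.1 hu.2
  · intro w h1 h2 _
    rw [norm_mul, norm_inv, mul_assoc]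
    refine mul_le_mul (inv_anti₀ hr (hdist w h1 h2)) ?_ (by positivity) (by positivity)
    calc _ ≤ C * (1 + w.re ^ 2)⁻¹ * |w.re| :=
          mul_le_mul_of_nonneg_right (hC w (hstrip w h1 h2)) (abs_nonneg _)
      _ = C * (|w.re| / (1 + w.re ^ 2)) := by ring
      _ ≤ C * 1 := by
          refine mul_le_mul_of_nonneg_left ?_ hC0
          rw [div_le_one (by positivity), ← sq_abs]
          nlinarith [sq_nonneg (|w.re| - 1), abs_nonneg w.re]
      _ = C := mul_one C

/-- Cauchy's integral formula for a strip. The pole at z is removed by subtracting a rational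
function with the same value at z; the difference quotient is holomorphic, its integrals over the
two lines agree, and only explicit rational integrals remain. -/
theorem cauchyT_sub_cauchyT_eq (hC0 : 0 ≤ C) (hf : DifferentiableOn ℂ f {z | |z.im| < ε})
    (hC : ∀ z : ℂ, |z.im| < ε → ‖f z‖ ≤ C * (1 + z.re ^ 2)⁻¹) (heε : e < ε)
    {z : ℂ} (hz : |z.im| < e) :
    cauchyT (fun t => f (t + e * I)) (z - e * I) - cauchyT (fun t => f (t + (-e : ℝ) * I))
      (z - (-e : ℝ) * I) = 2 * Real.pi * I * f z := by
  have he : 0 < e := (abs_nonneg _).trans_lt hz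
  obtain ⟨hz1, hz2⟩ := abs_lt.1 hz
  set q : ℂ := z + e * I with hq
  have hqim : q.im = z.im + e := by simp [hq]
  -- The auxiliary pole lies below the strip and mirrors z across the lower line. There the rational
  -- integral is the conjugate-pair one; on the upper line both poles lie below and it vanishes.
  set p : ℂ := (starRingEnd ℂ) q - e * I with hp
  have hpim : p.im = -z.im - 2 * e := by simp [hp, hqim]; ring
  set S : Set ℂ := {w | max p.im (-ε) < w.im ∧ w.im < ε} with hS
  have hSo : IsOpen S := (isOpen_lt continuous_const Complex.continuous_im).inter
    (isOpen_lt Complex.continuous_im continuous_const)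
  have hSsub : ∀ w : ℂ, -e ≤ w.im → w.im ≤ e → w ∈ S := fun w h1 h2 =>
    ⟨max_lt (by rw [hpim]; linarith) (by linarith), by linarith⟩
  have hzS : z ∈ S := hSsub z hz1.le hz2.le
  have hpS : ∀ w ∈ S, w - p ≠ 0 := by
    intro w hw h0
    have := (le_max_left p.im (-ε)).trans_lt hw.1
    rw [sub_eq_zero.1 h0] at this
    exact lt_irrefl _ this
  set n : ℂ → ℂ := fun w => f w - f z * ((z - p) / (w - p)) with hn
  have hzp : z - p ≠ 0 := hpS z hzS
  have hnz : n z = 0 := by simp [hn, div_self hzp]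
  have hnd : DifferentiableOn ℂ n S := by
    intro w hw
    refine DifferentiableWithinAt.sub ((hf w (abs_lt.2
      ⟨(le_max_right _ _).trans_lt hw.1, hw.2⟩)).mono fun u hu => abs_lt.2
        ⟨(le_max_right _ _).trans_lt hu.1, hu.2⟩) ?_
    have hwp : DifferentiableAt ℂ (fun w : ℂ => w - p) w := differentiableAt_id.sub_const p
    exact (((differentiableAt_const _).div hwp (hpS w hw)).const_mul
      (f z)).differentiableWithinAt
  have hgd : DifferentiableOn ℂ (dslope n z) S :=
    (Complex.differentiableOn_dslope (hSo.mem_nhds hzS)).2 hnd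
  have hgval : ∀ w : ℂ, w ≠ z → w - p ≠ 0 → dslope n z w =
      (w - z)⁻¹ * f w - f z * ((w - z)⁻¹ - (w - p)⁻¹) := by
    intro w hw hwp
    have hwz : w - z ≠ 0 := sub_ne_zero.2 hw
    rw [dslope_of_ne _ hw, slope_def_field, hnz, sub_zero, hn]
    field_simp
    ring
  have hline : ∀ y : ℝ, |y| = e → ∀ t : ℝ, dslope n z (t + y * I) =
      -((z - y * I - t)⁻¹ * f (t + y * I)) -
        f z * ((t - (z - y * I))⁻¹ - (t - (p - y * I))⁻¹) := by
    intro y hy t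
    have hyim : ((t : ℂ) + y * I).im = y := by simp
    rw [hgval]
    · rw [show z - y * I - t = -(t + y * I - z) by ring, inv_neg,
        show (t : ℂ) - (z - y * I) = t + y * I - z by ring,
        show (t : ℂ) - (p - y * I) = t + y * I - p by ring]
      ring
    · intro h0
      rw [← h0, hyim, hy] at hz
      exact lt_irrefl _ hz
    · have h1 := abs_le.1 hy.le
      exact hpS _ (hSsub _ (by rw [hyim]; exact h1.1) (by rw [hyim]; exact h1.2))
  have him : ∀ y : ℝ, |y| = e → (z - y * I).im ≠ 0 ∧ (p - y * I).im ≠ 0 := by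
    intro y hy
    have h1 := abs_le.1 hy.le
    have e1 : (z - y * I).im = z.im - y := by simp
    have e2 : (p - y * I).im = p.im - y := by simp
    rw [e1, e2, hpim]
    refine ⟨fun h0 => ?_, ne_of_lt (by linarith)⟩
    rw [sub_eq_zero.1 h0, hy] at hz
    exact lt_irrefl _ hz
  have hintf : ∀ y : ℝ, |y| = e → Integrable fun t : ℝ => (z - y * I - t)⁻¹ * f (t + y * I) :=
    fun y hy => integrable_inv_sub_mul (integrable_line hf hC (by rw [hy]; exact heε)) (him y hy).1
  have hintr : ∀ y : ℝ, |y| = e → Integrable fun t : ℝ =>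
      f z * (((t : ℂ) - (z - y * I))⁻¹ - (t - (p - y * I))⁻¹) :=
    fun y hy => (integrable_inv_sub_mul_inv_sub (him y hy).1 (him y hy).2).const_mul _
  have hintd : ∀ y : ℝ, |y| = e → Integrable fun t : ℝ => dslope n z (t + y * I) := by
    intro y hy
    simp_rw [hline y hy]
    exact (hintf y hy).neg.sub (hintr y hy)
  have hval : ∀ y : ℝ, |y| = e → ∫ t : ℝ, dslope n z (t + y * I) =
      -cauchyT (fun t => f (t + y * I)) (z - y * I) -
        f z * ∫ t : ℝ, (((t : ℂ) - (z - y * I))⁻¹ - (t - (p - y * I))⁻¹) := by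
    intro y hy
    simp_rw [hline y hy]
    have i1 : Integrable fun t : ℝ => -((z - y * I - t)⁻¹ * f (t + y * I)) := (hintf y hy).neg
    rw [integral_sub i1 (hintr y hy), integral_neg, integral_const_mul, cauchyT]
  have hshift := integral_line_eq (g := dslope n z) (c := -e) (d := e) (by linarith)
    (hgd.mono fun w hw => hSsub w hw.1 hw.2) (hintd (-e) (by rw [abs_neg, abs_of_pos he]))
    (hintd e (abs_of_pos he)) (K := 2 * (C + ‖f z‖ * (‖z - p‖ / (-e - p.im))))
    (R₀ := 2 * |z.re| + 1) ?_
  · rw [hval (-e) (by rw [abs_neg, abs_of_pos he]), hval e (abs_of_pos he)] at hshift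
    have e1 : z - (-e : ℝ) * I = q := by rw [hq]; push_cast; ring
    have e2 : p - (-e : ℝ) * I = (starRingEnd ℂ) q := by rw [hp]; push_cast; ring
    have e3 : ∫ t : ℝ, (((t : ℂ) - (z - (-e : ℝ) * I))⁻¹ - (t - (p - (-e : ℝ) * I))⁻¹) =
        2 * Real.pi * I := by
      rw [e1, e2]
      exact integral_inv_sub_sub_conj (by rw [hqim]; linarith)
    have e4 : ∫ t : ℝ, (((t : ℂ) - (z - e * I))⁻¹ - (t - (p - e * I))⁻¹) = 0 := by
      refine integral_inv_sub_sub_of_im_neg ?_ ?_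
      · simp; linarith
      · simp only [Complex.sub_im, hpim]; simp; linarith
    rw [e3, e4] at hshift
    linear_combination hshift
  · intro w h1 h2 h3
    have hwre : |w.re| ≤ 2 * |w.re - z.re| := by
      have := abs_sub_abs_le_abs_sub w.re z.re
      linarith
    have hwz : |w.re - z.re| ≤ ‖w - z‖ := by simpa using Complex.abs_re_le_norm (w - z)
    have hw0 : 0 < |w.re| := by linarith [abs_nonneg z.re]
    have hwz0 : 0 < ‖w - z‖ := by linarith
    have hne : w ≠ z := sub_ne_zero.1 (norm_pos_iff.1 hwz0)
    have hpos : 0 < -e - p.im := by rw [hpim]; linarith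
    have hnorm : ‖n w‖ ≤ C + ‖f z‖ * (‖z - p‖ / (-e - p.im)) := by
      refine (norm_sub_le _ _).trans (add_le_add ?_ ?_)
      · refine (hC w (abs_lt.2 ⟨by linarith, by linarith⟩)).trans ?_
        refine mul_le_of_le_one_right hC0 (inv_le_one_of_one_le₀ ?_)
        nlinarith [sq_nonneg w.re]
      · rw [norm_mul, norm_div]
        refine mul_le_mul_of_nonneg_left (div_le_div_of_nonneg_left (norm_nonneg _) hpos ?_)
          (norm_nonneg _)
        refine le_trans ?_ ((le_abs_self _).trans (Complex.abs_im_le_norm _))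
        have : (w - p).im = w.im - p.im := Complex.sub_im w p
        linarith
    rw [dslope_of_ne _ hne, slope_def_field, hnz, sub_zero, norm_div, div_mul_eq_mul_div,
      div_le_iff₀ hwz0]
    calc ‖n w‖ * |w.re| ≤ (C + ‖f z‖ * (‖z - p‖ / (-e - p.im))) * (2 * ‖w - z‖) :=
          mul_le_mul hnorm (by linarith) hw0.le ((norm_nonneg _).trans hnorm)
      _ = _ := by ring

end Strip

/-! ### Analytic continuation of `v_↑` and `v_↓` across the real line -/

theorem logVUp_eq (ħ : ℝ) (Y : ℝ → ℂ) (x : ℂ) : logVUp ħ Y x =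
    -(1 / (2 * Real.pi * I)) * cauchyT (fun μ => Complex.log (1 + Y μ)) (x + I * ħ / 2) := by
  rw [logVUp, cauchyT, neg_mul, ← integral_const_mul]
  congr 1
  refine integral_congr_ae (Eventually.of_forall fun μ => ?_)
  simp only
  rw [show x - μ + I * ħ / 2 = x + I * ħ / 2 - μ by ring]
  ring

theorem logVDown_eq (ħ : ℝ) (Y : ℝ → ℂ) (x : ℂ) : logVDown ħ Y x =
    1 / (2 * Real.pi * I) * cauchyT (fun μ => Complex.log (1 + Y μ)) (x - I * ħ / 2) := by
  rw [logVDown, cauchyT, ← integral_const_mul]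
  refine integral_congr_ae (Eventually.of_forall fun μ => ?_)
  simp only
  rw [show x - μ - I * ħ / 2 = x - I * ħ / 2 - μ by ring]
  ring

/-- `A` and `B` continue `z ↦ log v_↑(z - iħ/2)` and `z ↦ log v_↓(z - iħ/2)` to half planes that
overlap in the strip `|Im z| < ε`, where `e^A e^B = 1 + X`. -/
structure IsFactorization {N : ℕ} (ħ : ℝ) (δ : Fin N → ℂ) (Λ : ℝ) (X : ℝ → ℂ) (ε : ℝ)
    (A B : ℂ → ℂ) : Prop where
  pos : 0 < ε
  gap : ∀ k, |(δ k).im| + ε ≤ ħ / 2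
  diff_up : DifferentiableOn ℂ A {z | -ε < z.im}
  diff_down : DifferentiableOn ℂ B {z | z.im < ε}
  bound : ∃ M, (∀ z : ℂ, -ε < z.im → ‖A z‖ ≤ M) ∧ ∀ z : ℂ, z.im < ε → ‖B z‖ ≤ M
  eq_up : ∀ z : ℂ, 0 < z.im → A z = logVUp ħ X (z - I * ħ / 2)
  eq_down : ∀ z : ℂ, z.im < 0 → B z = logVDown ħ X (z + I * ħ / 2)
  jump : ∀ z : ℂ, |z.im| < ε →
    exp (A z) * exp (B z) = 1 + exp (A (z + I * ħ)) * exp (B (z - I * ħ)) / Theta ħ δ Λ z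

/-- A is a Cauchy integral over the line Im = -ε/2 and B over Im = ε/2; Cauchy's formula gives A + B
= f between them. Contour shifts identify them with Cauchy integrals over ℝ, and restricting to ε/4
keeps the distance to the contours bounded below. -/
theorem exists_additive_decomposition {f : ℂ → ℂ} {ε C : ℝ} (hε : 0 < ε) (hC0 : 0 ≤ C)
    (hf : DifferentiableOn ℂ f {z | |z.im| < ε})
    (hC : ∀ z : ℂ, |z.im| < ε → ‖f z‖ ≤ C * (1 + z.re ^ 2)⁻¹) :
    ∃ A B : ℂ → ℂ, DifferentiableOn ℂ A {z | -(ε / 4) < z.im} ∧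
      DifferentiableOn ℂ B {z | z.im < ε / 4} ∧
      (∃ M, (∀ z : ℂ, -(ε / 4) < z.im → ‖A z‖ ≤ M) ∧ ∀ z : ℂ, z.im < ε / 4 → ‖B z‖ ≤ M) ∧
      (∀ z : ℂ, 0 < z.im → A z = -(1 / (2 * Real.pi * I)) * cauchyT (fun t => f t) z) ∧
      (∀ z : ℂ, z.im < 0 → B z = 1 / (2 * Real.pi * I) * cauchyT (fun t => f t) z) ∧
      ∀ z : ℂ, |z.im| < ε / 4 → A z + B z = f z := by
  set e := ε / 2 with he
  have he0 : 0 < e := by positivity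
  have heε : e < ε := by linarith
  set c : ℂ := 1 / (2 * Real.pi * I) with hc
  have hup := integrable_line hf hC (y := e) (by rwa [abs_of_pos he0])
  have hdn := integrable_line hf hC (y := -e) (by rwa [abs_neg, abs_of_pos he0])
  have imUp : ∀ z : ℂ, -(ε / 4) < z.im → ε / 4 ≤ (z - (-e : ℝ) * I).im := by
    intro z hz
    have : (z - (-e : ℝ) * I).im = z.im + e := by simp
    rw [this]; linarith
  have imDn : ∀ z : ℂ, z.im < ε / 4 → (z - e * I).im ≤ -(ε / 4) := by
    intro z hz
    have : (z - e * I).im = z.im - e := by simp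
    rw [this]; linarith
  refine ⟨fun z => -c * cauchyT (fun t => f (t + (-e : ℝ) * I)) (z - (-e : ℝ) * I),
    fun z => c * cauchyT (fun t => f (t + e * I)) (z - e * I), ?_, ?_,
    ⟨max (‖c‖ * ((ε / 4)⁻¹ * ∫ t : ℝ, ‖f (t + (-e : ℝ) * I)‖))
      (‖c‖ * ((ε / 4)⁻¹ * ∫ t : ℝ, ‖f (t + e * I)‖)), fun z hz => ?_, fun z hz => ?_⟩, ?_, ?_, ?_⟩
  · intro z hz
    have h1 := imUp z hz
    have h2 : DifferentiableAt ℂ (fun z : ℂ => z - (-e : ℝ) * I) z := by fun_prop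
    exact ((DifferentiableAt.comp z (differentiableAt_cauchyT hdn (ne_of_gt (by linarith)))
      h2).const_mul _).differentiableWithinAt
  · intro z hz
    have h1 := imDn z hz
    have h2 : DifferentiableAt ℂ (fun z : ℂ => z - e * I) z := by fun_prop
    exact ((DifferentiableAt.comp z (differentiableAt_cauchyT hup (ne_of_lt (by linarith)))
      h2).const_mul _).differentiableWithinAt
  · have h1 := imUp z hz
    refine le_trans ?_ (le_max_left _ _)
    rw [norm_mul, norm_neg]
    refine mul_le_mul_of_nonneg_left ((norm_cauchyT_le hdn (ne_of_gt (by linarith))).trans ?_)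
      (norm_nonneg _)
    refine mul_le_mul_of_nonneg_right (inv_anti₀ (by positivity) ?_)
      (integral_nonneg fun _ => norm_nonneg _)
    exact h1.trans (le_abs_self _)
  · have h1 := imDn z hz
    refine le_trans ?_ (le_max_right _ _)
    rw [norm_mul]
    refine mul_le_mul_of_nonneg_left ((norm_cauchyT_le hup (ne_of_lt (by linarith))).trans ?_)
      (norm_nonneg _)
    refine mul_le_mul_of_nonneg_right (inv_anti₀ (by positivity) ?_)
      (integral_nonneg fun _ => norm_nonneg _)
    exact le_trans (by linarith) (neg_le_abs _)
  · intro z hz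
    have := cauchyT_shift_eq hC0 hf hC (c := -e) (d := 0) (by linarith) (by linarith) hε
      (z := z) (Or.inl hz)
    simp only [this]
    simp
  · intro z hz
    have := cauchyT_shift_eq hC0 hf hC (c := 0) (d := e) he0.le (by linarith) heε
      (z := z) (Or.inr hz)
    simp only [← this]
    simp
  · intro z hz
    have := cauchyT_sub_cauchyT_eq hC0 hf hC heε (z := z) (by linarith)
    have hπ : (2 * Real.pi * I : ℂ) ≠ 0 := by simp [Real.pi_ne_zero]
    calc _ = c * (cauchyT (fun t => f (t + e * I)) (z - e * I) -
          cauchyT (fun t => f (t + (-e : ℝ) * I)) (z - (-e : ℝ) * I)) := by ring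
      _ = f z := by rw [this, hc]; field_simp

/-- The kernel is the difference of the resolvents at μ ± iħ. This is how the right side of the
integral equation becomes A(μ+iħ) + B(μ-iħ). -/
theorem poisson_eq_cauchyT {ħ : ℝ} (hħ : 0 < ħ) {L : ℝ → ℂ} (hL : Integrable L) (μ : ℝ) :
    -(1 / (2 * Real.pi * I)) * cauchyT L (μ + I * ħ) +
      1 / (2 * Real.pi * I) * cauchyT L (μ - I * ħ) = poisson ħ L μ := by
  have h1 : ((μ : ℂ) + I * ħ).im ≠ 0 := by simpa using hħ.ne'
  have h2 : ((μ : ℂ) - I * ħ).im ≠ 0 := by simpa using hħ.ne'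
  have i1 := integrable_inv_sub_mul hL h1
  have i2 := integrable_inv_sub_mul hL h2
  rw [cauchyT, cauchyT, ← integral_const_mul, ← integral_const_mul,
    ← integral_add (i1.const_mul _) (i2.const_mul _)]
  refine integral_congr_ae (Eventually.of_forall fun t => ?_)
  simp only
  rw [← kernel_eq_poissonKer hħ]
  have n1 := sub_ofReal_ne_zero h1 t
  have n2 := sub_ofReal_ne_zero h2 t
  have e : ((μ : ℂ) - t) ^ 2 + (ħ : ℂ) ^ 2 = (μ + I * ħ - t) * (μ - I * ħ - t) := by
    linear_combination ((ħ : ℂ) ^ 2) * I_sq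
  have hπ : (2 * Real.pi * I : ℂ) ≠ 0 := by simp [Real.pi_ne_zero]
  rw [e]
  have key : -((μ : ℂ) + I * ħ - t)⁻¹ + (μ - I * ħ - t)⁻¹ =
      2 * I * ħ / ((μ + I * ħ - t) * (μ - I * ħ - t)) := by
    field_simp
    ring
  rw [← key]
  ring

/-- The convolution is holomorphic near ℝ, so e^{PL}/Θ continues X to a strip free of zeros of Θ. In
a thinner strip its real part stays above -1/2, the principal log(1+X) is holomorphic with quadratic
decay, and the additive decomposition applies. -/
theorem IsNLIESolution.exists_factorization {N : ℕ} {ħ : ℝ} {δ : Fin N → ℂ} {Λ : ℝ} {X : ℝ → ℂ}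
    (hN : N ≠ 0) (hħ : 0 < ħ) (hδ : δ ∈ strip N ħ) (hΛ : 0 < Λ) (h : IsNLIESolution ħ δ Λ X)
    (hre : ∀ μ, -(1 / 2) < (X μ).re) : ∃ ε A B, IsFactorization ħ δ Λ X ε A B := by
  obtain ⟨m, hm0, hm⟩ := exists_gap hδ
  have hmħ : m ≤ ħ / 2 := by
    have := hm ⟨0, Nat.pos_of_ne_zero hN⟩
    linarith [abs_nonneg (δ ⟨0, Nat.pos_of_ne_zero hN⟩).im]
  obtain ⟨C, hC0, hC⟩ := exists_norm_Theta_inv_le (Λ := Λ) hN hm0 hm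
  set L : ℝ → ℂ := fun μ => Complex.log (1 + X μ) with hL
  have hLi : Integrable L := h.integrable_log hN hħ hδ hΛ hre
  set c : ℂ := 1 / (2 * Real.pi * I) with hc
  set G : ℂ → ℂ := fun z => -c * cauchyT L (z + I * ħ) + c * cauchyT L (z - I * ħ) with hG
  have imp : ∀ z : ℂ, |z.im| < m → ħ / 2 ≤ (z + I * ħ).im ∧ (z - I * ħ).im ≤ -(ħ / 2) := by
    intro z hz
    have := abs_lt.1 hz
    have e1 : (z + I * ħ).im = z.im + ħ := by simp
    have e2 : (z - I * ħ).im = z.im - ħ := by simp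
    rw [e1, e2]
    constructor <;> linarith
  have hGd : ∀ z : ℂ, |z.im| < m → DifferentiableAt ℂ G z := by
    intro z hz
    obtain ⟨h1, h2⟩ := imp z hz
    have d1 : DifferentiableAt ℂ (fun z : ℂ => z + I * ħ) z := by fun_prop
    have d2 : DifferentiableAt ℂ (fun z : ℂ => z - I * ħ) z := by fun_prop
    exact ((DifferentiableAt.comp z (differentiableAt_cauchyT hLi (ne_of_gt (by linarith)))
      d1).const_mul _).add ((DifferentiableAt.comp z (differentiableAt_cauchyT hLi
        (ne_of_lt (by linarith))) d2).const_mul _)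
  set K := 2 * (‖c‖ * ((ħ / 2)⁻¹ * ∫ t, ‖L t‖)) with hK
  have hGb : ∀ z : ℂ, |z.im| < m → ‖G z‖ ≤ K := by
    intro z hz
    obtain ⟨h1, h2⟩ := imp z hz
    have b : ∀ w : ℂ, ħ / 2 ≤ |w.im| → ‖c * cauchyT L w‖ ≤ ‖c‖ * ((ħ / 2)⁻¹ * ∫ t, ‖L t‖) := by
      intro w hw
      have hw0 : w.im ≠ 0 := abs_pos.1 (lt_of_lt_of_le (by positivity) hw)
      rw [norm_mul]
      refine mul_le_mul_of_nonneg_left ((norm_cauchyT_le hLi hw0).trans ?_) (norm_nonneg _)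
      exact mul_le_mul_of_nonneg_right (inv_anti₀ (by positivity) hw)
        (integral_nonneg fun _ => norm_nonneg _)
    refine (norm_add_le _ _).trans ?_
    rw [neg_mul, norm_neg]
    linarith [b _ (h1.trans (le_abs_self _)),
      b (z - I * ħ) (le_trans (by linarith) (neg_le_abs _))]
  set Xt : ℂ → ℂ := fun z => exp (G z) / Theta ħ δ Λ z with hXt
  have hXd : ∀ z : ℂ, |z.im| < m → DifferentiableAt ℂ Xt z := fun z hz =>
    (hGd z hz).cexp.div (differentiable_Theta z) (Theta_ne_zero hm hΛ hz)
  have hXreal : ∀ μ : ℝ, Xt μ = X μ := by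
    intro μ
    have hΘ : Theta ħ δ Λ μ ≠ 0 := Theta_ne_zero hm hΛ (by simpa using hm0)
    simp only [hXt, hG]
    rw [poisson_eq_cauchyT hħ hLi, h.exp_poisson hħ hδ hΛ, mul_div_cancel_right₀ _ hΘ]
  set C' := Real.exp K * C with hC'
  have hC'0 : 0 ≤ C' := by positivity
  have hXb : ∀ z : ℂ, |z.im| < m / 2 → ‖Xt z‖ ≤ C' * (1 + z.re ^ 2)⁻¹ := by
    intro z hz
    simp only [hXt]
    rw [div_eq_mul_inv, norm_mul, hC', mul_assoc]
    exact mul_le_mul ((Complex.norm_exp_le_exp_norm _).trans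
      (Real.exp_le_exp.2 (hGb z (by linarith)))) (hC z hz.le) (norm_nonneg _) (Real.exp_nonneg _)
  -- U is an open neighbourhood of ℝ. Compactness gives a uniform width over [-R, R]; outside, the
  -- decay of the continuation suffices.
  set U : Set ℂ := {z | |z.im| < m / 2} ∩ Xt ⁻¹' {w | -(1 / 2) < w.re} with hU
  have hUo : IsOpen U := by
    refine ContinuousOn.isOpen_inter_preimage (fun z hz => (hXd z ?_).continuousAt.continuousWithinAt)
      (isOpen_lt (by fun_prop) continuous_const)
      (isOpen_lt continuous_const Complex.continuous_re)
    have : |z.im| < m / 2 := hz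
    linarith
  set R := 4 * C' + 1 with hR
  have hKc : IsCompact ((fun t : ℝ => (t : ℂ)) '' Set.Icc (-R) R) :=
    isCompact_Icc.image Complex.continuous_ofReal
  have hKU : (fun t : ℝ => (t : ℂ)) '' Set.Icc (-R) R ⊆ U := by
    rintro _ ⟨t, -, rfl⟩
    refine ⟨by simpa using hm0, ?_⟩
    simp only [Set.mem_preimage, hXreal]
    exact hre t
  obtain ⟨r, hr0, hr⟩ := hKc.exists_thickening_subset_open hUo hKU
  set ε := min r (m / 2) with hε
  have hε0 : 0 < ε := lt_min hr0 (by positivity)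
  have hεm : ε ≤ m / 2 := min_le_right _ _
  have hreX : ∀ z : ℂ, |z.im| < ε → -(1 / 2) < (Xt z).re := by
    intro z hz
    by_cases hzR : |z.re| ≤ R
    · have : z ∈ U := hr (by
        rw [Metric.mem_thickening_iff]
        refine ⟨z.re, ⟨z.re, abs_le.1 hzR, rfl⟩, ?_⟩
        rw [dist_eq_norm]
        have e : z - (z.re : ℂ) = (z.im : ℂ) * I := by
          apply Complex.ext <;> simp
        rw [e, norm_mul, Complex.norm_I, mul_one, Complex.norm_real]
        exact lt_of_lt_of_le hz (min_le_left _ _))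
      exact this.2
    · have h2 : 4 * C' ≤ 1 + z.re ^ 2 := by
        rw [← sq_abs z.re]
        nlinarith
      have h3 : ‖Xt z‖ ≤ 1 / 4 := by
        refine (hXb z (by linarith)).trans ?_
        rw [← div_eq_mul_inv, div_le_iff₀ (by positivity)]
        linarith
      have h4 := abs_le.1 ((Complex.abs_re_le_norm _).trans h3)
      linarith
  set f : ℂ → ℂ := fun z => Complex.log (1 + Xt z) with hf
  have hfd : DifferentiableOn ℂ f {z | |z.im| < ε} := by
    intro z hz
    have hz' : |z.im| < ε := hz
    refine (((hXd z (by linarith)).const_add 1).clog (Or.inl ?_)).differentiableWithinAt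
    have := hreX z hz
    simp only [Complex.add_re, Complex.one_re]; linarith
  have hfb : ∀ z : ℂ, |z.im| < ε → ‖f z‖ ≤ 2 * C' * (1 + z.re ^ 2)⁻¹ := fun z hz =>
    (norm_log_one_add_le (hreX z hz)).trans (by linarith [hXb z (by linarith)])
  obtain ⟨A, B, hA, hB, hM, hA', hB', hAB⟩ :=
    exists_additive_decomposition hε0 (by positivity) hfd hfb
  have hfL : (fun t : ℝ => f t) = L := by
    ext t; simp only [hf, hXreal, hL]
  rw [hfL] at hA' hB'
  refine ⟨ε / 4, A, B, by positivity, fun k => by linarith [hm k], hA, hB, hM, fun z hz => ?_,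
    fun z hz => ?_, fun z hz => ?_⟩
  · rw [hA' z hz, logVUp_eq, sub_add_cancel]
  · rw [hB' z hz, logVDown_eq, add_sub_cancel_right]
  · obtain ⟨h1, h2⟩ := imp z (by linarith)
    rw [← Complex.exp_add, ← Complex.exp_add, hAB z hz, hA' _ (by linarith), hB' _ (by linarith),
      Complex.exp_log]
    intro h0
    have := hreX z (by linarith)
    have h3 := congrArg Complex.re h0
    simp only [Complex.add_re, Complex.one_re, Complex.zero_re] at h3
    linarith

/-! ### Entire functions of polynomial growth -/

/-- The difference quotient at 0 lowers the growth exponent by one; Liouville's theorem is the base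
case. -/
theorem exists_polynomial_of_growth (n : ℕ) : ∀ {T : ℂ → ℂ} {C : ℝ}, Differentiable ℂ T →
    (∀ x, ‖T x‖ ≤ C * (1 + ‖x‖) ^ n) →
    ∃ p : Polynomial ℂ, p.natDegree ≤ n ∧ ∀ x, T x = p.eval x := by
  induction n with
  | zero =>
    intro T C hT hC
    obtain ⟨c, hc⟩ := hT.exists_const_forall_eq_of_bounded
      (isBounded_iff_forall_norm_le.2 ⟨C, by rintro _ ⟨x, rfl⟩; simpa using hC x⟩)
    exact ⟨Polynomial.C c, by simp, fun x => by simp [hc x]⟩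
  | succ n ih =>
    intro T C hT hC
    have hgd : Differentiable ℂ (dslope T 0) := by
      have := (Complex.differentiableOn_dslope (s := Set.univ) (c := 0) (f := T) univ_mem).2
        hT.differentiableOn
      exact differentiableOn_univ.1 this
    have hC0 : 0 ≤ C := by
      have := (norm_nonneg _).trans (hC 0)
      simpa using this
    obtain ⟨K, hK⟩ := (isCompact_closedBall (0 : ℂ) 1).exists_bound_of_continuousOn
      hgd.continuous.continuousOn
    obtain ⟨q, hq, hqe⟩ := ih (C := max K (4 * C)) hgd fun x => by
      by_cases hx : ‖x‖ ≤ 1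
      · refine (hK x (by simpa using hx)).trans ((le_max_left K (4 * C)).trans ?_)
        refine le_mul_of_one_le_right (le_trans (by positivity) (le_max_right K (4 * C))) ?_
        exact one_le_pow₀ (by linarith [norm_nonneg x])
      · rw [not_le] at hx
        have hx0 : x ≠ 0 := norm_pos_iff.1 (by linarith)
        refine le_trans ?_ (mul_le_mul_of_nonneg_right (le_max_right K (4 * C)) (by positivity))
        rw [dslope_of_ne _ hx0, slope_def_field, sub_zero, norm_div, div_le_iff₀ (by linarith)]
        have h1 : (1 : ℝ) ≤ (1 + ‖x‖) ^ (n + 1) := one_le_pow₀ (by linarith)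
        have h2 : ‖T 0‖ ≤ C := by simpa using hC 0
        calc ‖T x - T 0‖ ≤ C * (1 + ‖x‖) ^ (n + 1) + C :=
              (norm_sub_le _ _).trans (add_le_add (hC x) h2)
          _ ≤ 2 * C * (1 + ‖x‖) ^ (n + 1) := by nlinarith
          _ = 2 * C * (1 + ‖x‖) ^ n * (1 + ‖x‖) := by ring
          _ ≤ 2 * C * (1 + ‖x‖) ^ n * (2 * ‖x‖) :=
              mul_le_mul_of_nonneg_left (by linarith) (by positivity)
          _ = _ := by ring
    refine ⟨Polynomial.C (T 0) + Polynomial.X * q, ?_, fun x => ?_⟩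
    · refine (Polynomial.natDegree_add_le _ _).trans (max_le (by simp) ?_)
      refine Polynomial.natDegree_mul_le.trans ?_
      rw [Polynomial.natDegree_X]; omega
    · have := sub_smul_dslope T 0 x
      simp only [sub_zero, smul_eq_mul] at this
      simp [← hqe, this]

/-- Coefficients are peeled off one at a time by dividing by the variable. It is applied to the
reversed polynomial at u = 1/x, where it converts asymptotics at infinity into leading coefficients.
-/
theorem coeff_eq_zero_of_tendsto {S : Polynomial ℂ} {ι : Type*} {l : Filter ι} [l.NeBot]
    {u : ι → ℂ} (hu : Tendsto u l (𝓝 0)) (hu0 : ∀ i, u i ≠ 0) (n : ℕ)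
    (hS : Tendsto (fun i => S.eval (u i) / u i ^ n) l (𝓝 0)) : ∀ k ≤ n, S.coeff k = 0 := by
  induction n generalizing S with
  | zero =>
    intro k hk
    obtain rfl : k = 0 := by omega
    have h1 : Tendsto (fun i => S.eval (u i)) l (𝓝 (S.eval 0)) :=
      (S.continuous.tendsto 0).comp hu
    rw [Polynomial.coeff_zero_eq_eval_zero]
    exact tendsto_nhds_unique h1 (by simpa using hS)
  | succ n ih =>
    have h0 : S.coeff 0 = 0 := by
      have h1 : Tendsto (fun i => S.eval (u i)) l (𝓝 (S.eval 0)) :=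
        (S.continuous.tendsto 0).comp hu
      have h2 : Tendsto (fun i => S.eval (u i)) l (𝓝 0) := by
        have := hS.mul (hu.pow (n + 1))
        rw [zero_mul] at this
        refine this.congr fun i => ?_
        rw [div_mul_cancel₀ _ (pow_ne_zero _ (hu0 i))]
      rw [Polynomial.coeff_zero_eq_eval_zero]
      exact tendsto_nhds_unique h1 h2
    have hX : ∀ x, S.eval x = S.divX.eval x * x := fun x => by
      conv_lhs => rw [← Polynomial.divX_mul_X_add S, h0]
      simp
    have := ih (S := S.divX) (hS.congr fun i => by
      rw [hX, pow_succ, mul_div_mul_right _ _ (hu0 i)])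
    intro k hk
    rcases k with _ | k
    · exact h0
    · rw [← Polynomial.coeff_divX]
      exact this k (by omega)

theorem coeff_prod_one_sub {ι : Type*} (s : Finset ι) (δ : ι → ℂ) :
    (∏ k ∈ s, (1 - Polynomial.C (δ k) * Polynomial.X)).coeff 0 = 1 ∧
    (∏ k ∈ s, (1 - Polynomial.C (δ k) * Polynomial.X)).coeff 1 = -∑ k ∈ s, δ k ∧
    2 * (∏ k ∈ s, (1 - Polynomial.C (δ k) * Polynomial.X)).coeff 2 =
      (∑ k ∈ s, δ k) ^ 2 - ∑ k ∈ s, δ k ^ 2 := by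
  classical
  induction s using Finset.induction_on with
  | empty => simp [Polynomial.coeff_one]
  | insert a s ha ih =>
    obtain ⟨h0, h1, h2⟩ := ih
    rw [Finset.prod_insert ha, Finset.sum_insert ha, Finset.sum_insert ha]
    set R := ∏ k ∈ s, (1 - Polynomial.C (δ k) * Polynomial.X)
    have e : (1 - Polynomial.C (δ a) * Polynomial.X) * R = R - Polynomial.C (δ a) * R * Polynomial.X := by
      ring
    rw [e]
    refine ⟨?_, ?_, ?_⟩
    · simp [h0]
    · rw [Polynomial.coeff_sub, Polynomial.coeff_mul_X, Polynomial.coeff_C_mul, h0, h1]; ring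
    · rw [Polynomial.coeff_sub, Polynomial.coeff_mul_X, Polynomial.coeff_C_mul, h1]
      linear_combination h2

/-- A function given by compatible formulae in two half planes and a strip. -/
theorem exists_glue {f₁ f₂ f₃ : ℂ → ℂ} {a b : ℝ} (ha : 0 ≤ a) (hab : a < b)
    (h₁₂ : ∀ x : ℂ, a < x.im → x.im < b → f₁ x = f₂ x)
    (h₃₂ : ∀ x : ℂ, -b < x.im → x.im < -a → f₃ x = f₂ x)
    (d₁ : DifferentiableOn ℂ f₁ {x | a < x.im}) (d₂ : DifferentiableOn ℂ f₂ {x | |x.im| < b})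
    (d₃ : DifferentiableOn ℂ f₃ {x | x.im < -a}) :
    ∃ T : ℂ → ℂ, Differentiable ℂ T ∧ (∀ x : ℂ, a < x.im → T x = f₁ x) ∧
      (∀ x : ℂ, |x.im| < b → T x = f₂ x) ∧ ∀ x : ℂ, x.im < -a → T x = f₃ x := by
  classical
  set T : ℂ → ℂ := fun x => if |x.im| < b then f₂ x else if a < x.im then f₁ x else f₃ x with hT
  have e₁ : ∀ x : ℂ, a < x.im → T x = f₁ x := by
    intro x hx
    simp only [hT]
    split_ifs with h
    · exact (h₁₂ x hx (abs_lt.1 h).2).symm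
    · rfl
  have e₂ : ∀ x : ℂ, |x.im| < b → T x = f₂ x := fun x hx => if_pos hx
  have e₃ : ∀ x : ℂ, x.im < -a → T x = f₃ x := by
    intro x hx
    simp only [hT]
    split_ifs with h h'
    · exact (h₃₂ x (abs_lt.1 h).1 hx).symm
    · linarith
    · rfl
  refine ⟨T, fun x => ?_, e₁, e₂, e₃⟩
  have o₁ : IsOpen {x : ℂ | a < x.im} := isOpen_lt continuous_const Complex.continuous_im
  have o₂ : IsOpen {x : ℂ | |x.im| < b} := isOpen_lt (by fun_prop) continuous_const
  have o₃ : IsOpen {x : ℂ | x.im < -a} := isOpen_lt Complex.continuous_im continuous_const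
  by_cases h1 : a < x.im
  · exact ((d₁.differentiableAt (o₁.mem_nhds h1))).congr_of_eventuallyEq
      (eventually_of_mem (o₁.mem_nhds h1) e₁)
  by_cases h3 : x.im < -a
  · exact ((d₃.differentiableAt (o₃.mem_nhds h3))).congr_of_eventuallyEq
      (eventually_of_mem (o₃.mem_nhds h3) e₃)
  · have h2 : |x.im| < b := abs_lt.2 ⟨by linarith, by linarith⟩
    exact ((d₂.differentiableAt (o₂.mem_nhds h2))).congr_of_eventuallyEq
      (eventually_of_mem (o₂.mem_nhds h2) e₂)

/-! ### The transfer matrix eigenvalue `t` -/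

/-- The term `Λ^{2N} v_↑(x + iħ) / (v_↑(x) ϑ(x + iħ))`, where `v_↑(x) = exp (A (x + iħ/2))`. -/
def tailUp {N : ℕ} (ħ : ℝ) (δ : Fin N → ℂ) (Λ : ℝ) (A : ℂ → ℂ) (x : ℂ) : ℂ :=
  (Λ : ℂ) ^ (2 * N) * exp (A (x + 3 * (I * ħ / 2)) - A (x + I * ħ / 2)) / vartheta δ (x + I * ħ)

/-- The mirror image of `tailUp`. -/
def tailDown {N : ℕ} (ħ : ℝ) (δ : Fin N → ℂ) (Λ : ℝ) (B : ℂ → ℂ) (x : ℂ) : ℂ :=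
  (Λ : ℂ) ^ (2 * N) * exp (B (x - 3 * (I * ħ / 2)) - B (x - I * ħ / 2)) / vartheta δ (x - I * ħ)

section Transfer

variable {N : ℕ} {ħ : ℝ} {δ : Fin N → ℂ} {Λ : ℝ} {X : ℝ → ℂ} {ε : ℝ} {A B : ℂ → ℂ}

theorem im_shift (x : ℂ) (ħ : ℝ) : (x + I * ħ / 2).im = x.im + ħ / 2 ∧
    (x - I * ħ / 2).im = x.im - ħ / 2 ∧ (x + 3 * (I * ħ / 2)).im = x.im + 3 * (ħ / 2) ∧
    (x - 3 * (I * ħ / 2)).im = x.im - 3 * (ħ / 2) ∧ (x + I * ħ).im = x.im + ħ ∧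
    (x - I * ħ).im = x.im - ħ := by
  have e1 : I * (ħ : ℂ) / 2 = ((ħ / 2 : ℝ) : ℂ) * I := by push_cast; ring
  have e2 : 3 * (((ħ / 2 : ℝ) : ℂ) * I) = ((3 * (ħ / 2) : ℝ) : ℂ) * I := by push_cast; ring
  have e3 : I * (ħ : ℂ) = (ħ : ℂ) * I := mul_comm _ _
  rw [e1, e2, e3]
  simp

theorem vartheta_ne_zero {x : ℂ} (hx : ∀ k, (δ k).im ≠ x.im) : vartheta δ x ≠ 0 :=
  Finset.prod_ne_zero_iff.2 fun k _ h0 => hx k (by rw [sub_eq_zero.1 h0])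

theorem differentiable_vartheta : Differentiable ℂ (vartheta δ) := by
  unfold vartheta
  fun_prop

theorem norm_vartheta_inv_le {x : ℂ} {r : ℝ} (hr : 0 < r) (hx : ∀ k, r ≤ |x.im - (δ k).im|) :
    ‖(vartheta δ x)⁻¹‖ ≤ (r⁻¹) ^ N := by
  rw [vartheta, ← Finset.prod_inv_distrib, norm_prod]
  refine (Finset.prod_le_prod (fun _ _ => norm_nonneg _) fun k _ => ?_).trans
    (le_of_eq (by rw [Finset.prod_const, Finset.card_univ, Fintype.card_fin]))
  rw [norm_inv]
  refine inv_anti₀ hr ((hx k).trans ?_)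
  simpa using Complex.abs_im_le_norm (x - δ k)

theorem exists_norm_vartheta_le : ∃ C, 0 ≤ C ∧ ∀ x, ‖vartheta δ x‖ ≤ C * (1 + ‖x‖) ^ N := by
  refine ⟨∏ k, (1 + ‖δ k‖), Finset.prod_nonneg fun k _ => by positivity, fun x => ?_⟩
  rw [vartheta, norm_prod]
  calc _ ≤ ∏ k, ((1 + ‖δ k‖) * (1 + ‖x‖)) := by
        refine Finset.prod_le_prod (fun _ _ => norm_nonneg _) fun k _ => ?_
        refine (norm_sub_le _ _).trans ?_
        nlinarith [norm_nonneg x, norm_nonneg (δ k), mul_nonneg (norm_nonneg x) (norm_nonneg (δ k))]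
    _ = _ := by
        rw [Finset.prod_mul_distrib, Finset.prod_const, Finset.card_univ, Fintype.card_fin]

theorem Theta_shift (x : ℂ) : Theta ħ δ Λ (x - I * ħ / 2) =
      ((Λ : ℂ) ^ (2 * N))⁻¹ * (vartheta δ (x - I * ħ) * vartheta δ x) ∧
    Theta ħ δ Λ (x + I * ħ / 2) =
      ((Λ : ℂ) ^ (2 * N))⁻¹ * (vartheta δ x * vartheta δ (x + I * ħ)) := by
  have e1 : x - I * ħ / 2 - I * ħ / 2 = x - I * ħ := by ring
  have e2 : x + I * ħ / 2 + I * ħ / 2 = x + I * ħ := by ring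
  rw [Theta, Theta, e1, e2, sub_add_cancel, add_sub_cancel_right]
  exact ⟨rfl, rfl⟩

theorem IsFactorization.im_gap (h : IsFactorization ħ δ Λ X ε A B) (k : Fin N) :
    -(ħ / 2) + ε ≤ (δ k).im ∧ (δ k).im ≤ ħ / 2 - ε := by
  have := abs_le.1 (show |(δ k).im| ≤ ħ / 2 - ε by linarith [h.gap k])
  constructor <;> linarith

/-- This is the jump relation at x - iħ/2: the summand 1 gives the leading term of the middle
formula, and the other summand, with ϑ(x) cancelled against Θ, gives `tailDown`. -/
theorem IsFactorization.glue_up (h : IsFactorization ħ δ Λ X ε A B) (hΛ : 0 < Λ) {x : ℂ}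
    (h1 : ħ / 2 - ε < x.im) (h2 : x.im < ħ / 2) :
    vartheta δ x * exp (A (x - I * ħ / 2) - A (x + I * ħ / 2)) + tailUp ħ δ Λ A x =
      vartheta δ x * exp (-A (x + I * ħ / 2) - B (x - I * ħ / 2)) + tailUp ħ δ Λ A x +
        tailDown ħ δ Λ B x := by
  have hε := h.pos
  obtain ⟨-, i2, -, -, -, i6⟩ := im_shift x ħ
  have hj := h.jump (x - I * ħ / 2) (by rw [i2]; exact abs_lt.2 ⟨by linarith, by linarith⟩)
  have e1 : x - I * ħ / 2 + I * ħ = x + I * ħ / 2 := by ring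
  have e2 : x - I * ħ / 2 - I * ħ = x - 3 * (I * ħ / 2) := by ring
  rw [e1, e2, (Theta_shift x).1] at hj
  have hΛc : (Λ : ℂ) ≠ 0 := by exact_mod_cast hΛ.ne'
  have n1 : vartheta δ x ≠ 0 := vartheta_ne_zero fun k => ne_of_lt (by linarith [(h.im_gap k).2])
  have n2 : vartheta δ (x - I * ħ) ≠ 0 := vartheta_ne_zero fun k => ne_of_gt (by
    rw [i6]; linarith [(h.im_gap k).1])
  simp only [tailDown, Complex.exp_sub, Complex.exp_neg]
  have m1 := Complex.exp_ne_zero (A (x + I * ħ / 2))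
  have m2 := Complex.exp_ne_zero (B (x - I * ħ / 2))
  have m3 := Complex.exp_ne_zero (A (x - I * ħ / 2))
  generalize exp (A (x + I * ħ / 2)) = a1 at *
  generalize exp (B (x - I * ħ / 2)) = b1 at *
  generalize exp (A (x - I * ħ / 2)) = a2 at *
  generalize exp (B (x - 3 * (I * ħ / 2))) = b2 at *
  have hj' : a2 = (1 + a1 * b2 / (((Λ : ℂ) ^ (2 * N))⁻¹ *
      (vartheta δ (x - I * ħ) * vartheta δ x))) / b1 := by
    rw [← hj, mul_div_cancel_right₀ _ m2]
  rw [hj']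
  field_simp
  ring

theorem IsFactorization.glue_down (h : IsFactorization ħ δ Λ X ε A B) (hΛ : 0 < Λ) {x : ℂ}
    (h1 : -(ħ / 2) < x.im) (h2 : x.im < -(ħ / 2 - ε)) :
    vartheta δ x * exp (B (x + I * ħ / 2) - B (x - I * ħ / 2)) + tailDown ħ δ Λ B x =
      vartheta δ x * exp (-A (x + I * ħ / 2) - B (x - I * ħ / 2)) + tailUp ħ δ Λ A x +
        tailDown ħ δ Λ B x := by
  have hε := h.pos
  obtain ⟨i1, -, -, -, i5, -⟩ := im_shift x ħ
  have hj := h.jump (x + I * ħ / 2) (by rw [i1]; exact abs_lt.2 ⟨by linarith, by linarith⟩)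
  have e1 : x + I * ħ / 2 - I * ħ = x - I * ħ / 2 := by ring
  have e2 : x + I * ħ / 2 + I * ħ = x + 3 * (I * ħ / 2) := by ring
  rw [e1, e2, (Theta_shift x).2] at hj
  have hΛc : (Λ : ℂ) ≠ 0 := by exact_mod_cast hΛ.ne'
  have n1 : vartheta δ x ≠ 0 := vartheta_ne_zero fun k => ne_of_gt (by linarith [(h.im_gap k).1])
  have n2 : vartheta δ (x + I * ħ) ≠ 0 := vartheta_ne_zero fun k => ne_of_lt (by
    rw [i5]; linarith [(h.im_gap k).2])
  simp only [tailUp, Complex.exp_sub, Complex.exp_neg]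
  have m1 := Complex.exp_ne_zero (A (x + I * ħ / 2))
  have m2 := Complex.exp_ne_zero (B (x - I * ħ / 2))
  have m3 := Complex.exp_ne_zero (B (x + I * ħ / 2))
  generalize exp (A (x + I * ħ / 2)) = a1 at *
  generalize exp (B (x - I * ħ / 2)) = b1 at *
  generalize exp (B (x + I * ħ / 2)) = b3 at *
  generalize exp (A (x + 3 * (I * ħ / 2))) = a2 at *
  have hj' : b3 = (1 + a2 * b1 / (((Λ : ℂ) ^ (2 * N))⁻¹ *
      (vartheta δ x * vartheta δ (x + I * ħ)))) / a1 := by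
    rw [← hj, mul_div_cancel_left₀ _ m1]
  rw [hj']
  field_simp

theorem IsFactorization.differentiableAt_up (h : IsFactorization ħ δ Λ X ε A B) {x : ℂ} (c : ℂ)
    (hx : -ε < (x + c).im) : DifferentiableAt ℂ (fun x => A (x + c)) x :=
  DifferentiableAt.comp (f := fun x => x + c) x (h.diff_up.differentiableAt
    ((isOpen_lt continuous_const Complex.continuous_im).mem_nhds hx)) (by fun_prop)

theorem IsFactorization.differentiableAt_down (h : IsFactorization ħ δ Λ X ε A B) {x : ℂ} (c : ℂ)
    (hx : (x + c).im < ε) : DifferentiableAt ℂ (fun x => B (x + c)) x :=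
  DifferentiableAt.comp (f := fun x => x + c) x (h.diff_down.differentiableAt
    ((isOpen_lt Complex.continuous_im continuous_const).mem_nhds hx)) (by fun_prop)

theorem IsFactorization.differentiableAt_tailUp (h : IsFactorization ħ δ Λ X ε A B) {x : ℂ}
    (hħ : 0 < ħ) (hx : -(ħ / 2) < x.im) : DifferentiableAt ℂ (tailUp ħ δ Λ A) x := by
  have hε := h.pos
  obtain ⟨i1, -, i3, -, i5, -⟩ := im_shift x ħ
  have n : vartheta δ (x + I * ħ) ≠ 0 := vartheta_ne_zero fun k => ne_of_lt (by
    rw [i5]; linarith [(h.im_gap k).2])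
  have d1 := h.differentiableAt_up (x := x) (3 * (I * ħ / 2)) (by rw [i3]; linarith)
  have d2 := h.differentiableAt_up (x := x) (I * ħ / 2) (by rw [i1]; linarith)
  have d3 : DifferentiableAt ℂ (fun x => vartheta δ (x + I * ħ)) x :=
    DifferentiableAt.comp (f := fun x : ℂ => x + I * ħ) x (differentiable_vartheta _) (by fun_prop)
  exact ((d1.sub d2).cexp.const_mul _).div d3 n

theorem IsFactorization.differentiableAt_tailDown (h : IsFactorization ħ δ Λ X ε A B) {x : ℂ}
    (hħ : 0 < ħ) (hx : x.im < ħ / 2) : DifferentiableAt ℂ (tailDown ħ δ Λ B) x := by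
  have hε := h.pos
  obtain ⟨-, i2, -, i4, -, i6⟩ := im_shift x ħ
  have n : vartheta δ (x - I * ħ) ≠ 0 := vartheta_ne_zero fun k => ne_of_gt (by
    rw [i6]; linarith [(h.im_gap k).1])
  have d1 := h.differentiableAt_down (x := x) (-(3 * (I * ħ / 2))) (by
    rw [← sub_eq_add_neg, i4]; linarith)
  have d2 := h.differentiableAt_down (x := x) (-(I * ħ / 2)) (by
    rw [← sub_eq_add_neg, i2]; linarith)
  simp only [← sub_eq_add_neg] at d1 d2
  have d3 : DifferentiableAt ℂ (fun x => vartheta δ (x - I * ħ)) x :=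
    DifferentiableAt.comp (f := fun x : ℂ => x - I * ħ) x (differentiable_vartheta _) (by fun_prop)
  exact ((d1.sub d2).cexp.const_mul _).div d3 n

theorem norm_exp_sub_le {a b : ℂ} {M : ℝ} (ha : ‖a‖ ≤ M) (hb : ‖b‖ ≤ M) :
    ‖exp (a - b)‖ ≤ Real.exp (2 * M) :=
  (Complex.norm_exp_le_exp_norm _).trans (Real.exp_le_exp.2 ((norm_sub_le _ _).trans (by linarith)))

/-- The entire function that is glued from the formulae for the eigenvalue of the transfer
matrix. -/
theorem IsFactorization.exists_transfer (h : IsFactorization ħ δ Λ X ε A B) (hħ : 0 < ħ)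
    (hN : N ≠ 0) (hΛ : 0 < Λ) : ∃ T : Polynomial ℂ, T.natDegree ≤ N ∧
      (∀ x : ℂ, ħ / 2 - ε < x.im → T.eval x =
        vartheta δ x * exp (A (x - I * ħ / 2) - A (x + I * ħ / 2)) + tailUp ħ δ Λ A x) ∧
      (∀ x : ℂ, |x.im| < ħ / 2 → T.eval x =
        vartheta δ x * exp (-A (x + I * ħ / 2) - B (x - I * ħ / 2)) + tailUp ħ δ Λ A x +
          tailDown ħ δ Λ B x) ∧
      (∀ x : ℂ, x.im < -(ħ / 2 - ε) → T.eval x =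
        vartheta δ x * exp (B (x + I * ħ / 2) - B (x - I * ħ / 2)) + tailDown ħ δ Λ B x) := by
  have hε := h.pos
  have hεħ : ε ≤ ħ / 2 := by
    have := h.gap ⟨0, Nat.pos_of_ne_zero hN⟩
    linarith [abs_nonneg (δ ⟨0, Nat.pos_of_ne_zero hN⟩).im]
  have hd1 : DifferentiableOn ℂ (fun x => vartheta δ x * exp (A (x - I * ħ / 2) - A (x + I * ħ / 2)) +
      tailUp ħ δ Λ A x) {x | ħ / 2 - ε < x.im} := by
    intro x hx
    have hx' : ħ / 2 - ε < x.im := hx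
    obtain ⟨i1, i2, -⟩ := im_shift x ħ
    have d1 := h.differentiableAt_up (x := x) (-(I * ħ / 2)) (by
      rw [← sub_eq_add_neg, i2]; linarith)
    have d2 := h.differentiableAt_up (x := x) (I * ħ / 2) (by rw [i1]; linarith)
    simp only [← sub_eq_add_neg] at d1
    exact (((differentiable_vartheta x).mul (d1.sub d2).cexp).add
      (h.differentiableAt_tailUp hħ (by linarith))).differentiableWithinAt
  have hd2 : DifferentiableOn ℂ (fun x => vartheta δ x * exp (-A (x + I * ħ / 2) - B (x - I * ħ / 2)) +
      tailUp ħ δ Λ A x + tailDown ħ δ Λ B x) {x | |x.im| < ħ / 2} := by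
    intro x hx
    have hx' := abs_lt.1 (show |x.im| < ħ / 2 from hx)
    obtain ⟨i1, i2, -⟩ := im_shift x ħ
    have d1 := h.differentiableAt_down (x := x) (-(I * ħ / 2)) (by
      rw [← sub_eq_add_neg, i2]; linarith)
    have d2 := h.differentiableAt_up (x := x) (I * ħ / 2) (by rw [i1]; linarith)
    simp only [← sub_eq_add_neg] at d1
    exact ((((differentiable_vartheta x).mul (d2.neg.sub d1).cexp).add
      (h.differentiableAt_tailUp hħ (by linarith))).add
      (h.differentiableAt_tailDown hħ (by linarith))).differentiableWithinAt
  have hd3 : DifferentiableOn ℂ (fun x => vartheta δ x * exp (B (x + I * ħ / 2) - B (x - I * ħ / 2)) +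
      tailDown ħ δ Λ B x) {x | x.im < -(ħ / 2 - ε)} := by
    intro x hx
    have hx' : x.im < -(ħ / 2 - ε) := hx
    obtain ⟨i1, i2, -⟩ := im_shift x ħ
    have d1 := h.differentiableAt_down (x := x) (-(I * ħ / 2)) (by
      rw [← sub_eq_add_neg, i2]; linarith)
    have d2 := h.differentiableAt_down (x := x) (I * ħ / 2) (by rw [i1]; linarith)
    simp only [← sub_eq_add_neg] at d1
    exact (((differentiable_vartheta x).mul (d2.sub d1).cexp).add
      (h.differentiableAt_tailDown hħ (by linarith))).differentiableWithinAt
  obtain ⟨T, hT, e₁, e₂, e₃⟩ := exists_glue (a := ħ / 2 - ε) (b := ħ / 2)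
    (f₁ := fun x => vartheta δ x * exp (A (x - I * ħ / 2) - A (x + I * ħ / 2)) + tailUp ħ δ Λ A x)
    (f₂ := fun x => vartheta δ x * exp (-A (x + I * ħ / 2) - B (x - I * ħ / 2)) +
      tailUp ħ δ Λ A x + tailDown ħ δ Λ B x)
    (f₃ := fun x => vartheta δ x * exp (B (x + I * ħ / 2) - B (x - I * ħ / 2)) +
      tailDown ħ δ Λ B x) (by linarith) (by linarith)
    (fun x h1 h2 => h.glue_up hΛ h1 h2) (fun x h1 h2 => h.glue_down hΛ h1 h2) hd1 hd2 hd3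
  obtain ⟨C, hC0, hC⟩ := exists_norm_vartheta_le (δ := δ)
  obtain ⟨M, hA, hB⟩ := h.bound
  set K := ‖(Λ : ℂ) ^ (2 * N)‖ * (Real.exp (2 * M) * ((ε / 2)⁻¹) ^ N) with hK
  have hK0 : 0 ≤ K := by positivity
  -- The formulae are switched in the middle of the overlaps, at |Im x| = ħ/2 - ε/2. There x ± iħ
  -- keeps a distance of at least ε/2 from the zeros of ϑ, so the tails are bounded and only ϑ(x)
  -- grows.
  have hup : ∀ x : ℂ, -(ħ / 2 - ε / 2) ≤ x.im → ‖tailUp ħ δ Λ A x‖ ≤ K := by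
    intro x hx
    obtain ⟨i1, -, i3, -, i5, -⟩ := im_shift x ħ
    rw [tailUp, div_eq_mul_inv, norm_mul, norm_mul, hK, mul_assoc]
    refine mul_le_mul_of_nonneg_left (mul_le_mul (norm_exp_sub_le (hA _ (by rw [i3]; linarith))
      (hA _ (by rw [i1]; linarith))) (norm_vartheta_inv_le (by positivity) fun k => ?_)
      (norm_nonneg _) (Real.exp_nonneg _)) (norm_nonneg _)
    refine le_trans ?_ (le_abs_self _)
    rw [i5]; linarith [(h.im_gap k).2]
  have hdn : ∀ x : ℂ, x.im ≤ ħ / 2 - ε / 2 → ‖tailDown ħ δ Λ B x‖ ≤ K := by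
    intro x hx
    obtain ⟨-, i2, -, i4, -, i6⟩ := im_shift x ħ
    rw [tailDown, div_eq_mul_inv, norm_mul, norm_mul, hK, mul_assoc]
    refine mul_le_mul_of_nonneg_left (mul_le_mul (norm_exp_sub_le (hB _ (by rw [i4]; linarith))
      (hB _ (by rw [i2]; linarith))) (norm_vartheta_inv_le (by positivity) fun k => ?_)
      (norm_nonneg _) (Real.exp_nonneg _)) (norm_nonneg _)
    refine le_trans ?_ (neg_le_abs _)
    rw [i6]; linarith [(h.im_gap k).1]
  have hlead : ∀ (x a b : ℂ), ‖a‖ ≤ M → ‖b‖ ≤ M →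
      ‖vartheta δ x * exp (a - b)‖ ≤ C * Real.exp (2 * M) * (1 + ‖x‖) ^ N := by
    intro x a b ha hb
    rw [norm_mul]
    calc _ ≤ C * (1 + ‖x‖) ^ N * Real.exp (2 * M) :=
          mul_le_mul (hC x) (norm_exp_sub_le ha hb) (norm_nonneg _) (by positivity)
      _ = _ := by ring
  have hone : ∀ x : ℂ, K ≤ K * (1 + ‖x‖) ^ N := fun x =>
    le_mul_of_one_le_right hK0 (one_le_pow₀ (by linarith [norm_nonneg x]))
  obtain ⟨p, hp, hpe⟩ := exists_polynomial_of_growth N (C := C * Real.exp (2 * M) + 2 * K) hT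
    fun x => by
      obtain ⟨i1, i2, -⟩ := im_shift x ħ
      have hx1 := hone x
      rw [add_mul, mul_assoc 2 K]
      by_cases h1 : ħ / 2 - ε / 2 < x.im
      · rw [e₁ x (by linarith)]
        have := hlead x (A (x - I * ħ / 2)) (A (x + I * ħ / 2)) (hA _ (by rw [i2]; linarith))
          (hA _ (by rw [i1]; linarith))
        exact (norm_add_le _ _).trans (by linarith [hup x (by linarith)])
      by_cases h3 : x.im < -(ħ / 2 - ε / 2)
      · rw [e₃ x (by linarith)]
        have := hlead x (B (x + I * ħ / 2)) (B (x - I * ħ / 2)) (hB _ (by rw [i1]; linarith))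
          (hB _ (by rw [i2]; linarith))
        exact (norm_add_le _ _).trans (by linarith [hdn x (by linarith)])
      · rw [e₂ x (abs_lt.2 ⟨by linarith, by linarith⟩)]
        have := hlead x (-A (x + I * ħ / 2)) (B (x - I * ħ / 2))
          (by rw [norm_neg]; exact hA _ (by rw [i1]; linarith)) (hB _ (by rw [i2]; linarith))
        exact (norm_add₃_le).trans
          (by linarith [hdn x (by linarith), hup x (by linarith)])
  exact ⟨p, hp, fun x hx => by rw [← hpe, e₁ x hx], fun x hx => by rw [← hpe, e₂ x hx],
    fun x hx => by rw [← hpe, e₃ x hx]⟩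

end Transfer

/-! ### The leading coefficients of `t` -/

section Coefficients

variable {N : ℕ} {ħ : ℝ} {δ : Fin N → ℂ} {Λ : ℝ} {X : ℝ → ℂ} {ε : ℝ} {A B : ℂ → ℂ}

theorem tendsto_inv_I_mul_sub (s : ℂ) :
    Tendsto (fun y : ℝ => (I * y - s)⁻¹) atTop (𝓝 0) := by
  rw [tendsto_zero_iff_norm_tendsto_zero]
  simp only [norm_inv]
  refine tendsto_inv_atTop_zero.comp (tendsto_atTop_mono (fun y => ?_)
    (tendsto_atTop_add_const_right _ (-‖s‖) tendsto_id))
  have h1 := norm_sub_norm_le (I * y : ℂ) s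
  have h2 : ‖(I * y : ℂ)‖ = |y| := by simp
  rw [h2] at h1
  simp only [id]
  linarith [le_abs_self y]

theorem eventually_I_mul_sub_ne_zero (s : ℂ) : ∀ᶠ y : ℝ in atTop, (I * y - s : ℂ) ≠ 0 := by
  filter_upwards [eventually_gt_atTop s.im] with y hy h0
  have := congrArg Complex.im h0
  simp at this
  linarith

theorem tendsto_I_mul_div_sub (s : ℂ) :
    Tendsto (fun y : ℝ => I * y / (I * y - s)) atTop (𝓝 1) := by
  have := ((tendsto_inv_I_mul_sub s).const_mul s).const_add 1
  rw [mul_zero, add_zero] at this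
  refine this.congr' ?_
  filter_upwards [eventually_I_mul_sub_ne_zero s] with y hy
  field_simp
  ring

theorem tendsto_tailUp (h : IsFactorization ħ δ Λ X ε A B) (hN : N ≠ 0) (hħ : 0 < ħ) :
    Tendsto (fun y : ℝ => tailUp ħ δ Λ A (I * y)) atTop (𝓝 0) := by
  obtain ⟨M, hA, -⟩ := h.bound
  have h1 : Tendsto (fun y : ℝ => (vartheta δ (I * y + I * ħ))⁻¹) atTop (𝓝 0) := by
    have : Tendsto (fun y : ℝ => ∏ k, (I * y - (δ k - I * ħ))⁻¹) atTop (𝓝 (∏ _k : Fin N, 0)) :=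
      tendsto_finsetProd _ fun k _ => tendsto_inv_I_mul_sub _
    rw [Finset.prod_const, Finset.card_univ, Fintype.card_fin, zero_pow hN] at this
    refine this.congr fun y => ?_
    rw [vartheta, ← Finset.prod_inv_distrib]
    refine Finset.prod_congr rfl fun k _ => ?_
    congr 1
    ring
  have h2 := (h1.norm.const_mul (‖(Λ : ℂ) ^ (2 * N)‖ * Real.exp (2 * M)))
  rw [norm_zero, mul_zero] at h2
  refine squeeze_zero_norm' ?_ h2
  filter_upwards [eventually_gt_atTop 0] with y hy
  have hε := h.pos
  have hy' : ((I : ℂ) * y).im = y := by simp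
  obtain ⟨i1, -, i3, -, -, -⟩ := im_shift (I * y) ħ
  rw [hy'] at i1 i3
  rw [tailUp, div_eq_mul_inv, norm_mul, norm_mul]
  exact mul_le_mul_of_nonneg_right (mul_le_mul_of_nonneg_left
    (norm_exp_sub_le (hA _ (by rw [i3]; linarith)) (hA _ (by rw [i1]; linarith)))
    (norm_nonneg _)) (norm_nonneg _)

/-- The difference of two resolvents is iħ over their product of denominators, of order x⁻². On the
imaginary axis the rescaled kernel is bounded by 2 uniformly in t, so integrability of L alone
allows dominated convergence. -/
theorem tendsto_sq_mul_sub (h : IsFactorization ħ δ Λ X ε A B) (hħ : 0 < ħ)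
    (hL : Integrable fun μ => Complex.log (1 + X μ)) :
    Tendsto (fun y : ℝ => (I * y) ^ 2 * (A (I * y - I * ħ / 2) - A (I * y + I * ħ / 2))) atTop
      (𝓝 (-(ħ / (2 * Real.pi)) * ∫ μ, Complex.log (1 + X μ))) := by
  set L : ℝ → ℂ := fun μ => Complex.log (1 + X μ) with hLdef
  have hint : Tendsto (fun y : ℝ => ∫ t : ℝ, (I * y / (I * y - (t + I * ħ / 2))) *
      (I * y / (I * y - (t - I * ħ / 2))) * L t) atTop (𝓝 (∫ t, L t)) := by
    refine tendsto_integral_filter_of_dominated_convergence (fun t => 2 * ‖L t‖) ?_ ?_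
      (hL.norm.const_mul 2) ?_
    · filter_upwards [eventually_gt_atTop (ħ / 2)] with y hy
      refine AEStronglyMeasurable.mul (Continuous.aestronglyMeasurable ?_) hL.aestronglyMeasurable
      obtain ⟨i1, i2, -⟩ := im_shift (I * y) ħ
      have hy' : ((I : ℂ) * y).im = y := by simp
      rw [hy'] at i1 i2
      refine Continuous.mul (continuous_const.div (by fun_prop) fun t => ?_)
        (continuous_const.div (by fun_prop) fun t => ?_)
      · rw [show (I * y - (t + I * ħ / 2) : ℂ) = I * y - I * ħ / 2 - t by ring]
        exact sub_ofReal_ne_zero (ne_of_gt (by rw [i2]; linarith)) t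
      · rw [show (I * y - (t - I * ħ / 2) : ℂ) = I * y + I * ħ / 2 - t by ring]
        exact sub_ofReal_ne_zero (ne_of_gt (by rw [i1]; linarith)) t
    · filter_upwards [eventually_gt_atTop ħ] with y hy
      refine Eventually.of_forall fun t => ?_
      rw [norm_mul]
      refine mul_le_mul_of_nonneg_right ?_ (norm_nonneg _)
      obtain ⟨i1, i2, -⟩ := im_shift (I * y) ħ
      have hy' : ((I : ℂ) * y).im = y := by simp
      rw [hy'] at i1 i2
      have n1 := abs_im_le_norm_sub_ofReal (I * y - I * ħ / 2) t
      have n2 := abs_im_le_norm_sub_ofReal (I * y + I * ħ / 2) t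
      rw [i2, abs_of_pos (by linarith)] at n1
      rw [i1, abs_of_pos (by linarith)] at n2
      rw [show (I * y - (t + I * ħ / 2) : ℂ) = I * y - I * ħ / 2 - t by ring,
        show (I * y - (t - I * ħ / 2) : ℂ) = I * y + I * ħ / 2 - t by ring,
        div_mul_div_comm, norm_div, norm_mul, norm_mul, norm_mul, Complex.norm_I,
        Complex.norm_real, one_mul, Real.norm_of_nonneg (by linarith), div_le_iff₀
        (mul_pos (by linarith) (by linarith))]
      have := mul_le_mul n1 n2 (by linarith) (norm_nonneg _)
      nlinarith
    · refine Eventually.of_forall fun t => ?_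
      have := ((tendsto_I_mul_div_sub (t + I * ħ / 2)).mul
        (tendsto_I_mul_div_sub (t - I * ħ / 2))).mul_const (L t)
      simpa using this
  refine (hint.const_mul (-(ħ / (2 * Real.pi)) : ℂ)).congr' ?_
  filter_upwards [eventually_gt_atTop (ħ / 2)] with y hy
  obtain ⟨i1, i2, -⟩ := im_shift (I * y) ħ
  have hy' : ((I : ℂ) * y).im = y := by simp
  rw [hy'] at i1 i2
  have j1 : 0 < (I * (y : ℂ) + I * ħ / 2).im := by rw [i1]; linarith
  have j2 : 0 < (I * (y : ℂ) - I * ħ / 2).im := by rw [i2]; linarith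
  rw [h.eq_up _ j1, h.eq_up _ j2, logVUp_eq, logVUp_eq, sub_add_cancel, sub_add_cancel, ← mul_sub,
    cauchyT, cauchyT, ← integral_sub (integrable_inv_sub_mul hL j2.ne')
    (integrable_inv_sub_mul hL j1.ne'), ← mul_assoc, ← integral_const_mul, ← integral_const_mul]
  refine integral_congr_ae (Eventually.of_forall fun t => ?_)
  simp only
  have n1 := sub_ofReal_ne_zero j1.ne' t
  have n2 := sub_ofReal_ne_zero j2.ne' t
  rw [show (I * y - (t + I * ħ / 2) : ℂ) = I * y - I * ħ / 2 - t by ring,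
    show (I * y - (t - I * ħ / 2) : ℂ) = I * y + I * ħ / 2 - t by ring]
  change _ = _ * ((I * ↑y - I * ↑ħ / 2 - ↑t)⁻¹ * L t - (I * ↑y + I * ↑ħ / 2 - ↑t)⁻¹ * L t)
  rw [← sub_mul, inv_sub_inv n2 n1, div_mul_div_comm,
    show I * (y : ℂ) + I * ħ / 2 - t - (I * y - I * ħ / 2 - t) = I * ħ by ring]
  have hπc : (Real.pi : ℂ) ≠ 0 := by exact_mod_cast Real.pi_ne_zero
  field_simp

/-- The three leading coefficients of the eigenvalue of the transfer matrix. -/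
theorem transfer_coeff (h : IsFactorization ħ δ Λ X ε A B) (hħ : 0 < ħ) (hN : 2 ≤ N)
    (hL : Integrable fun μ => Complex.log (1 + X μ)) {T : Polynomial ℂ} (hT : T.natDegree ≤ N)
    (hT1 : ∀ x : ℂ, ħ / 2 - ε < x.im → T.eval x =
        vartheta δ x * exp (A (x - I * ħ / 2) - A (x + I * ħ / 2)) + tailUp ħ δ Λ A x) :
    T.coeff N = 1 ∧ T.coeff (N - 1) = -∑ k, δ k ∧
      T.coeff (N - 1) ^ 2 / 2 - T.coeff (N - 2) = 1 / 2 * ∑ k, δ k ^ 2 +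
        ħ / (2 * Real.pi) * ∫ μ, Complex.log (1 + X μ) := by
  set c : ℂ := ħ / (2 * Real.pi) * ∫ μ, Complex.log (1 + X μ) with hc
  set P : Polynomial ℂ := ∏ k, (1 - Polynomial.C (δ k) * Polynomial.X) with hP
  -- With u = 1/x, the leading term of x^{-N} T(x) is P(u) e^D and e^D - 1 behaves like -cu². So
  -- S(u) = o(u²), and its first three coefficients vanish.
  set S : Polynomial ℂ := T.reflect N - P + Polynomial.C c * Polynomial.X ^ 2 with hS
  have hε := h.pos
  set D : ℝ → ℂ := fun y => A (I * y - I * ħ / 2) - A (I * y + I * ħ / 2) with hD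
  have hx2D := tendsto_sq_mul_sub h hħ hL
  change Tendsto (fun y : ℝ => (I * y) ^ 2 * D y) atTop _ at hx2D
  rw [neg_mul, ← hc] at hx2D
  have hinv : Tendsto (fun y : ℝ => (I * y : ℂ)⁻¹) atTop (𝓝 0) := by
    simpa using tendsto_inv_I_mul_sub 0
  have hD0 : Tendsto D atTop (𝓝 0) := by
    have := hx2D.mul (hinv.pow 2)
    rw [zero_pow two_ne_zero, mul_zero] at this
    refine this.congr' ?_
    filter_upwards [eventually_gt_atTop 0] with y hy
    have : (y : ℂ) ≠ 0 := by exact_mod_cast hy.ne'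
    field_simp
  have hexp : Tendsto (fun y : ℝ => (I * y) ^ 2 * (exp (D y) - 1)) atTop (𝓝 (-c)) := by
    have h1 : Tendsto (fun y : ℝ => (I * y) ^ 2 * (exp (D y) - 1 - D y)) atTop (𝓝 0) := by
      have h2 := hx2D.norm.mul hD0.norm
      rw [norm_zero, mul_zero] at h2
      refine squeeze_zero_norm' ?_ h2
      have h3 := (tendsto_zero_iff_norm_tendsto_zero.1 hD0).eventually_le_const one_pos
      filter_upwards [h3] with y hy
      have := Complex.norm_exp_sub_one_sub_id_le hy
      rw [norm_mul, norm_mul]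
      calc _ ≤ ‖(I * y : ℂ) ^ 2‖ * ‖D y‖ ^ 2 := mul_le_mul_of_nonneg_left this (norm_nonneg _)
        _ = _ := by ring
    have := h1.add hx2D
    rw [zero_add] at this
    exact this.congr fun y => by ring
  have hPlim : Tendsto (fun y : ℝ => P.eval ((I * y : ℂ)⁻¹)) atTop (𝓝 1) := by
    have := (P.continuous.tendsto 0).comp hinv
    have h0 : P.eval 0 = 1 := by simp [hP, Polynomial.eval_prod]
    rwa [h0] at this
  -- After division by u² the tail carries u^{N-2}, a nonnegative power because N ≥ 2.
  have htail : Tendsto (fun y : ℝ => ((I * y : ℂ)⁻¹) ^ (N - 2) * tailUp ħ δ Λ A (I * y)) atTop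
      (𝓝 0) := by
    simpa using (hinv.pow (N - 2)).mul (tendsto_tailUp h (by omega) hħ)
  have hlim : Tendsto (fun y : ℝ => S.eval ((I * y : ℂ)⁻¹) / ((I * y : ℂ)⁻¹) ^ 2) atTop
      (𝓝 0) := by
    have h1 := ((hPlim.mul hexp).add htail).add_const c
    rw [one_mul, add_zero, neg_add_cancel] at h1
    refine h1.congr' ?_
    filter_upwards [eventually_gt_atTop (max 0 (ħ / 2))] with y hy
    have hy0 : 0 < y := (le_max_left _ _).trans_lt hy
    have hy1 : ħ / 2 < y := (le_max_right _ _).trans_lt hy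
    have hx0 : (I * y : ℂ) ≠ 0 := by
      have : (y : ℂ) ≠ 0 := by exact_mod_cast hy0.ne'
      exact mul_ne_zero I_ne_zero this
    have hTx := hT1 (I * y) (by simp; linarith)
    have hrefl : (T.reflect N).eval ((I * y : ℂ)⁻¹) * (I * y) ^ N = T.eval (I * y : ℂ) := by
      have : Invertible (I * y : ℂ) := invertibleOfNonzero hx0
      have := Polynomial.eval₂_reflect_mul_pow (RingHom.id ℂ) (I * y : ℂ) N T hT
      simpa [Polynomial.eval₂_eq_eval_map] using this
    have hPe : vartheta δ (I * y) = P.eval ((I * y : ℂ)⁻¹) * (I * y) ^ N := by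
      rw [hP, Polynomial.eval_prod, vartheta]
      have : ((I * y : ℂ)) ^ N = ∏ _k : Fin N, (I * y : ℂ) := by simp
      rw [this, ← Finset.prod_mul_distrib]
      refine Finset.prod_congr rfl fun k _ => ?_
      simp only [Polynomial.eval_sub, Polynomial.eval_one, Polynomial.eval_mul, Polynomial.eval_C,
        Polynomial.eval_X]
      rw [sub_mul, one_mul, mul_assoc, inv_mul_cancel₀ hx0, mul_one]
    rw [hTx, hPe] at hrefl
    change _ = _ * exp (D y) + _ at hrefl
    simp only [hS, Polynomial.eval_add, Polynomial.eval_sub, Polynomial.eval_mul, Polynomial.eval_C,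
      Polynomial.eval_pow, Polynomial.eval_X]
    generalize P.eval ((I * y : ℂ)⁻¹) = p at *
    generalize tailUp ħ δ Λ A (I * y) = u at *
    generalize (I * y : ℂ) = x at *
    have hr : (T.reflect N).eval x⁻¹ = p * exp (D y) + u / x ^ N := by
      rw [eq_comm, ← mul_left_inj' (pow_ne_zero N hx0), hrefl, add_mul,
        div_mul_cancel₀ _ (pow_ne_zero N hx0)]
      ring
    rw [hr, inv_pow, inv_pow, div_inv_eq_mul]
    have hxN : x ^ N = x ^ (N - 2) * x ^ 2 := by rw [← pow_add]; congr 1; omega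
    rw [hxN]
    field_simp
    ring
  -- The value 1 at y = 0 only serves to make u nonzero everywhere.
  have hz := fun k hk => coeff_eq_zero_of_tendsto (S := S) (l := atTop)
    (u := fun y : ℝ => if y = 0 then 1 else (I * y : ℂ)⁻¹) ?_ ?_ 2 ?_ k hk
  rotate_left
  · refine hinv.congr' ?_
    filter_upwards [eventually_gt_atTop 0] with y hy
    rw [if_neg hy.ne']
  · intro y
    split_ifs with hy
    · exact one_ne_zero
    · have : (y : ℂ) ≠ 0 := by exact_mod_cast hy
      exact inv_ne_zero (mul_ne_zero I_ne_zero this)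
  · refine hlim.congr' ?_
    filter_upwards [eventually_gt_atTop 0] with y hy
    rw [if_neg hy.ne']
  · obtain ⟨p0, p1, p2⟩ := coeff_prod_one_sub Finset.univ δ
    rw [← hP] at p0 p1 p2
    have z0 := hz 0 (by omega)
    have z1 := hz 1 (by omega)
    have z2 := hz 2 le_rfl
    simp only [hS, Polynomial.coeff_add, Polynomial.coeff_sub, Polynomial.coeff_reflect,
      Polynomial.coeff_C_mul, Polynomial.coeff_X_pow] at z0 z1 z2
    rw [Polynomial.revAt_le (by omega)] at z0 z1 z2
    rw [p0] at z0
    rw [p1] at z1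
    norm_num at z0 z1 z2
    have t1 : T.coeff (N - 1) = -∑ k, δ k := by linear_combination z1
    refine ⟨by linear_combination z0, t1, ?_⟩
    rw [t1]
    linear_combination (-1) * z2 - p2 / 2

end Coefficients

/-! ### Entire solutions of the Baxter equation -/

/-- One step of the continuation of a solution of a three term difference equation. -/
def extendStep (ħ : ℝ) (t : ℂ → ℂ) (a b : ℂ) (f : ℂ → ℂ) (x : ℂ) : ℂ :=
  b⁻¹ * (t (x + I * ħ) * f (x + I * ħ) - a * f (x + I * ħ + I * ħ))

/-- The equation is solved for the lowest of its three values. This divides only by the constant b,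
so no poles arise. -/
theorem extendStep_spec {ħ : ℝ} (hħ : 0 < ħ) {t : ℂ → ℂ} (ht : Differentiable ℂ t) {a b : ℂ}
    (hb : b ≠ 0) {c : ℝ} {f : ℂ → ℂ} (hf : ∀ x : ℂ, c < x.im → DifferentiableAt ℂ f x)
    (hB : ∀ x : ℂ, c + ħ < x.im → t x * f x = a * f (x + I * ħ) + b * f (x - I * ħ)) :
    (∀ x : ℂ, c < x.im → extendStep ħ t a b f x = f x) ∧
    (∀ x : ℂ, c - ħ < x.im → DifferentiableAt ℂ (extendStep ħ t a b f) x) ∧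
    ∀ x : ℂ, c < x.im → t x * extendStep ħ t a b f x =
      a * extendStep ħ t a b f (x + I * ħ) + b * extendStep ħ t a b f (x - I * ħ) := by
  have him : ∀ x : ℂ, (x + I * ħ).im = x.im + ħ := fun x => by simp
  have h1 : ∀ x : ℂ, c < x.im → extendStep ħ t a b f x = f x := by
    intro x hx
    rw [extendStep, hB _ (by rw [him]; linarith), add_sub_cancel_right, add_sub_cancel_left,
      inv_mul_cancel_left₀ hb]
  refine ⟨h1, fun x hx => ?_, fun x hx => ?_⟩
  · have d1 : DifferentiableAt ℂ (fun x => f (x + I * ħ)) x :=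
      (hf (x + I * ħ) (by rw [him]; linarith)).comp (f := fun x : ℂ => x + I * ħ) x (by fun_prop)
    have d2 : DifferentiableAt ℂ (fun x => f (x + I * ħ + I * ħ)) x :=
      (hf (x + I * ħ + I * ħ) (by rw [him, him]; linarith)).comp
        (f := fun x : ℂ => x + I * ħ + I * ħ) x (by fun_prop)
    have d3 : DifferentiableAt ℂ (fun x => t (x + I * ħ)) x :=
      (ht (x + I * ħ)).comp (f := fun x : ℂ => x + I * ħ) x (by fun_prop)
    exact ((d3.mul d1).sub (d2.const_mul _)).const_mul _
  · rw [h1 x hx, h1 (x + I * ħ) (by rw [him]; linarith), extendStep, sub_add_cancel,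
      mul_inv_cancel_left₀ hb]
    ring

/-- A solution of a three term difference equation, holomorphic in a half plane, extends to an
entire solution. -/
theorem exists_entire_extension {ħ : ℝ} (hħ : 0 < ħ) {t : ℂ → ℂ} (ht : Differentiable ℂ t)
    {a b : ℂ} (hb : b ≠ 0) {c : ℝ} {f : ℂ → ℂ}
    (hf : ∀ x : ℂ, c < x.im → DifferentiableAt ℂ f x)
    (hB : ∀ x : ℂ, c + ħ < x.im → t x * f x = a * f (x + I * ħ) + b * f (x - I * ħ)) :
    ∃ F : ℂ → ℂ, Differentiable ℂ F ∧ (∀ x : ℂ, c < x.im → F x = f x) ∧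
      ∀ x : ℂ, t x * F x = a * F (x + I * ħ) + b * F (x - I * ħ) := by
  set G : ℕ → ℂ → ℂ := fun n => (extendStep ħ t a b)^[n] f with hG
  have hsucc : ∀ n, G (n + 1) = extendStep ħ t a b (G n) := fun n =>
    Function.iterate_succ_apply' _ _ _
  have key : ∀ n : ℕ, (∀ x : ℂ, c - n * ħ < x.im → DifferentiableAt ℂ (G n) x) ∧
      ∀ x : ℂ, c - n * ħ + ħ < x.im →
        t x * G n x = a * G n (x + I * ħ) + b * G n (x - I * ħ) := by
    intro n
    induction n with
    | zero => simpa [hG] using ⟨hf, hB⟩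
    | succ n ih =>
      obtain ⟨-, h2, h3⟩ := extendStep_spec hħ ht hb ih.1 ih.2
      rw [hsucc]
      push_cast
      exact ⟨fun x hx => h2 x (by linarith), fun x hx => h3 x (by linarith)⟩
  have hstep : ∀ n : ℕ, ∀ x : ℂ, c - n * ħ < x.im → G (n + 1) x = G n x := fun n x hx => by
    rw [hsucc]
    exact (extendStep_spec hħ ht hb (key n).1 (key n).2).1 x hx
  have hmono : ∀ m n : ℕ, m ≤ n → ∀ x : ℂ, c - m * ħ < x.im → G n x = G m x := by
    intro m n hmn x hx
    induction n, hmn using Nat.le_induction with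
    | base => rfl
    | succ n hmn ih =>
      rw [hstep n x, ih]
      have : (m : ℝ) * ħ ≤ n * ħ := mul_le_mul_of_nonneg_right (by exact_mod_cast hmn) hħ.le
      linarith
  have hex : ∀ x : ℂ, ∃ n : ℕ, c - n * ħ < x.im := fun x => by
    obtain ⟨n, hn⟩ := exists_nat_gt ((c - x.im) / ħ)
    exact ⟨n, by rw [div_lt_iff₀ hħ] at hn; linarith⟩
  -- Successive continuations agree where both are defined, so the number of steps may depend on the
  -- point.
  choose ν hν using hex
  have hF : ∀ n : ℕ, ∀ x : ℂ, c - n * ħ < x.im → G (ν x) x = G n x := fun n x hx => by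
    rcases le_total n (ν x) with h | h
    · exact hmono _ _ h x hx
    · exact (hmono _ _ h x (hν x)).symm
  refine ⟨fun x => G (ν x) x, fun x => ?_, fun x hx => ?_, fun x => ?_⟩
  · refine ((key (ν x)).1 x (hν x)).congr_of_eventuallyEq ?_
    filter_upwards [(isOpen_lt continuous_const Complex.continuous_im).mem_nhds (hν x)] with y hy
    exact hF _ y hy
  · simpa [hG] using hF 0 x (by simpa using hx)
  · obtain ⟨-, -, -, -, i5, i6⟩ := im_shift x ħ
    have hx := hν x
    have h1 := (key (ν x + 1)).2 x (by push_cast; linarith)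
    simp only
    rw [hF (ν x + 1) x (by push_cast; linarith), hF (ν x + 1) (x + I * ħ) (by push_cast; linarith),
      hF (ν x + 1) (x - I * ħ) (by push_cast; linarith), h1]

/-! ### Elementary factors of Q^± and their first order shift relations -/

section GammaFactors

variable {N : ℕ} {ħ : ℝ} {δ : Fin N → ℂ} {Λ : ℝ}

/-- The elementary factor of `Q⁺`. -/
def gammaUp (ħ : ℝ) (δ : Fin N → ℂ) (Λ : ℝ) (x : ℂ) : ℂ :=
  ((ħ / Λ : ℝ) : ℂ) ^ (I * N * x / ħ) * exp (-(N * Real.pi * x / ħ)) *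
    ∏ k, (Complex.Gamma (1 - I * (x - δ k) / ħ))⁻¹

/-- The elementary factor of `Q⁻`. -/
def gammaDown (ħ : ℝ) (δ : Fin N → ℂ) (Λ : ℝ) (x : ℂ) : ℂ :=
  ((Λ / ħ : ℝ) : ℂ) ^ (I * N * x / ħ) * exp (-(N * Real.pi * x / ħ)) *
    ∏ k, (Complex.Gamma (1 + I * (x - δ k) / ħ))⁻¹

theorem differentiable_gammaUp (hħ : 0 < ħ) (hΛ : 0 < Λ) :
    Differentiable ℂ (gammaUp ħ δ Λ) := by
  have hc : ((ħ / Λ : ℝ) : ℂ) ≠ 0 := by exact_mod_cast (div_pos hħ hΛ).ne'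
  refine Differentiable.mul (Differentiable.mul (fun x => ?_) (by fun_prop)) ?_
  · exact DifferentiableAt.const_cpow (by fun_prop) (Or.inl hc)
  · refine Differentiable.fun_finsetProd fun k _ => ?_
    exact differentiable_one_div_Gamma.comp (f := fun x : ℂ => 1 - I * (x - δ k) / ħ) (by fun_prop)

theorem differentiable_gammaDown (hħ : 0 < ħ) (hΛ : 0 < Λ) :
    Differentiable ℂ (gammaDown ħ δ Λ) := by
  have hc : ((Λ / ħ : ℝ) : ℂ) ≠ 0 := by exact_mod_cast (div_pos hΛ hħ).ne'
  refine Differentiable.mul (Differentiable.mul (fun x => ?_) (by fun_prop)) ?_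
  · exact DifferentiableAt.const_cpow (by fun_prop) (Or.inl hc)
  · refine Differentiable.fun_finsetProd fun k _ => ?_
    exact differentiable_one_div_Gamma.comp (f := fun x : ℂ => 1 + I * (x - δ k) / ħ) (by fun_prop)

theorem exponential_shift {c : ℂ} (hc : c ≠ 0) (hħ : ħ ≠ 0) (x : ℂ) :
    c ^ (I * N * (x + I * ħ) / ħ) * exp (-(N * Real.pi * (x + I * ħ) / ħ)) =
      (-1) ^ N * (c ^ N)⁻¹ * (c ^ (I * N * x / ħ) * exp (-(N * Real.pi * x / ħ))) := by
  have hħc : (ħ : ℂ) ≠ 0 := by exact_mod_cast hħ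
  have e1 : I * N * (x + I * ħ) / ħ = I * N * x / ħ - N := by
    field_simp
    linear_combination (N : ℂ) * ħ * I_sq
  have e2 : -(N * Real.pi * (x + I * ħ) / ħ) = -(N * Real.pi * x / ħ) - N * (Real.pi * I) := by
    field_simp
    ring
  rw [e1, e2, Complex.cpow_sub _ _ hc, Complex.cpow_natCast, Complex.exp_sub, Complex.exp_nat_mul,
    Complex.exp_pi_mul_I]
  have : ((-1 : ℂ) ^ N)⁻¹ = (-1) ^ N := by rw [← inv_pow]; norm_num
  generalize c ^ (I * N * x / ħ) = p
  generalize exp (-(N * Real.pi * x / ħ)) = q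
  rw [div_eq_mul_inv, div_eq_mul_inv, this]
  ring

/-- The functional equation of Γ produces one linear factor of ϑ for each k; the exponential
prefactor supplies Λ^N and the powers of i. -/
theorem gammaUp_shift (hħ : 0 < ħ) (hΛ : 0 < Λ) (x : ℂ) :
    (Λ : ℂ) ^ N * (I ^ N)⁻¹ * gammaUp ħ δ Λ x =
      vartheta δ (x + I * ħ) * gammaUp ħ δ Λ (x + I * ħ) := by
  have hħc : (ħ : ℂ) ≠ 0 := by exact_mod_cast hħ.ne'
  have hΛc : (Λ : ℂ) ≠ 0 := by exact_mod_cast hΛ.ne'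
  have hc : ((ħ / Λ : ℝ) : ℂ) ≠ 0 := by exact_mod_cast (div_pos hħ hΛ).ne'
  have hprod : ∏ k, (Complex.Gamma (1 - I * (x - δ k) / ħ))⁻¹ =
      ((-I / ħ) ^ N * vartheta δ (x + I * ħ)) *
        ∏ k, (Complex.Gamma (1 - I * (x + I * ħ - δ k) / ħ))⁻¹ := by
    have : (-I / ħ : ℂ) ^ N = ∏ _k : Fin N, (-I / ħ : ℂ) := by
      rw [Finset.prod_const, Finset.card_univ, Fintype.card_fin]
    rw [vartheta, this, ← Finset.prod_mul_distrib, ← Finset.prod_mul_distrib]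
    refine Finset.prod_congr rfl fun k _ => ?_
    rw [one_div_Gamma_eq_self_mul_one_div_Gamma_add_one]
    congr 1
    · field_simp
      linear_combination (ħ : ℂ) * I_sq
    · congr 2
      field_simp
      linear_combination (ħ : ℂ) * I_sq
  rw [gammaUp, gammaUp, exponential_shift hc hħ.ne', hprod]
  generalize (((ħ / Λ : ℝ) : ℂ) ^ (I * N * x / ħ) * exp (-(N * Real.pi * x / ħ))) = e
  generalize ∏ k, (Complex.Gamma (1 - I * (x + I * ħ - δ k) / ħ))⁻¹ = g
  rw [show (-I / ħ : ℂ) = I⁻¹ / ħ * 1 by rw [inv_I]; ring]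
  push_cast
  have h1 : (Λ : ℂ) ^ N * (I ^ N)⁻¹ * (I⁻¹ / ħ * 1) ^ N = (-1) ^ N * ((ħ / Λ : ℂ) ^ N)⁻¹ := by
    rw [← inv_pow, ← inv_pow, ← mul_pow, ← mul_pow, ← mul_pow]
    congr 1
    rw [inv_I]
    field_simp
    linear_combination I_sq
  linear_combination e * g * vartheta δ (x + I * ħ) * h1

theorem gammaDown_shift (hħ : 0 < ħ) (hΛ : 0 < Λ) (x : ℂ) :
    (Λ : ℂ) ^ N * I ^ N * gammaDown ħ δ Λ (x + I * ħ) = vartheta δ x * gammaDown ħ δ Λ x := by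
  have hħc : (ħ : ℂ) ≠ 0 := by exact_mod_cast hħ.ne'
  have hΛc : (Λ : ℂ) ≠ 0 := by exact_mod_cast hΛ.ne'
  have hc : ((Λ / ħ : ℝ) : ℂ) ≠ 0 := by exact_mod_cast (div_pos hΛ hħ).ne'
  have hprod : ∏ k, (Complex.Gamma (1 + I * (x + I * ħ - δ k) / ħ))⁻¹ =
      ((I / ħ) ^ N * vartheta δ x) * ∏ k, (Complex.Gamma (1 + I * (x - δ k) / ħ))⁻¹ := by
    have : (I / ħ : ℂ) ^ N = ∏ _k : Fin N, (I / ħ : ℂ) := by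
      rw [Finset.prod_const, Finset.card_univ, Fintype.card_fin]
    rw [vartheta, this, ← Finset.prod_mul_distrib, ← Finset.prod_mul_distrib]
    refine Finset.prod_congr rfl fun k _ => ?_
    rw [one_div_Gamma_eq_self_mul_one_div_Gamma_add_one]
    congr 1
    · field_simp
      linear_combination (ħ : ℂ) * I_sq
    · congr 2
      field_simp
      linear_combination (ħ : ℂ) * I_sq
  rw [gammaDown, gammaDown, exponential_shift hc hħ.ne', hprod]
  generalize (((Λ / ħ : ℝ) : ℂ) ^ (I * N * x / ħ) * exp (-(N * Real.pi * x / ħ))) = e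
  generalize ∏ k, (Complex.Gamma (1 + I * (x - δ k) / ħ))⁻¹ = g
  push_cast
  have h1 : (Λ : ℂ) ^ N * I ^ N * ((-1) ^ N * ((Λ / ħ : ℂ) ^ N)⁻¹) * (I / ħ) ^ N = 1 := by
    rw [← inv_pow, ← mul_pow, ← mul_pow, ← mul_pow, ← mul_pow]
    rw [show (Λ * I * (-1 * (Λ / ħ : ℂ)⁻¹) * (I / ħ) : ℂ) = 1 from ?_, one_pow]
    field_simp
    linear_combination -I_sq
  linear_combination e * g * vartheta δ x * h1

end GammaFactors

/-! ### Q^± in half planes and their entire continuations -/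

section QFunctions

variable {N : ℕ} {ħ : ℝ} {δ : Fin N → ℂ} {Λ : ℝ} {X : ℝ → ℂ} {ε : ℝ} {A B : ℂ → ℂ}

/-- The function `Q⁺` in terms of the factorization, for `Im x > -ħ/2 - ε`. -/
def QUp (ħ : ℝ) (δ : Fin N → ℂ) (Λ : ℝ) (A : ℂ → ℂ) (x : ℂ) : ℂ :=
  gammaUp ħ δ Λ x * exp (A (x + I * ħ / 2))

/-- The function `Q⁻` in terms of the factorization, for `Im x < ħ/2 + ε`. -/
def QDown (ħ : ℝ) (δ : Fin N → ℂ) (Λ : ℝ) (B : ℂ → ℂ) (x : ℂ) : ℂ :=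
  gammaDown ħ δ Λ x * exp (B (x - I * ħ / 2))

theorem pow_mul_I_pow_mul (N : ℕ) (Λ : ℝ) :
    ((Λ : ℂ) ^ N * I ^ N) * ((Λ : ℂ) ^ N * (I ^ N)⁻¹) = (Λ : ℂ) ^ (2 * N) := by
  have : (I : ℂ) ^ N ≠ 0 := pow_ne_zero _ I_ne_zero
  field_simp
  ring

/-- Together with `QUp_sub` this matches the two terms of the Baxter equation with the two summands
of the outer formula for t. The lower bound on Im x keeps ϑ(x+iħ) away from its zeros. -/
theorem IsFactorization.QUp_add (h : IsFactorization ħ δ Λ X ε A B) (hħ : 0 < ħ) (hΛ : 0 < Λ)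
    {x : ℂ} (hx : -(ħ / 2) < x.im) :
    (Λ : ℂ) ^ N * I ^ N * QUp ħ δ Λ A (x + I * ħ) = tailUp ħ δ Λ A x * QUp ħ δ Λ A x := by
  have hε := h.pos
  obtain ⟨i1, i2, i3, i4, i5, i6⟩ := im_shift x ħ
  have n : vartheta δ (x + I * ħ) ≠ 0 := vartheta_ne_zero fun k => ne_of_lt (by
    rw [i5]; linarith [(h.im_gap k).2])
  have h1 := gammaUp_shift (δ := δ) hħ hΛ x
  rw [QUp, QUp, tailUp, show x + I * ħ + I * ħ / 2 = x + 3 * (I * ħ / 2) by ring, Complex.exp_sub,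
    ← pow_mul_I_pow_mul N Λ]
  have m := Complex.exp_ne_zero (A (x + I * ħ / 2))
  generalize exp (A (x + I * ħ / 2)) = p at *
  generalize exp (A (x + 3 * (I * ħ / 2))) = q at *
  generalize (Λ : ℂ) ^ N * (I ^ N)⁻¹ = b at *
  generalize (Λ : ℂ) ^ N * I ^ N = a at *
  field_simp
  linear_combination -a * q * h1

theorem IsFactorization.QDown_sub (h : IsFactorization ħ δ Λ X ε A B) (hħ : 0 < ħ) (hΛ : 0 < Λ)
    {x : ℂ} (hx : x.im < ħ / 2) :
    (Λ : ℂ) ^ N * (I ^ N)⁻¹ * QDown ħ δ Λ B (x - I * ħ) =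
      tailDown ħ δ Λ B x * QDown ħ δ Λ B x := by
  have hε := h.pos
  obtain ⟨i1, i2, i3, i4, i5, i6⟩ := im_shift x ħ
  have n : vartheta δ (x - I * ħ) ≠ 0 := vartheta_ne_zero fun k => ne_of_gt (by
    rw [i6]; linarith [(h.im_gap k).1])
  have h1 := gammaDown_shift (δ := δ) hħ hΛ (x - I * ħ)
  rw [sub_add_cancel] at h1
  rw [QDown, QDown, tailDown, show x - I * ħ - I * ħ / 2 = x - 3 * (I * ħ / 2) by ring,
    Complex.exp_sub, ← pow_mul_I_pow_mul N Λ]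
  have m := Complex.exp_ne_zero (B (x - I * ħ / 2))
  generalize exp (B (x - I * ħ / 2)) = p at *
  generalize exp (B (x - 3 * (I * ħ / 2))) = q at *
  generalize (Λ : ℂ) ^ N * (I ^ N)⁻¹ = b at *
  generalize (Λ : ℂ) ^ N * I ^ N = a at *
  field_simp
  linear_combination -b * q * h1

theorem QUp_sub (hħ : 0 < ħ) (hΛ : 0 < Λ) (x : ℂ) :
    (Λ : ℂ) ^ N * (I ^ N)⁻¹ * QUp ħ δ Λ A (x - I * ħ) =
      vartheta δ x * exp (A (x - I * ħ / 2) - A (x + I * ħ / 2)) * QUp ħ δ Λ A x := by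
  have h1 := gammaUp_shift (δ := δ) hħ hΛ (x - I * ħ)
  rw [sub_add_cancel] at h1
  rw [QUp, QUp, show x - I * ħ + I * ħ / 2 = x - I * ħ / 2 by ring, Complex.exp_sub]
  have m := Complex.exp_ne_zero (A (x + I * ħ / 2))
  generalize exp (A (x + I * ħ / 2)) = p at *
  generalize exp (A (x - I * ħ / 2)) = q at *
  field_simp at h1 ⊢
  linear_combination q * h1

theorem QDown_add (hħ : 0 < ħ) (hΛ : 0 < Λ) (x : ℂ) :
    (Λ : ℂ) ^ N * I ^ N * QDown ħ δ Λ B (x + I * ħ) =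
      vartheta δ x * exp (B (x + I * ħ / 2) - B (x - I * ħ / 2)) * QDown ħ δ Λ B x := by
  have h1 := gammaDown_shift (δ := δ) hħ hΛ x
  rw [QDown, QDown, show x + I * ħ - I * ħ / 2 = x + I * ħ / 2 by ring, Complex.exp_sub]
  have m := Complex.exp_ne_zero (B (x - I * ħ / 2))
  generalize exp (B (x - I * ħ / 2)) = p at *
  generalize exp (B (x + I * ħ / 2)) = q at *
  field_simp
  linear_combination q * h1

theorem IsFactorization.QUp_eq (h : IsFactorization ħ δ Λ X ε A B) {x : ℂ}
    (hx : -(ħ / 2) < x.im) : QUp ħ δ Λ A x = QPlusFormula ħ δ Λ X x := by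
  obtain ⟨i1, -⟩ := im_shift x ħ
  rw [QUp, gammaUp, QPlusFormula, h.eq_up _ (by rw [i1]; linarith), add_sub_cancel_right,
    Finset.prod_inv_distrib]
  ring

theorem IsFactorization.QDown_eq (h : IsFactorization ħ δ Λ X ε A B) {x : ℂ}
    (hx : x.im < ħ / 2) : QDown ħ δ Λ B x = QMinusFormula ħ δ Λ X x := by
  obtain ⟨-, i2, -⟩ := im_shift x ħ
  rw [QDown, gammaDown, QMinusFormula, h.eq_down _ (by rw [i2]; linarith), sub_add_cancel,
    Finset.prod_inv_distrib]
  ring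

theorem IsFactorization.differentiableAt_QUp (h : IsFactorization ħ δ Λ X ε A B) (hħ : 0 < ħ)
    (hΛ : 0 < Λ) {x : ℂ} (hx : -(ħ / 2) - ε < x.im) : DifferentiableAt ℂ (QUp ħ δ Λ A) x :=
  (differentiable_gammaUp hħ hΛ x).mul
    (h.differentiableAt_up (I * ħ / 2) (by rw [(im_shift x ħ).1]; linarith)).cexp

theorem IsFactorization.differentiableAt_QDown (h : IsFactorization ħ δ Λ X ε A B) (hħ : 0 < ħ)
    (hΛ : 0 < Λ) {x : ℂ} (hx : x.im < ħ / 2 + ε) : DifferentiableAt ℂ (QDown ħ δ Λ B) x := by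
  have := h.differentiableAt_down (x := x) (-(I * ħ / 2)) (by
    rw [← sub_eq_add_neg, (im_shift x ħ).2.1]; linarith)
  simp only [← sub_eq_add_neg] at this
  exact (differentiable_gammaDown hħ hΛ x).mul this.cexp

/-- The entire solutions of the Baxter equation. -/
theorem IsFactorization.exists_entire (h : IsFactorization ħ δ Λ X ε A B) (hN : N ≠ 0) (hħ : 0 < ħ)
    (hΛ : 0 < Λ) {T : Polynomial ℂ}
    (hT1 : ∀ x : ℂ, ħ / 2 - ε < x.im → T.eval x =
        vartheta δ x * exp (A (x - I * ħ / 2) - A (x + I * ħ / 2)) + tailUp ħ δ Λ A x)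
    (hT3 : ∀ x : ℂ, x.im < -(ħ / 2 - ε) → T.eval x =
        vartheta δ x * exp (B (x + I * ħ / 2) - B (x - I * ħ / 2)) + tailDown ħ δ Λ B x) :
    ∃ Qp Qm : ℂ → ℂ, Differentiable ℂ Qp ∧ Differentiable ℂ Qm ∧
      (∀ x : ℂ, -(ħ / 2) < x.im → Qp x = QUp ħ δ Λ A x) ∧
      (∀ x : ℂ, x.im < ħ / 2 → Qm x = QDown ħ δ Λ B x) ∧
      IsBaxterSolution N ħ Λ T Qp ∧ IsBaxterSolution N ħ Λ T Qm := by
  have hε := h.pos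
  have hgap : ε ≤ ħ / 2 := by
    have := h.im_gap ⟨0, Nat.pos_of_ne_zero hN⟩
    linarith [this.1, this.2]
  have hΛc : (Λ : ℂ) ^ N ≠ 0 := pow_ne_zero _ (by exact_mod_cast hΛ.ne')
  have hI : (I : ℂ) ^ N ≠ 0 := pow_ne_zero _ I_ne_zero
  -- The bound is the edge -ħ/2 - ε of the domain of `QUp` raised by ħ, which is exactly the edge
  -- ħ/2 - ε of the outer formula for T.
  have hup : ∀ x : ℂ, -(ħ / 2) - ε + ħ < x.im → T.eval x * QUp ħ δ Λ A x =
      (Λ : ℂ) ^ N * I ^ N * QUp ħ δ Λ A (x + I * ħ) +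
        (Λ : ℂ) ^ N * (I ^ N)⁻¹ * QUp ħ δ Λ A (x - I * ħ) := by
    intro x hx
    rw [hT1 x (by linarith), add_mul, h.QUp_add hħ hΛ (by linarith), QUp_sub hħ hΛ, add_comm]
  -- The reflection x ↦ -x interchanges the two coefficients, so the same continuation result serves
  -- Q⁻.
  have hdown : ∀ x : ℂ, -(ħ / 2) - ε + ħ < x.im → T.eval (-x) * QDown ħ δ Λ B (-x) =
      (Λ : ℂ) ^ N * (I ^ N)⁻¹ * QDown ħ δ Λ B (-(x + I * ħ)) +
        (Λ : ℂ) ^ N * I ^ N * QDown ħ δ Λ B (-(x - I * ħ)) := by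
    intro x hx
    have him : (-x).im = -x.im := neg_im x
    rw [hT3 (-x) (by rw [him]; linarith), add_mul, neg_add', neg_sub', sub_neg_eq_add,
      h.QDown_sub hħ hΛ (by rw [him]; linarith), QDown_add hħ hΛ, add_comm]
  obtain ⟨F, hF1, hF2, hF3⟩ := exists_entire_extension hħ T.differentiable
    (mul_ne_zero hΛc (inv_ne_zero hI)) (fun x hx => h.differentiableAt_QUp hħ hΛ hx) hup
  obtain ⟨G, hG1, hG2, hG3⟩ := exists_entire_extension hħ
    (T.differentiable.comp differentiable_neg) (mul_ne_zero hΛc hI)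
    (f := fun x => QDown ħ δ Λ B (-x)) (c := -(ħ / 2) - ε)
    (fun x hx => (h.differentiableAt_QDown hħ hΛ (x := -x) (by
      rw [neg_im]; linarith)).comp x differentiable_neg.differentiableAt) hdown
  refine ⟨F, fun x => G (-x), hF1, hG1.comp differentiable_neg, fun x hx => hF2 x (by linarith),
    fun x hx => ?_, fun x => ?_, fun x => ?_⟩
  · have := hG2 (-x) (by rw [neg_im]; linarith)
    simpa using this
  · rw [hF3]
    ring
  · have := hG3 (-x)
    simp only [Function.comp, neg_neg] at this
    simp only
    rw [this, neg_add', neg_sub', sub_neg_eq_add]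
    ring

end QFunctions

/-! ### Floquet series with rapidly decaying coefficients -/

/-- The coefficients decay faster than any exponential. -/
def RapidDecay (c : ℤ → ℂ) : Prop :=
  ∀ R : ℝ, Summable fun n : ℤ => ‖c n‖ * Real.exp (R * |(n : ℝ)|)

section Series

variable {c : ℤ → ℂ} {s : ℂ}

theorem norm_exp_add_int_mul_le (s w : ℂ) {R : ℝ} (hw : ‖w‖ ≤ R) (n : ℤ) :
    ‖exp ((s + n) * w)‖ ≤ Real.exp (‖s‖ * R) * Real.exp (R * |(n : ℝ)|) := by
  rw [← Real.exp_add]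
  refine (Complex.norm_exp_le_exp_norm _).trans (Real.exp_le_exp.2 ?_)
  rw [norm_mul]
  have h1 : ‖s + (n : ℂ)‖ ≤ ‖s‖ + |(n : ℝ)| := by
    simpa using norm_add_le s (n : ℂ)
  calc _ ≤ (‖s‖ + |(n : ℝ)|) * R := mul_le_mul h1 hw (norm_nonneg _) (by positivity)
    _ = _ := by ring

theorem RapidDecay.norm_term_le (c : ℤ → ℂ) (s w : ℂ) {R : ℝ} (hw : ‖w‖ ≤ R) (n : ℤ) :
    ‖c n * exp ((s + n) * w)‖ ≤ Real.exp (‖s‖ * R) * (‖c n‖ * Real.exp (R * |(n : ℝ)|)) := by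
  rw [norm_mul]
  refine (mul_le_mul_of_nonneg_left (norm_exp_add_int_mul_le s w hw n) (norm_nonneg _)).trans
    (le_of_eq (by ring))

theorem RapidDecay.summable (hc : RapidDecay c) (s w : ℂ) :
    Summable fun n : ℤ => c n * exp ((s + n) * w) :=
  Summable.of_norm_bounded ((hc ‖w‖).mul_left _) fun n => norm_term_le c s w le_rfl n

theorem RapidDecay.mul_add (hc : RapidDecay c) (s : ℂ) : RapidDecay fun n => c n * (s + n) := by
  intro R
  refine Summable.of_nonneg_of_le (fun n => by positivity) (fun n => ?_)
    ((hc (R + 1)).mul_left (Real.exp ‖s‖))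
  have h1 : ‖s + (n : ℂ)‖ ≤ ‖s‖ + |(n : ℝ)| := by
    simpa using norm_add_le s (n : ℂ)
  have h2 : ‖s + (n : ℂ)‖ ≤ Real.exp ‖s‖ * Real.exp |(n : ℝ)| := by
    rw [← Real.exp_add]
    linarith [Real.add_one_le_exp (‖s‖ + |(n : ℝ)|)]
  rw [norm_mul, add_mul, one_mul, Real.exp_add]
  calc _ ≤ ‖c n‖ * (Real.exp ‖s‖ * Real.exp |(n : ℝ)|) * Real.exp (R * |(n : ℝ)|) := by gcongr
    _ = _ := by ring

theorem RapidDecay.mul_pow (hc : RapidDecay c) (s : ℂ) (k : ℕ) :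
    RapidDecay fun n => c n * (s + n) ^ k := by
  induction k with
  | zero => simpa using hc
  | succ k ih =>
    convert ih.mul_add s using 2 with n
    ring

theorem RapidDecay.hasDerivAt (hc : RapidDecay c) (s w : ℂ) :
    HasDerivAt (fun w => ∑' n : ℤ, c n * exp ((s + n) * w))
      (∑' n : ℤ, c n * (s + n) * exp ((s + n) * w)) w := by
  set R := ‖w‖ + 1
  refine hasDerivAt_tsum_of_isPreconnected (t := Metric.ball 0 R)
    (g := fun (n : ℤ) w => c n * exp ((s + n) * w))
    (g' := fun (n : ℤ) w => c n * (s + n) * exp ((s + n) * w))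
    ((hc.mul_add s R).mul_left (Real.exp (‖s‖ * R))) Metric.isOpen_ball
    (convex_ball _ _).isPreconnected (fun n y _ => ?_) (fun n y hy => ?_) (y₀ := w) (by simp [R])
    (hc.summable s w) (by simp [R])
  · refine ((((hasDerivAt_id y).const_mul (s + n : ℂ)).cexp).const_mul (c n)).congr_deriv ?_
    simp only [id]
    ring
  · exact norm_term_le (fun n => c n * (s + n)) s y (mem_ball_zero_iff.1 hy).le n

theorem RapidDecay.iteratedDeriv_eq (hc : RapidDecay c) (s : ℂ) (k : ℕ) :
    iteratedDeriv k (fun w => ∑' n : ℤ, c n * exp ((s + n) * w)) =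
      fun w => ∑' n : ℤ, c n * (s + n) ^ k * exp ((s + n) * w) := by
  induction k with
  | zero => simp
  | succ k ih =>
    rw [iteratedDeriv_succ, ih]
    ext w
    rw [((hc.mul_pow s k).hasDerivAt s w).deriv]
    refine tsum_congr fun n => ?_
    ring

theorem RapidDecay.tsum_shift (c : ℤ → ℂ) (s w : ℂ) :
    (∑' n : ℤ, c (n - 1) * exp ((s + n) * w) = exp w * ∑' n : ℤ, c n * exp ((s + n) * w)) ∧
    ∑' n : ℤ, c (n + 1) * exp ((s + n) * w) =
      exp (-w) * ∑' n : ℤ, c n * exp ((s + n) * w) := by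
  constructor
  · rw [← tsum_mul_left, ← (Equiv.addRight (1 : ℤ)).tsum_eq]
    refine tsum_congr fun n => ?_
    simp only [Equiv.coe_addRight, add_sub_cancel_right]
    rw [mul_left_comm, ← Complex.exp_add]
    congr 2
    push_cast
    ring
  · rw [← tsum_mul_left, ← (Equiv.subRight (1 : ℤ)).tsum_eq]
    refine tsum_congr fun n => ?_
    simp only [Equiv.subRight_apply, sub_add_cancel]
    rw [mul_left_comm, ← Complex.exp_add]
    congr 2
    push_cast
    ring

theorem RapidDecay.add_two_pi_I (c : ℤ → ℂ) (s w : ℂ) :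
    ∑' n : ℤ, c n * exp ((s + n) * (w + 2 * Real.pi * I)) =
      exp (s * (2 * Real.pi * I)) * ∑' n : ℤ, c n * exp ((s + n) * w) := by
  rw [← tsum_mul_left]
  refine tsum_congr fun n => ?_
  have : (s + n) * (w + 2 * Real.pi * I) =
      s * (2 * Real.pi * I) + (s + n) * w + n * (2 * Real.pi * I) := by ring
  rw [this, Complex.exp_add, Complex.exp_add, Complex.exp_int_mul_two_pi_mul_I]
  ring

theorem integral_exp_int_mul (n : ℤ) :
    ∫ θ in (0 : ℝ)..2 * Real.pi, exp (n * (θ * I)) =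
      (if n = 0 then 2 * Real.pi else 0 : ℂ) := by
  split_ifs with h
  · simp [h]
  · have hn : (n : ℂ) * I ≠ 0 := mul_ne_zero (by exact_mod_cast h) I_ne_zero
    have := integral_exp_mul_complex (a := 0) (b := 2 * Real.pi) hn
    rw [show (fun θ : ℝ => exp (n * (θ * I))) = fun θ : ℝ => exp (n * I * θ) by
      ext θ; congr 1; ring, this]
    rw [show (n : ℂ) * I * ((2 * Real.pi : ℝ) : ℂ) = n * (2 * Real.pi * I) by push_cast; ring,
      Complex.exp_int_mul_two_pi_mul_I]
    simp

/-- On w = iθ, after removal of the factor e^{sw}, the series is a Fourier series. Integration over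
a period isolates c 0. -/
theorem RapidDecay.ne_zero (hc : RapidDecay c) (s : ℂ) (h0 : c 0 ≠ 0) :
    (fun w => ∑' n : ℤ, c n * exp ((s + n) * w)) ≠ 0 := by
  intro hzero
  have hsum := intervalIntegral.hasSum_intervalIntegral_of_summable_norm (a := 0) (b := 2 * Real.pi)
    (f := fun n : ℤ => (⟨fun θ : ℝ => c n * exp (n * (θ * I)), by fun_prop⟩ : C(ℝ, ℂ))) ?_
  · have h1 : ∀ θ : ℝ, ∑' n : ℤ, c n * exp (n * (θ * I)) = 0 := fun θ => by
      have := congrFun hzero (θ * I)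
      simp only [add_mul, Complex.exp_add, mul_left_comm (c _), tsum_mul_left] at this
      simpa using this
    simp only [ContinuousMap.coe_mk, intervalIntegral.integral_const_mul, integral_exp_int_mul,
      h1, intervalIntegral.integral_zero] at hsum
    have h2 : HasSum (fun n : ℤ => c n * if n = 0 then (2 * Real.pi : ℂ) else 0)
        (c 0 * if (0 : ℤ) = 0 then (2 * Real.pi : ℂ) else 0) :=
      hasSum_single 0 fun n hn => by simp [hn]
    have h3 := hsum.unique h2
    simp [h0, Real.pi_ne_zero] at h3
  · refine Summable.of_nonneg_of_le (fun _ => norm_nonneg _) (fun n => ?_) (hc 0)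
    rw [zero_mul, Real.exp_zero, mul_one, ContinuousMap.norm_le _ (norm_nonneg _)]
    intro θ
    have : (n : ℂ) * ((θ : ℝ) * I) = ((n * θ : ℝ) : ℂ) * I := by push_cast; ring
    simp only [ContinuousMap.restrict_apply, ContinuousMap.coe_mk, norm_mul]
    rw [this, Complex.norm_exp_ofReal_mul_I, mul_one]

end Series

/-! ### Floquet series of Baxter solutions and their independence -/

section Floquet

variable {N : ℕ} {ħ Λ : ℝ} {t : Polynomial ℂ} {Q : ℂ → ℂ} {d : ℂ}

theorem floquet_eq (ħ : ℝ) (Q : ℂ → ℂ) (d : ℂ) :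
    floquet ħ Q d = fun w => ∑' n : ℤ, Q (d - I * ħ * n) * exp ((I * d / ħ + n) * w) := rfl

/-- Floquet series of solutions of the Baxter equation solve the oper equation. -/
theorem isOperSolution_floquet (hħ : 0 < ħ) (hQ : IsBaxterSolution N ħ Λ t Q)
    (hc : RapidDecay fun n => Q (d - I * ħ * n)) :
    IsOperSolution N ħ Λ t (floquet ħ Q d) := by
  have hħc : (ħ : ℂ) ≠ 0 := by exact_mod_cast hħ.ne'
  set c : ℤ → ℂ := fun n => Q (d - I * ħ * n) with hcdef
  set s : ℂ := I * d / ħ with hs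
  -- The lattice point is the eigenvalue of -iħ∂_w on the n-th term, so t(-iħ∂_w) multiplies that
  -- term by t at the lattice point.
  have hx : ∀ n : ℤ, d - I * ħ * n = -(I * ħ) * (s + n) := fun n => by
    rw [hs]
    field_simp
    linear_combination d * I_sq
  have hB : ∀ n : ℤ, t.eval (-(I * ħ) * (s + n)) * c n =
      (Λ : ℂ) ^ N * (I ^ N * c (n - 1) + (I ^ N)⁻¹ * c (n + 1)) := fun n => by
    rw [← hx, hcdef]
    simp only
    rw [hQ, show d - I * ħ * n + I * ħ = d - I * ħ * ((n - 1 : ℤ) : ℂ) by push_cast; ring,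
      show d - I * ħ * n - I * ħ = d - I * ħ * ((n + 1 : ℤ) : ℂ) by push_cast; ring]
  refine ⟨fun w => (hc.hasDerivAt s w).differentiableAt, fun w => ?_⟩
  rw [floquet_eq]
  change ∑ k ∈ Finset.range (t.natDegree + 1), t.coeff k * (-(I * ħ)) ^ k *
    iteratedDeriv k (fun w => ∑' n : ℤ, c n * exp ((s + n) * w)) w = _ *
    ∑' n : ℤ, c n * exp ((s + n) * w)
  have hsum : ∀ k ∈ Finset.range (t.natDegree + 1), Summable fun n : ℤ =>
      t.coeff k * (-(I * ħ)) ^ k * (c n * (s + n) ^ k * exp ((s + n) * w)) :=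
    fun k _ => ((hc.mul_pow s k).summable s w).mul_left _
  simp only [hc.iteratedDeriv_eq s, ← tsum_mul_left]
  rw [← Summable.tsum_finsetSum hsum]
  have hterm : ∀ n : ℤ, ∑ k ∈ Finset.range (t.natDegree + 1),
      t.coeff k * (-(I * ħ)) ^ k * (c n * (s + n) ^ k * exp ((s + n) * w)) =
      (Λ : ℂ) ^ N * I ^ N * (c (n - 1) * exp ((s + n) * w)) +
        (Λ : ℂ) ^ N * (I ^ N)⁻¹ * (c (n + 1) * exp ((s + n) * w)) := fun n => by
    have := hB n
    rw [Polynomial.eval_eq_sum_range, Finset.sum_mul] at this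
    calc _ = (∑ k ∈ Finset.range (t.natDegree + 1),
          t.coeff k * (-(I * ħ) * (s + n)) ^ k * c n) * exp ((s + n) * w) := by
          rw [Finset.sum_mul]
          refine Finset.sum_congr rfl fun k _ => ?_
          rw [_root_.mul_pow]
          ring
      _ = _ := by rw [this]; ring
  obtain ⟨e1, e2⟩ := RapidDecay.tsum_shift c s w
  have s0 := hc.summable s w
  have s1 : Summable fun n : ℤ => c (n - 1) * exp ((s + n) * w) := by
    refine (Equiv.addRight (1 : ℤ)).summable_iff.1 ((s0.mul_left (exp w)).congr fun n => ?_)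
    simp only [Function.comp, Equiv.coe_addRight, add_sub_cancel_right]
    rw [mul_left_comm, ← Complex.exp_add]
    congr 2
    push_cast
    ring
  have s2 : Summable fun n : ℤ => c (n + 1) * exp ((s + n) * w) := by
    refine (Equiv.subRight (1 : ℤ)).summable_iff.1 ((s0.mul_left (exp (-w))).congr fun n => ?_)
    simp only [Function.comp, Equiv.subRight_apply, sub_add_cancel]
    rw [mul_left_comm, ← Complex.exp_add]
    congr 2
    push_cast
    ring
  rw [tsum_congr hterm, (s1.mul_left _).tsum_add (s2.mul_left _), tsum_mul_left, tsum_mul_left, e1,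
    e2, tsum_mul_left]
  ring

/-- Equal multipliers would force δ_j - δ_k = -iħn with n an integer, and the strip condition leaves
only n = 0. -/
theorem exp_floquet_exponent_injective (hħ : 0 < ħ) {δ : Fin N → ℂ} (hδ : δ ∈ strip N ħ)
    (hinj : Function.Injective δ) :
    Function.Injective fun j => exp (I * δ j / ħ * (2 * Real.pi * I)) := by
  intro j k hjk
  have hħc : (ħ : ℂ) ≠ 0 := by exact_mod_cast hħ.ne'
  obtain ⟨n, hn⟩ := Complex.exp_eq_exp_iff_exists_int.1 hjk
  have hπ : (2 * Real.pi * I : ℂ) ≠ 0 := Complex.two_pi_I_ne_zero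
  rw [← add_mul] at hn
  have h1 := mul_right_cancel₀ hπ hn
  have h2 : δ j - δ k = -(I * (ħ * n : ℝ)) := by
    field_simp at h1
    push_cast
    linear_combination (-I) * h1 + (δ j - δ k) * I_sq
  have h3 := congrArg Complex.im h2
  simp only [Complex.sub_im, Complex.neg_im, Complex.I_mul_im, Complex.ofReal_re] at h3
  have hj := abs_lt.1 (hδ j)
  have hk := abs_lt.1 (hδ k)
  have h4 : ħ * (n : ℝ) < ħ * 1 := by linarith
  have h5 : ħ * (-1 : ℝ) < ħ * n := by linarith
  have h6 : (n : ℝ) < 1 := lt_of_mul_lt_mul_left h4 hħ.le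
  have h7 : (-1 : ℝ) < n := lt_of_mul_lt_mul_left h5 hħ.le
  have h8 : n = 0 := by
    have : n < 1 := by exact_mod_cast h6
    have : -1 < n := by exact_mod_cast h7
    omega
  refine hinj (sub_eq_zero.1 ?_)
  rw [h2, h8]
  simp

/-- Floquet series with different exponents are linearly independent. -/
theorem linearIndependent_floquet (hħ : 0 < ħ) {δ : Fin N → ℂ} (hδ : δ ∈ strip N ħ)
    (hinj : Function.Injective δ) (hc : ∀ j, RapidDecay fun n => Q (δ j - I * ħ * n))
    (h0 : ∀ j, Q (δ j) ≠ 0) : LinearIndependent ℂ fun j => floquet ħ Q (δ j) := by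
  -- The Floquet series are eigenvectors of the monodromy w ↦ w + 2πi with distinct eigenvalues.
  refine Module.End.eigenvectors_linearIndependent'
    (LinearMap.funLeft ℂ ℂ fun w : ℂ => w + 2 * Real.pi * I)
    (fun j => exp (I * δ j / ħ * (2 * Real.pi * I)))
    (exp_floquet_exponent_injective hħ hδ hinj) _ fun j => ?_
  refine ⟨Module.End.mem_eigenspace_iff.2 ?_, ?_⟩
  · ext w
    exact RapidDecay.add_two_pi_I _ _ _
  · exact (hc j).ne_zero _ (by simpa using h0 j)

end Floquet

/-! ### The connection coefficients -/

theorem summable_norm_mul_exp_of_ratio {f τ : ℕ → ℂ} {a : ℂ} (ha : a ≠ 0)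
    (hf : ∀ n, a * f (n + 1) = τ n * f n) (hτ : Tendsto τ atTop (𝓝 0)) (R : ℝ) :
    Summable fun n : ℕ => ‖f n‖ * Real.exp (R * n) := by
  have h0 : Tendsto (fun n => ‖τ n‖ / ‖a‖ * Real.exp R) atTop (𝓝 0) := by
    have := (hτ.norm.div_const ‖a‖).mul_const (Real.exp R)
    simpa using this
  refine summable_of_ratio_norm_eventually_le (r := 1 / 2) (by norm_num) ?_
  filter_upwards [h0.eventually_le_const (show (0 : ℝ) < 1 / 2 by norm_num)] with n hn
  have ha' : 0 < ‖a‖ := norm_pos_iff.2 ha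
  have h1 : ‖f (n + 1)‖ = ‖τ n‖ / ‖a‖ * ‖f n‖ := by
    have := congrArg norm (hf n)
    rw [norm_mul, norm_mul] at this
    field_simp
    linarith
  rw [Real.norm_of_nonneg (by positivity), Real.norm_of_nonneg (by positivity), h1, Nat.cast_add,
    Nat.cast_one, mul_add, mul_one, Real.exp_add]
  calc _ = (‖τ n‖ / ‖a‖ * Real.exp R) * (‖f n‖ * Real.exp (R * n)) := by ring
    _ ≤ _ := mul_le_mul_of_nonneg_right hn (by positivity)

section Connection

variable {N : ℕ} {ħ : ℝ} {δ : Fin N → ℂ} {Λ : ℝ} {X : ℝ → ℂ} {ε : ℝ} {A B : ℂ → ℂ}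

theorem tendsto_pow_inv_atTop (hN : N ≠ 0) (hħ : 0 < ħ) (K : ℝ) :
    Tendsto (fun n : ℕ => K * (((n + 1 : ℕ) : ℝ) * ħ)⁻¹ ^ N) atTop (𝓝 0) := by
  have h1 : Tendsto (fun n : ℕ => (((n + 1 : ℕ) : ℝ) * ħ)) atTop atTop :=
    ((tendsto_natCast_atTop_atTop (R := ℝ)).comp (tendsto_add_atTop_nat 1)).atTop_mul_const hħ
  have := ((tendsto_inv_atTop_zero.comp h1).pow N).const_mul K
  simpa [hN, Function.comp_def] using this

theorem IsFactorization.tendsto_tailUp_nat (h : IsFactorization ħ δ Λ X ε A B) (hN : N ≠ 0)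
    (hħ : 0 < ħ) {d : ℂ} (hd : -(ħ / 2) < d.im) :
    Tendsto (fun n : ℕ => tailUp ħ δ Λ A (d + I * ħ * ((n + 1 : ℕ) : ℂ))) atTop (𝓝 0) := by
  obtain ⟨M, hA, -⟩ := h.bound
  have hε := h.pos
  refine squeeze_zero_norm (fun n => ?_)
    (tendsto_pow_inv_atTop hN hħ (‖(Λ : ℂ) ^ (2 * N)‖ * Real.exp (2 * M)))
  set x : ℂ := d + I * ħ * ((n + 1 : ℕ) : ℂ) with hxd
  have hx : x.im = d.im + ((n + 1 : ℕ) : ℝ) * ħ := by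
    rw [hxd, mul_assoc, Complex.add_im, Complex.I_mul_im,
      ← Complex.ofReal_natCast, ← Complex.ofReal_mul, Complex.ofReal_re, mul_comm]
  have hn : 0 < ((n + 1 : ℕ) : ℝ) * ħ := by positivity
  obtain ⟨i1, -, i3, -, i5, -⟩ := im_shift x ħ
  rw [tailUp, div_eq_mul_inv, norm_mul, norm_mul, mul_assoc, mul_assoc]
  refine mul_le_mul_of_nonneg_left (mul_le_mul (norm_exp_sub_le (hA _ (by rw [i3]; linarith))
    (hA _ (by rw [i1]; linarith))) (norm_vartheta_inv_le hn fun k => ?_)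
    (norm_nonneg _) (Real.exp_nonneg _)) (norm_nonneg _)
  refine le_trans ?_ (le_abs_self _)
  rw [i5]
  linarith [(h.im_gap k).2]

theorem IsFactorization.tendsto_tailDown_nat (h : IsFactorization ħ δ Λ X ε A B) (hN : N ≠ 0)
    (hħ : 0 < ħ) {d : ℂ} (hd : d.im < ħ / 2) :
    Tendsto (fun n : ℕ => tailDown ħ δ Λ B (d - I * ħ * ((n + 1 : ℕ) : ℂ))) atTop (𝓝 0) := by
  obtain ⟨M, -, hB⟩ := h.bound
  have hε := h.pos
  refine squeeze_zero_norm (fun n => ?_)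
    (tendsto_pow_inv_atTop hN hħ (‖(Λ : ℂ) ^ (2 * N)‖ * Real.exp (2 * M)))
  set x : ℂ := d - I * ħ * ((n + 1 : ℕ) : ℂ) with hxd
  have hx : x.im = d.im - ((n + 1 : ℕ) : ℝ) * ħ := by
    rw [hxd, mul_assoc, Complex.sub_im, Complex.I_mul_im,
      ← Complex.ofReal_natCast, ← Complex.ofReal_mul, Complex.ofReal_re, mul_comm]
  have hn : 0 < ((n + 1 : ℕ) : ℝ) * ħ := by positivity
  obtain ⟨-, i2, -, i4, -, i6⟩ := im_shift x ħ
  rw [tailDown, div_eq_mul_inv, norm_mul, norm_mul, mul_assoc, mul_assoc]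
  refine mul_le_mul_of_nonneg_left (mul_le_mul (norm_exp_sub_le (hB _ (by rw [i4]; linarith))
    (hB _ (by rw [i2]; linarith))) (norm_vartheta_inv_le hn fun k => ?_)
    (norm_nonneg _) (Real.exp_nonneg _)) (norm_nonneg _)
  refine le_trans ?_ (neg_le_abs _)
  rw [i6]
  linarith [(h.im_gap k).1]

/-- The coefficients of the Floquet series decay rapidly. -/
theorem IsFactorization.rapidDecay (h : IsFactorization ħ δ Λ X ε A B) (hN : N ≠ 0) (hħ : 0 < ħ)
    (hΛ : 0 < Λ) {Q₁ Q₂ : ℂ → ℂ} {d r : ℂ} (hd : |d.im| < ħ / 2)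
    (h1 : ∀ x : ℂ, -(ħ / 2) < x.im → Q₁ x = QUp ħ δ Λ A x)
    (h2 : ∀ x : ℂ, x.im < ħ / 2 → Q₂ x = QDown ħ δ Λ B x)
    (h12 : ∀ n : ℤ, Q₁ (d - I * ħ * n) = r * Q₂ (d - I * ħ * n)) :
    RapidDecay fun n => Q₁ (d - I * ħ * n) := by
  intro R
  have hΛc : (Λ : ℂ) ^ N ≠ 0 := pow_ne_zero _ (by exact_mod_cast hΛ.ne')
  have hI : (I : ℂ) ^ N ≠ 0 := pow_ne_zero _ I_ne_zero
  have hd' := abs_lt.1 hd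
  have him : ∀ n : ℕ, (d + I * ħ * n).im = d.im + n * ħ ∧ (d - I * ħ * n).im = d.im - n * ħ := by
    intro n
    rw [mul_assoc, Complex.add_im, Complex.sub_im, Complex.I_mul_im,
      ← Complex.ofReal_natCast, ← Complex.ofReal_mul, Complex.ofReal_re, mul_comm]
    exact ⟨rfl, rfl⟩
  have hnn : ∀ n : ℕ, 0 ≤ (n : ℝ) * ħ := fun n => by positivity
  -- Towards n → +∞ the points move down, where Q₂ satisfies a first order recursion with ratio
  -- tending to 0; towards n → -∞ the same holds for Q₁. Proportionality combines the two halves.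
  refine Summable.of_nat_of_neg ?_ ?_
  · have := summable_norm_mul_exp_of_ratio (f := fun n : ℕ => Q₂ (d - I * ħ * ((n + 1 : ℕ) : ℂ)))
      (mul_ne_zero hΛc (inv_ne_zero hI)) (fun n => ?_) (h.tendsto_tailDown_nat hN hħ hd'.2) R
    · refine (summable_nat_add_iff 1).1 ((this.mul_left (‖r‖ * Real.exp R)).congr fun n => ?_)
      have hc : (((n + 1 : ℕ) : ℤ) : ℂ) = ((n + 1 : ℕ) : ℂ) := by push_cast; rfl
      have hc' : |(((n + 1 : ℕ) : ℤ) : ℝ)| = n + 1 := by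
        push_cast; exact abs_of_nonneg (by positivity)
      simp only
      rw [h12, hc, norm_mul, hc', mul_add, mul_one, Real.exp_add]
      ring
    · rw [h2 _ (by rw [(him _).2]; linarith [hnn (n + 1 + 1)]),
        h2 _ (by rw [(him _).2]; linarith [hnn (n + 1)]),
        ← h.QDown_sub hħ hΛ (by rw [(him _).2]; linarith [hnn (n + 1)])]
      congr 2
      push_cast
      ring
  · have := summable_norm_mul_exp_of_ratio (f := fun n : ℕ => Q₁ (d + I * ħ * ((n + 1 : ℕ) : ℂ)))
      (mul_ne_zero hΛc hI) (fun n => ?_) (h.tendsto_tailUp_nat hN hħ hd'.1) R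
    · refine (summable_nat_add_iff 1).1 ((this.mul_left (Real.exp R)).congr fun n => ?_)
      have hc : d - I * ħ * ((-((n + 1 : ℕ) : ℤ) : ℤ) : ℂ) = d + I * ħ * ((n + 1 : ℕ) : ℂ) := by
        push_cast; ring
      have hc' : |((-((n + 1 : ℕ) : ℤ) : ℤ) : ℝ)| = n + 1 := by
        push_cast; rw [abs_neg]; exact abs_of_nonneg (by positivity)
      simp only
      rw [hc, hc', mul_add, mul_one, Real.exp_add]
      ring
    · rw [h1 _ (by rw [(him _).1]; linarith [hnn (n + 1 + 1)]),
        h1 _ (by rw [(him _).1]; linarith [hnn (n + 1)]),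
        ← h.QUp_add hħ hΛ (by rw [(him _).1]; linarith [hnn (n + 1)])]
      congr 2
      push_cast
      ring

theorem RapidDecay.const_mul {c : ℤ → ℂ} (hc : RapidDecay c) (r : ℂ) :
    RapidDecay fun n => r * c n := fun R => by
  refine ((hc R).mul_left ‖r‖).congr fun n => ?_
  rw [norm_mul, mul_assoc]

theorem ofReal_div_cpow {a b : ℝ} (ha : 0 < a) (hb : 0 < b) (z : ℂ) :
    ((a / b : ℝ) : ℂ) ^ z = exp (z * ((Real.log a : ℂ) - (Real.log b : ℂ))) := by
  rw [Complex.cpow_def_of_ne_zero (by exact_mod_cast (div_pos ha hb).ne'),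
    ← Complex.ofReal_log (div_pos ha hb).le, Real.log_div ha.ne' hb.ne']
  push_cast
  ring_nf

theorem exp_logQPlus (hħ : 0 < ħ) (hΛ : 0 < Λ) {x : ℂ}
    (hx : ∀ k, 0 < (1 - I * (x - δ k) / ħ).re) :
    exp (logQPlus ħ δ Λ X x) = QPlusFormula ħ δ Λ X x := by
  rw [logQPlus, QPlusFormula, Complex.exp_sub, Complex.exp_sum,
    Finset.prod_congr rfl fun k _ => exp_logGamma (hx k), ofReal_div_cpow hħ hΛ, ← Complex.exp_add,
    ← Complex.exp_add]
  congr 2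

theorem exp_logQMinus (hħ : 0 < ħ) (hΛ : 0 < Λ) {x : ℂ}
    (hx : ∀ k, 0 < (1 + I * (x - δ k) / ħ).re) :
    exp (logQMinus ħ δ Λ X x) = QMinusFormula ħ δ Λ X x := by
  rw [logQMinus, QMinusFormula, Complex.exp_sub, Complex.exp_sum,
    Finset.prod_congr rfl fun k _ => exp_logGamma (hx k), ofReal_div_cpow hΛ hħ, ← Complex.exp_add,
    ← Complex.exp_add]
  congr 2

theorem re_one_sub_pos (hħ : 0 < ħ) {z : ℂ} (hz : |z.im| < ħ) :
    0 < (1 - I * z / ħ).re ∧ 0 < (1 + I * z / ħ).re := by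
  have h1 : (I * z / (ħ : ℂ)).re = -z.im / ħ := by
    rw [Complex.div_ofReal_re, Complex.I_mul_re]
  obtain ⟨h2, h3⟩ := abs_lt.1 hz
  rw [Complex.sub_re, Complex.add_re, h1, Complex.one_re]
  have h4 : -z.im / ħ < 1 := by rw [div_lt_one hħ]; linarith
  have h5 : -1 < -z.im / ħ := by rw [lt_div_iff₀ hħ]; linarith
  constructor <;> linarith

/-- A solution of the Baxter equation along a lattice is determined by two consecutive values. -/
theorem eq_zero_of_recurrence {u τ : ℤ → ℂ} {a b : ℂ} (ha : a ≠ 0) (hb : b ≠ 0)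
    (hu : ∀ n, τ n * u n = a * u (n - 1) + b * u (n + 1)) (h0 : u 0 = 0) (h1 : u 1 = 0) (n : ℤ) :
    u n = 0 := by
  have hpos : ∀ n : ℕ, u n = 0 ∧ u (n + 1) = 0 := by
    intro n
    induction n with
    | zero => exact ⟨by simpa using h0, by simpa using h1⟩
    | succ n ih =>
      refine ⟨by push_cast; exact ih.2, ?_⟩
      have := hu (n + 1)
      rw [ih.2, add_sub_cancel_right, ih.1, mul_zero, mul_zero, zero_add] at this
      push_cast
      exact (mul_eq_zero.1 this.symm).resolve_left hb
  have hneg : ∀ n : ℕ, u (-n) = 0 ∧ u (-n + 1) = 0 := by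
    intro n
    induction n with
    | zero => exact ⟨by simpa using h0, by simpa using h1⟩
    | succ n ih =>
      refine ⟨?_, by push_cast; rw [neg_add, neg_add_cancel_right]; exact ih.1⟩
      have := hu (-n)
      rw [ih.2, ih.1, mul_zero, mul_zero, add_zero] at this
      push_cast
      rw [neg_add, ← sub_eq_add_neg]
      exact (mul_eq_zero.1 this.symm).resolve_left ha
  rcases Int.eq_nat_or_neg n with ⟨m, rfl | rfl⟩
  · exact (hpos m).1
  · exact (hneg m).1

/-- Since ϑ(δ_j) = 0, T(δ_j) is the sum of the two tails. Subtracting the upward relation of Q⁺ from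
its Baxter equation shows that Q⁺ has the same ratio between δ_j - iħ and δ_j as Q⁻. So Qp - r Qm
vanishes at two consecutive lattice points, hence at all. -/
theorem IsFactorization.connection (h : IsFactorization ħ δ Λ X ε A B) (hħ : 0 < ħ) (hΛ : 0 < Λ)
    {T : Polynomial ℂ} (hT2 : ∀ x : ℂ, |x.im| < ħ / 2 → T.eval x =
        vartheta δ x * exp (-A (x + I * ħ / 2) - B (x - I * ħ / 2)) + tailUp ħ δ Λ A x +
          tailDown ħ δ Λ B x) {Qp Qm : ℂ → ℂ}
    (hp : ∀ x : ℂ, -(ħ / 2) < x.im → Qp x = QUp ħ δ Λ A x)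
    (hm : ∀ x : ℂ, x.im < ħ / 2 → Qm x = QDown ħ δ Λ B x)
    (hBp : IsBaxterSolution N ħ Λ T Qp) (hBm : IsBaxterSolution N ħ Λ T Qm) {j : Fin N}
    {r : ℂ} (hr : Qp (δ j) = r * Qm (δ j)) (n : ℤ) :
    Qp (δ j - I * ħ * n) = r * Qm (δ j - I * ħ * n) := by
  have hε := h.pos
  have hΛc : (Λ : ℂ) ^ N ≠ 0 := pow_ne_zero _ (by exact_mod_cast hΛ.ne')
  have hI : (I : ℂ) ^ N ≠ 0 := pow_ne_zero _ I_ne_zero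
  obtain ⟨g1, g2⟩ := h.im_gap j
  obtain ⟨i1, i2, i3, i4, i5, i6⟩ := im_shift (δ j) ħ
  have hb : (Λ : ℂ) ^ N * (I ^ N)⁻¹ ≠ 0 := mul_ne_zero hΛc (inv_ne_zero hI)
  refine sub_eq_zero.1 (eq_zero_of_recurrence
    (u := fun n : ℤ => Qp (δ j - I * ħ * n) - r * Qm (δ j - I * ħ * n))
    (τ := fun n : ℤ => T.eval (δ j - I * ħ * n)) (mul_ne_zero hΛc hI) hb (fun n => ?_)
    (by simp [hr]) ?_ n)
  · have h1 := hBp (δ j - I * ħ * n)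
    have h2 := hBm (δ j - I * ħ * n)
    rw [show δ j - I * ħ * n + I * ħ = δ j - I * ħ * ((n - 1 : ℤ) : ℂ) by push_cast; ring,
      show δ j - I * ħ * n - I * ħ = δ j - I * ħ * ((n + 1 : ℤ) : ℂ) by push_cast; ring] at h1 h2
    linear_combination h1 - r * h2
  · have hT := hT2 (δ j) (abs_lt.2 ⟨by linarith, by linarith⟩)
    have hv : vartheta δ (δ j) = 0 := Finset.prod_eq_zero (Finset.mem_univ j) (sub_self _)
    rw [hv, zero_mul, zero_add] at hT
    have hu := h.QUp_add hħ hΛ (x := δ j) (by linarith)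
    have hd := h.QDown_sub hħ hΛ (x := δ j) (by linarith)
    rw [← hp _ (by rw [i5]; linarith), ← hp _ (by linarith)] at hu
    rw [← hm _ (by rw [i6]; linarith), ← hm _ (by linarith)] at hd
    have h1 := hBp (δ j)
    rw [hT] at h1
    simp only [Int.cast_one, mul_one]
    refine mul_left_cancel₀ hb ?_
    linear_combination -h1 - hu - r * hd + tailDown ħ δ Λ B (δ j) * hr

end Connection

/-! ### Baxter data of a solution -/

theorem IsNLIESolution.exists_baxterData {N : ℕ} {ħ : ℝ} {δ : Fin N → ℂ} {Λ : ℝ} {X : ℝ → ℂ}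
    (hN : 2 ≤ N) (hħ : 0 < ħ) (hδ : δ ∈ strip N ħ) (hΛ : 0 < Λ) (h : IsNLIESolution ħ δ Λ X)
    (hre : ∀ μ, -(1 / 2) < (X μ).re) :
    ∃ (Qp Qm : ℂ → ℂ) (t : Polynomial ℂ), IsBaxterData ħ δ Λ X Qp Qm t ∧
      t.coeff (N - 1) = -∑ k, δ k ∧
      t.coeff (N - 1) ^ 2 / 2 - t.coeff (N - 2) = 1 / 2 * ∑ k, δ k ^ 2 +
        ħ / (2 * Real.pi) * ∫ μ, Complex.log (1 + X μ) ∧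
      ∀ j, Qp (δ j) = exp (logQPlus ħ δ Λ X (δ j)) ∧ Qm (δ j) = exp (logQMinus ħ δ Λ X (δ j)) ∧
        (∀ n : ℤ, Qp (δ j - I * ħ * n) =
          exp (logQPlus ħ δ Λ X (δ j) - logQMinus ħ δ Λ X (δ j)) * Qm (δ j - I * ħ * n)) ∧
        (RapidDecay fun n => Qp (δ j - I * ħ * n)) ∧
        RapidDecay fun n => Qm (δ j - I * ħ * n) := by
  have hN0 : N ≠ 0 := by omega
  obtain ⟨ε, A, B, hF⟩ := h.exists_factorization hN0 hħ hδ hΛ hre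
  obtain ⟨T, hdeg, hT1, hT2, hT3⟩ := hF.exists_transfer hħ hN0 hΛ
  obtain ⟨c0, c1, c2⟩ := transfer_coeff hF hħ hN (h.integrable_log hN0 hħ hδ hΛ hre) hdeg hT1
  obtain ⟨Qp, Qm, dp, dm, hp, hm, bp, bm⟩ := hF.exists_entire hN0 hħ hΛ hT1 hT3
  have hnat : T.natDegree = N := le_antisymm hdeg
    (Polynomial.le_natDegree_of_ne_zero (by rw [c0]; exact one_ne_zero))
  have hmonic : T.Monic := by rw [Polynomial.Monic, Polynomial.leadingCoeff, hnat, c0]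
  refine ⟨Qp, Qm, T, ⟨dp, dm, fun x hx => (hp x hx).trans (hF.QUp_eq hx),
    fun x hx => (hm x hx).trans (hF.QDown_eq hx), hmonic, hnat, bp, bm⟩, c1, c2, fun j => ?_⟩
  have him : ∀ k, |(δ j - δ k).im| < ħ := fun k => by
    have h1 := abs_lt.1 (hδ j)
    have h2 := abs_lt.1 (hδ k)
    rw [Complex.sub_im]
    exact abs_lt.2 ⟨by linarith, by linarith⟩
  have hj := abs_lt.1 (hδ j)
  have ep : Qp (δ j) = exp (logQPlus ħ δ Λ X (δ j)) := by
    rw [exp_logQPlus hħ hΛ fun k => (re_one_sub_pos hħ (him k)).1, hp _ hj.1, hF.QUp_eq hj.1]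
  have em : Qm (δ j) = exp (logQMinus ħ δ Λ X (δ j)) := by
    rw [exp_logQMinus hħ hΛ fun k => (re_one_sub_pos hħ (him k)).2, hm _ hj.2, hF.QDown_eq hj.2]
  have hcon := hF.connection hħ hΛ hT2 hp hm bp bm (j := j)
    (r := exp (logQPlus ħ δ Λ X (δ j) - logQMinus ħ δ Λ X (δ j)))
    (by rw [ep, em, ← Complex.exp_add, sub_add_cancel])
  have hdecay := hF.rapidDecay hN0 hħ hΛ (hδ j) hp hm hcon
  refine ⟨ep, em, hcon, hdecay, ?_⟩
  have := hdecay.const_mul (exp (logQPlus ħ δ Λ X (δ j) - logQMinus ħ δ Λ X (δ j)))⁻¹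
  refine cast (congrArg RapidDecay (funext fun n => ?_)) this
  rw [hcon, inv_mul_cancel_left₀ (Complex.exp_ne_zero _)]

/-! ### Uniqueness of generating functions -/

section Uniqueness

variable {N : ℕ} {ħ : ℝ} {D : Set ((Fin N → ℂ) × ℝ)} {η : (Fin N → ℂ) × ℝ → Fin N → ℂ}
  {S Y : (Fin N → ℂ) → ℝ → ℂ} {Λ : ℝ}

theorem eq_of_hasDerivAt_zero {g : ℝ → ℂ} (hg : ∀ s ∈ Set.Icc (0 : ℝ) 1, HasDerivAt g 0 s) :
    g 0 = g 1 :=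
  (constant_of_has_deriv_right_zero (fun s hs => (hg s hs).continuousAt.continuousWithinAt)
    (fun s hs => (hg s (Set.Ico_subset_Icc_self hs)).hasDerivWithinAt) 1 (by simp)).symm

theorem continuous_deltaOf (ħ : ℝ) : Continuous (deltaOf ħ : (Fin N → ℂ) → Fin N → ℂ) :=
  continuous_const_smul _

/-- The difference of two generating functions is constant along segments. -/
theorem sub_eq_sub_of_segment (hS : IsGeneratingFunctionAt ħ D η S Λ)
    (hY : IsGeneratingFunctionAt ħ D η Y Λ) {σ τ : Fin N → ℂ} (hσ : ∑ j, σ j = 0)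
    (hτ : ∑ j, τ j = 0)
    (hseg : ∀ s ∈ Set.Icc (0 : ℝ) 1, (σ + s • (τ - σ), Λ) ∈ operDomain ħ D) :
    S σ Λ - Y σ Λ = S τ Λ - Y τ Λ := by
  have hv : ∑ j, (τ - σ) j = 0 := by simp [Finset.sum_sub_distrib, hσ, hτ]
  have := eq_of_hasDerivAt_zero
    (g := fun s : ℝ => S (σ + s • (τ - σ)) Λ - Y (σ + s • (τ - σ)) Λ) fun s hs => ?_
  · simpa using this
  -- The complex directional derivatives cancel; recentring at s and restricting to real parameters
  -- gives the derivative along the segment.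
  · have h1 := (hS _ (hseg s hs) (τ - σ) hv).sub (hY _ (hseg s hs) (τ - σ) hv)
    have h2 := (HasDerivAt.comp_sub_const (s : ℂ) (s : ℂ)
      (by rw [sub_self (s : ℂ)]; exact h1.congr_deriv (sub_self _))).comp_ofReal
    refine h2.congr_of_eventuallyEq (Eventually.of_forall fun u => ?_)
    have : σ + s • (τ - σ) + ((u : ℂ) - s) • (τ - σ) = σ + u • (τ - σ) := by
      ext j
      simp
      ring
    simp only [Pi.sub_apply, this]

theorem HasLogDeriv.hasDerivAt {f : ℝ → ℂ} {c : ℂ} (hN : N ≠ 0) (hħ : ħ ≠ 0) (hΛ : 0 < Λ)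
    (h : HasLogDeriv N ħ f c Λ) : HasDerivAt f ((2 * N * Λ⁻¹ : ℝ) • (c / (I * ħ))) Λ := by
  obtain ⟨d, hd, rfl⟩ := h
  have hħc : (ħ : ℂ) ≠ 0 := by exact_mod_cast hħ
  have hNr : (N : ℝ) ≠ 0 := by exact_mod_cast hN
  have hlog : Real.log (Λ ^ (2 * N)) = 2 * N * Real.log Λ := by rw [Real.log_pow]; push_cast; ring
  rw [hlog] at hd
  have h1 : HasDerivAt (fun M : ℝ => 2 * N * Real.log M) (2 * N * Λ⁻¹) Λ :=
    (Real.hasDerivAt_log hΛ.ne').const_mul _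
  rw [mul_div_cancel_left₀ _ (mul_ne_zero I_ne_zero hħc)]
  refine (hd.scomp Λ h1).congr_of_eventuallyEq ?_
  filter_upwards [lt_mem_nhds hΛ] with M hM
  rw [Function.comp, mul_div_cancel_left₀ _ (by positivity), Real.exp_log hM]

/-- In the max metric of the product the two coordinates may be contracted independently, which
allows moving first in Λ and then in σ. -/
theorem operDomain_segment_mem {σ τ : Fin N → ℂ} {Λ M : ℝ} {r : ℝ}
    (hball : ∀ q ∈ Metric.ball (σ, Λ) r, (deltaOf ħ q.1, q.2) ∈ D) (hσ : ∑ j, σ j = 0)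
    (hτ : ∑ j, τ j = 0) (hq : (τ, M) ∈ Metric.ball (σ, Λ) r) {s u : ℝ}
    (hs : s ∈ Set.Icc (0 : ℝ) 1) (hu : u ∈ Set.Icc (0 : ℝ) 1) :
    (σ + s • (τ - σ), Λ + u * (M - Λ)) ∈ operDomain ħ D := by
  refine ⟨?_, hball _ ?_⟩
  · simp [Finset.sum_add_distrib, ← Finset.mul_sum, Finset.sum_sub_distrib, hσ, hτ]
  · rw [Metric.mem_ball, Prod.dist_eq, max_lt_iff] at hq ⊢
    rw [dist_eq_norm, dist_eq_norm] at hq ⊢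
    constructor
    · rw [add_sub_cancel_left, norm_smul, Real.norm_of_nonneg hs.1]
      exact (mul_le_of_le_one_left (norm_nonneg _) hs.2).trans_lt hq.1
    · rw [add_sub_cancel_left, norm_mul, Real.norm_of_nonneg hu.1]
      exact (mul_le_of_le_one_left (norm_nonneg _) hu.2).trans_lt hq.2

theorem exists_ball_deltaOf_mem (hD : IsOpen D) {σ : Fin N → ℂ} {Λ : ℝ}
    (h : (σ, Λ) ∈ operDomain ħ D) :
    ∃ r > 0, ∀ q ∈ Metric.ball (σ, Λ) r, (deltaOf ħ q.1, q.2) ∈ D :=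
  Metric.isOpen_iff.1 (hD.preimage (((continuous_deltaOf ħ).comp continuous_fst).prodMk
    continuous_snd)) (σ, Λ) h.2

/-- A generating function of the oper locus is unique up to a constant. -/
theorem IsGeneratingFunctionAt.exists_eq_add_const (hD : IsOpen D)
    (hS : IsGeneratingFunctionAt ħ D η S Λ) (hY : IsGeneratingFunctionAt ħ D η Y Λ)
    (hconn : IsPreconnected {σ | (σ, Λ) ∈ operDomain ħ D}) :
    ∃ c : ℂ, ∀ σ, (σ, Λ) ∈ operDomain ħ D → S σ Λ = Y σ Λ + c := by
  rcases Set.eq_empty_or_nonempty {σ | (σ, Λ) ∈ operDomain ħ D} with h0 | ⟨σ₀, h₀⟩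
  · exact ⟨0, fun σ hσ => absurd (show σ ∈ {σ | (σ, Λ) ∈ operDomain ħ D} from hσ) (by simp [h0])⟩
  refine ⟨S σ₀ Λ - Y σ₀ Λ, fun σ hσ => ?_⟩
  -- Having the same difference S - Y is an equivalence relation that holds near every point, so
  -- preconnectedness spreads it over the domain.
  have := hconn.induction₂ (fun σ τ => S σ Λ - Y σ Λ = S τ Λ - Y τ Λ) ?_
    (fun _ _ _ _ _ _ h1 h2 => h1.trans h2) (fun _ _ _ _ h1 => h1.symm) hσ h₀
  · linear_combination this
  intro σ hσ
  obtain ⟨r, hr, hball⟩ := exists_ball_deltaOf_mem hD hσ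
  filter_upwards [self_mem_nhdsWithin, mem_nhdsWithin_of_mem_nhds (Metric.ball_mem_nhds σ hr)]
    with τ hτ hτr
  refine sub_eq_sub_of_segment hS hY hσ.1 hτ.1 fun s hs => ?_
  have := operDomain_segment_mem (M := Λ) hball hσ.1 hτ.1 (by
    rw [Metric.mem_ball, Prod.dist_eq, dist_self, max_eq_left dist_nonneg]
    exact hτr) hs (u := 0) (by simp)
  simpa using this

/-- Generating functions for all `Λ`, with the same derivatives along `log Λ`, agree up to a
constant. -/
theorem exists_eq_add_const_of_hasLogDeriv (hD : IsOpen D) (hpos : ∀ p ∈ D, 0 < p.2) (hN : N ≠ 0)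
    (hħ : ħ ≠ 0) (hS : ∀ Λ, IsGeneratingFunctionAt ħ D η S Λ)
    (hY : ∀ Λ, IsGeneratingFunctionAt ħ D η Y Λ) {E : (Fin N → ℂ) → ℝ → ℂ}
    (hSE : ∀ σ Λ, (σ, Λ) ∈ operDomain ħ D → HasLogDeriv N ħ (S σ) (E σ Λ) Λ)
    (hYE : ∀ σ Λ, (σ, Λ) ∈ operDomain ħ D → HasLogDeriv N ħ (Y σ) (E σ Λ) Λ)
    (hconn : IsPreconnected (operDomain ħ D)) :
    ∃ c : ℂ, ∀ σ Λ, (σ, Λ) ∈ operDomain ħ D → S σ Λ = Y σ Λ + c := by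
  rcases Set.eq_empty_or_nonempty (operDomain ħ D) with h0 | ⟨⟨σ₀, Λ₀⟩, h₀⟩
  · exact ⟨0, fun σ Λ hσ => absurd hσ (by simp [h0])⟩
  refine ⟨S σ₀ Λ₀ - Y σ₀ Λ₀, fun σ Λ hσ => ?_⟩
  have := hconn.induction₂ (fun p q => S p.1 p.2 - Y p.1 p.2 = S q.1 q.2 - Y q.1 q.2) ?_
    (fun _ _ _ _ _ _ h1 h2 => h1.trans h2) (fun _ _ _ _ h1 => h1.symm) hσ h₀
  · linear_combination this
  rintro ⟨σ, Λ⟩ hσ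
  obtain ⟨r, hr, hball⟩ := exists_ball_deltaOf_mem hD hσ
  filter_upwards [self_mem_nhdsWithin,
    mem_nhdsWithin_of_mem_nhds (Metric.ball_mem_nhds (σ, Λ) hr)]
  rintro ⟨τ, M⟩ hτ hτr
  -- The passage from (σ, Λ) to (τ, M) is made through (σ, M): the Λ-derivatives control this leg,
  -- the generating function property the other.
  have h1 : S σ Λ - Y σ Λ = S σ M - Y σ M := by
    have := eq_of_hasDerivAt_zero
      (g := fun s : ℝ => S σ (Λ + s * (M - Λ)) - Y σ (Λ + s * (M - Λ))) fun s hs => ?_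
    · simpa using this
    · have hmem := operDomain_segment_mem hball hσ.1 hτ.1 hτr (s := 0) (by simp) hs
      rw [zero_smul, add_zero] at hmem
      have hp : 0 < Λ + s * (M - Λ) := hpos _ hmem.2
      have d1 := ((hSE _ _ hmem).hasDerivAt hN hħ hp).sub ((hYE _ _ hmem).hasDerivAt hN hħ hp)
      rw [sub_self] at d1
      have d2 : HasDerivAt (fun s : ℝ => Λ + s * (M - Λ)) (1 * (M - Λ)) s :=
        ((hasDerivAt_id s).mul_const _).const_add _
      exact (d1.scomp s d2).congr_deriv (smul_zero _)
  refine h1.trans (sub_eq_sub_of_segment (hS M) (hY M) hσ.1 hτ.1 fun s hs => ?_)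
  have := operDomain_segment_mem hball hσ.1 hτ.1 hτr hs (u := 1) (by simp)
  simpa using this

end Uniqueness

end

end TodaYangYang

/-! ### Assembly of the theorem -/

open TodaYangYang in
theorem mainTheorem1 (N : ℕ) (hN : 2 ≤ N) (ħ : ℝ) (hħ : 0 < ħ) :
    -- the function `ϖ` satisfies `ϖ'(x) = log Γ(1 + i x / ħ)`
    (∀ x : ℂ, x.im < ħ →
      HasDerivAt (varpi ħ) (logGamma (1 + Complex.I * x / ħ)) x) ∧
    -- families of solutions exist for small `Λ`
    (∃ Λ₀ : (Fin N → ℂ) → ℝ, ContinuousOn Λ₀ (strip N ħ) ∧ (∀ δ ∈ strip N ħ, 0 < Λ₀ δ) ∧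
      ∃ X : (Fin N → ℂ) × ℝ → ℝ → ℂ,
        IsSolutionFamily ħ {p | p.1 ∈ strip N ħ ∧ 0 < p.2 ∧ p.2 < Λ₀ p.1} X) ∧
    -- for every family of solutions:
    ∀ (D : Set ((Fin N → ℂ) × ℝ)) (X : (Fin N → ℂ) × ℝ → ℝ → ℂ), IsSolutionFamily ħ D X →
      ∃ (Qp Qm : (Fin N → ℂ) × ℝ → ℂ → ℂ) (t : (Fin N → ℂ) × ℝ → Polynomial ℂ),
        (∀ (δ : Fin N → ℂ) (Λ : ℝ), (δ, Λ) ∈ D →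
          IsBaxterData ħ δ Λ (X (δ, Λ)) (Qp (δ, Λ)) (Qm (δ, Λ)) (t (δ, Λ)) ∧
          (t (δ, Λ)).coeff (N - 1) = -∑ j, δ j ∧
          -- the Floquet solutions at `0` and at `∞`, and their connection coefficients
          (∀ j, (∀ w, Summable (floquetTerm ħ (Qp (δ, Λ)) (δ j) w)) ∧
            (∀ w, Summable (floquetTerm ħ (Qm (δ, Λ)) (δ j) w)) ∧
            IsOperSolution N ħ Λ (t (δ, Λ)) (floquet ħ (Qp (δ, Λ)) (δ j)) ∧
            IsOperSolution N ħ Λ (t (δ, Λ)) (floquet ħ (Qm (δ, Λ)) (δ j)) ∧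
            Qp (δ, Λ) (δ j) = Complex.exp (logQPlus ħ δ Λ (X (δ, Λ)) (δ j)) ∧
            Qm (δ, Λ) (δ j) = Complex.exp (logQMinus ħ δ Λ (X (δ, Λ)) (δ j)) ∧
            (∀ n : ℤ, Qp (δ, Λ) (δ j - Complex.I * ħ * n) =
              Complex.exp (2 * Real.pi * Complex.I * eta ħ X (δ, Λ) j) *
                Qm (δ, Λ) (δ j - Complex.I * ħ * n)) ∧
            ∀ w, floquet ħ (Qp (δ, Λ)) (δ j) w =
              Complex.exp (2 * Real.pi * Complex.I * eta ħ X (δ, Λ) j) *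
                floquet ħ (Qm (δ, Λ)) (δ j) w) ∧
          (Function.Injective δ →
            LinearIndependent ℂ (fun j => floquet ħ (Qp (δ, Λ)) (δ j)) ∧
            LinearIndependent ℂ (fun j => floquet ħ (Qm (δ, Λ)) (δ j))) ∧
          -- `∂𝒴/∂δ_j = 2πi η_j`
          (∀ j, HasDerivAt (fun s : ℂ => YangYang ħ X (Function.update δ j s) Λ)
            (2 * Real.pi * Complex.I * eta ħ X (δ, Λ) j) (δ j)) ∧
          -- `iħ ∂𝒴/∂ log Λ^{2N} = E₁²/2 - E₂`, which is `-E₂` if `∑ δ_j = 0`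
          HasLogDeriv N ħ (fun Λ' => YangYang ħ X δ Λ')
            ((t (δ, Λ)).coeff (N - 1) ^ 2 / 2 - (t (δ, Λ)).coeff (N - 2)) Λ ∧
          (∑ j, δ j = 0 →
            HasLogDeriv N ħ (fun Λ' => YangYang ħ X δ Λ') (-(t (δ, Λ)).coeff (N - 2)) Λ)) ∧
        -- `∂𝒮/∂σ_j = 2πħ η_j` for `𝒮(σ, Λ) = 𝒴(-iħσ, Λ)`
        (∀ (σ : Fin N → ℂ) (Λ : ℝ), (deltaOf ħ σ, Λ) ∈ D → ∀ j,
          HasDerivAt (fun s : ℂ => YangYang ħ X (deltaOf ħ (Function.update σ j s)) Λ)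
            (2 * Real.pi * ħ * eta ħ X (deltaOf ħ σ, Λ) j) (σ j)) ∧
        -- `𝒴(-iħσ, Λ)` is a generating function of the oper locus
        (∀ Λ, IsGeneratingFunctionAt ħ D (eta ħ X) (fun σ Λ => YangYang ħ X (deltaOf ħ σ) Λ) Λ) ∧
        -- every generating function agrees with it, up to an additive function of `Λ`
        (∀ (S : (Fin N → ℂ) → ℝ → ℂ) (Λ : ℝ), IsGeneratingFunctionAt ħ D (eta ħ X) S Λ →
          IsPreconnected {σ | (σ, Λ) ∈ operDomain ħ D} →
          ∃ c : ℂ, ∀ σ, (σ, Λ) ∈ operDomain ħ D → S σ Λ = YangYang ħ X (deltaOf ħ σ) Λ + c) ∧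
        -- and up to an additive constant, if also `iħ ∂𝒮/∂ log Λ^{2N} = -E₂`
        (∀ S : (Fin N → ℂ) → ℝ → ℂ, (∀ Λ, IsGeneratingFunctionAt ħ D (eta ħ X) S Λ) →
          (∀ σ Λ, (σ, Λ) ∈ operDomain ħ D →
            HasLogDeriv N ħ (S σ) (-(t (deltaOf ħ σ, Λ)).coeff (N - 2)) Λ) →
          IsPreconnected (operDomain ħ D) →
          ∃ c : ℂ, ∀ σ Λ, (σ, Λ) ∈ operDomain ħ D →
            S σ Λ = YangYang ħ X (deltaOf ħ σ) Λ + c) := by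
  have hN0 : N ≠ 0 := by omega
  refine ⟨fun x hx => hasDerivAt_varpi hħ hx, exists_solutionFamily hN0 hħ, fun D X hX => ?_⟩
  -- Membership in D is placed inside the existential so that the choice gives functions on the
  -- whole parameter space; the values outside D are arbitrary.
  have hdata : ∀ p : (Fin N → ℂ) × ℝ, ∃ (Qp Qm : ℂ → ℂ) (t : Polynomial ℂ), p ∈ D →
      IsBaxterData ħ p.1 p.2 (X p) Qp Qm t ∧ t.coeff (N - 1) = -∑ k, p.1 k ∧
      t.coeff (N - 1) ^ 2 / 2 - t.coeff (N - 2) = 1 / 2 * ∑ k, p.1 k ^ 2 +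
        ħ / (2 * Real.pi) * ∫ μ, Complex.log (1 + X p μ) ∧
      ∀ j, Qp (p.1 j) = Complex.exp (logQPlus ħ p.1 p.2 (X p) (p.1 j)) ∧
        Qm (p.1 j) = Complex.exp (logQMinus ħ p.1 p.2 (X p) (p.1 j)) ∧
        (∀ n : ℤ, Qp (p.1 j - Complex.I * ħ * n) =
          Complex.exp (2 * Real.pi * Complex.I * eta ħ X p j) *
            Qm (p.1 j - Complex.I * ħ * n)) ∧
        (RapidDecay fun n => Qp (p.1 j - Complex.I * ħ * n)) ∧
        RapidDecay fun n => Qm (p.1 j - Complex.I * ħ * n) := by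
    intro p
    by_cases hp : p ∈ D
    · obtain ⟨Qp, Qm, t, h⟩ := (hX.solution p hp).exists_baxterData hN hħ (hX.mem_strip p hp)
        (hX.pos p hp) (hX.contracting p hp)
      simp only [two_pi_I_mul_eta]
      exact ⟨Qp, Qm, t, fun _ => h⟩
    · exact ⟨0, 0, 0, fun h => absurd h hp⟩
  choose Qp Qm t H using hdata
  have hlog : ∀ δ Λ, (δ, Λ) ∈ D → HasLogDeriv N ħ (fun Λ' => YangYang ħ X δ Λ')
      ((t (δ, Λ)).coeff (N - 1) ^ 2 / 2 - (t (δ, Λ)).coeff (N - 2)) Λ := fun δ Λ hp => by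
    rw [(H _ hp).2.2.1]
    exact hX.hasLogDeriv_YangYang hN0 hħ hp
  have hlog0 : ∀ δ Λ, (δ, Λ) ∈ D → ∑ j, δ j = 0 → HasLogDeriv N ħ (fun Λ' => YangYang ħ X δ Λ')
      (-(t (δ, Λ)).coeff (N - 2)) Λ := fun δ Λ hp h0 => by
    have := hlog δ Λ hp
    rw [(H _ hp).2.1] at this
    simpa [h0] using this
  have hgen : ∀ Λ, IsGeneratingFunctionAt ħ D (eta ħ X)
      (fun σ Λ => YangYang ħ X (deltaOf ħ σ) Λ) Λ := by
    intro Λ σ hσ v _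
    -- The direction v in σ is the direction -iħv in δ, and 2πi · (-iħ) = 2πħ.
    refine (hX.hasDerivAt_YangYang_of_line hN0 hħ hσ.2 (deltaOf ħ v) fun s => ?_).congr_deriv ?_
    · ext j
      simp [deltaOf]
      ring
    · rw [Finset.mul_sum, Finset.mul_sum]
      refine Finset.sum_congr rfl fun j _ => ?_
      simp only [deltaOf, Pi.smul_apply, smul_eq_mul]
      linear_combination (-2 * Real.pi * ħ * eta ħ X ((-(Complex.I * ħ)) • σ, Λ) j * v j) *
        Complex.I_sq
  refine ⟨Qp, Qm, t, fun δ Λ hp => ?_, fun σ Λ hp j => ?_, hgen,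
    fun S Λ hS hconn => hS.exists_eq_add_const hX.isOpen (hgen Λ) hconn,
    fun S hS hSE hconn => exists_eq_add_const_of_hasLogDeriv hX.isOpen hX.pos hN0 hħ.ne' hS hgen
      hSE (fun σ Λ hσ => hlog0 _ _ hσ.2 ?_) hconn⟩
  · obtain ⟨hB, h1, -, hj⟩ := H _ hp
    have hδ := hX.mem_strip _ hp
    refine ⟨hB, h1, fun j => ?_, fun hinj => ⟨?_, ?_⟩, fun j => ?_, hlog δ Λ hp, hlog0 δ Λ hp⟩
    · obtain ⟨ep, em, hc, dp, dm⟩ := hj j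
      refine ⟨fun w => dp.summable _ w, fun w => dm.summable _ w,
        isOperSolution_floquet hħ hB.baxter_plus dp, isOperSolution_floquet hħ hB.baxter_minus dm,
        ep, em, hc, fun w => ?_⟩
      rw [floquet, floquet, ← tsum_mul_left]
      refine tsum_congr fun n => ?_
      rw [floquetTerm, floquetTerm, hc n, mul_assoc]
    · exact linearIndependent_floquet hħ hδ hinj (fun j => (hj j).2.2.2.1) fun j => by
        rw [(hj j).1]; exact Complex.exp_ne_zero _
    · exact linearIndependent_floquet hħ hδ hinj (fun j => (hj j).2.2.2.2) fun j => by
        rw [(hj j).2.1]; exact Complex.exp_ne_zero _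
    · refine (hX.hasDerivAt_YangYang_of_line hN0 hħ hp (Pi.single j 1) fun s => ?_).congr_deriv ?_
      · ext k
        by_cases hk : k = j
        · subst hk; simp
        · simp [hk]
      · simp [Pi.single_apply]
  · refine (hX.hasDerivAt_YangYang_of_line hN0 hħ hp (deltaOf ħ (Pi.single j 1))
      fun s => ?_).congr_deriv ?_
    · ext k
      by_cases hk : k = j
      · subst hk; simp [deltaOf]; ring
      · simp [deltaOf, hk]
    · generalize eta ħ X (deltaOf ħ σ, Λ) = e
      simp [deltaOf, Pi.single_apply]
      linear_combination (-2 * Real.pi * ħ * e j) * Complex.I_sq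
  · simp [deltaOf, ← Finset.mul_sum, hσ.1]
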